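/- **Setting.** Fix $\gamma>1$, $0<\alpha<1$, $0<r_1<r_s<r_2$, $0<\theta_0<\pi/2$, and put $E=(-\theta_0,\theta_0)\times(-1,1)$, $\Omega=(r_1,r_2)\times E$, $\mathbb D=(r_s,r_2)\times E$, with points $(y_1,y')$, $y'=(y_2,y_3)$; on $\Omega$ write also $(r,\theta,x_3)$. For constants put $c^2(\rho,K)=\gamma K\rho^{\gamma-1}$. *Background.* Let $(\bar U^\pm,\bar\rho^\pm)(r)$ be smooth and positive, $\bar K^\pm>0$ constants, $\bar P^\pm=\bar K^\pm(\bar\rho^\pm)^\gamma$, with $(\bar\rho\bar U)'+\bar\rho\bar U/r=0$, $\bar U\bar U'+\bar P'/\bar\rho=0$; the "$-$" state is defined on $[r_1,r_2]$ and supersonic ($(\bar U^-)^2>c^2$), the "$+$" state is defined on $[r_b,r_2]$ for some $r_1\le r_b<r_s$ and subsonic ($(\bar U^+)^2<c^2$). Put $\bar B^\pm=\frac12(\bar U^\pm)^2+\frac{\gamma}{\gamma-1}\bar K^\pm(\bar\rho^\pm)^{\gamma-1}$ (constants) and assume at $r=r_s$ that $[\bar\rho\bar U]=[\bar\rho\bar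 U^2+\bar P]=[\bar B]=0$, $\bar K^+>\bar K^-$, where $[\cdot]$ is the "$+$" value minus the "$-$" value. With "$+$" values at $r_s$, $c^2=c^2(\bar\rho^+(r_s),\bar K^+)$, $\bar M^2=\bar U^2/c^2$, put $$a_0=\frac{\bar\rho\bar U}{[\bar P(r_s)]},\quad a_1=\frac{\gamma\bar U[\bar P(r_s)]}{r_s\bar\rho(c^2-\bar U^2)},\quad a_3=\frac{(\gamma-1)\bar M^2+1}{\gamma\bar M^2},\quad a_4=a_0a_1a_3 .$$ *Incoming flow.* Let $d=(U_{1,0}^-,U_{2,0}^-,U_{3,0}^-,P_0^-,K_0^-)\in C^{2,\alpha}(\overline E)^5$ satisfy, at $\theta=\pm\theta_0$, $U_{2,0}^-=\partial_\theta^2U_{2,0}^-=\partial_\theta(U_{1,0}^-,U_{3,0}^-,P_0^-,K_0^-)=0$, and, at $x_3=\pm1$, $U_{3,0}^-=\partial_{x_3}^2U_{3,0}^-=\partial_{x_3}(U_{1,0}^-,U_{2,0}^-,P_0^-,K_0^-)=0$. For $\epsilon,C_0>0$, an *incoming flow* $\Psi^-=(U_1^-,U_2^-,U_3^-,P^-,K^-)\in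 C^{2,\alpha}(\overline\Omega)^5$ is a solution of the steady polytropic Euler system in cylindrical coordinates $$\begin{cases}\partial_r(\rho U_1)+\frac1r\rho U_1+\frac1r\partial_\theta(\rho U_2)+\partial_{x_3}(\rho U_3)=0,\\ LU_1+\frac1\rho\partial_rP-\frac{U_2^2}r=0,\quad LU_2+\frac1{r\rho}\partial_\theta P+\frac{U_1U_2}r=0,\\ LU_3+\frac1\rho\partial_{x_3}P=0,\quad LK=0,\end{cases}\qquad L=U_1\partial_r+\tfrac{U_2}r\partial_\theta+U_3\partial_{x_3},\ \ \rho=(P/K)^{1/\gamma},$$ in $\Omega$ with $\Psi^-(r_1,\cdot)=(\bar U^-(r_1),0,0,\bar P^-(r_1),\bar K^-)+\epsilon\, d$, with $U_2^-=0$ at $\theta=\pm\theta_0$, $U_3^-=0$ at $x_3=\pm1$, and with the sum of the $C^{2,\alpha}(\overline\Omega)$ norms of the components of $\Psi^--(\bar U^-,0,0,\bar P^-,\bar K^-)$ at most $C_0\epsilon$. Let $\rho^-$ be its density and $B^-=\frac12|U^-|^2+\frac\gamma{\gamma-1}K^-(\rho^-)^{\gamma-1}$. *The class $\mathcal X$.*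 For $\delta_0>0$ let $\mathcal X$ be the set of $(\hat V_1,\dots,\hat V_5,\hat V_6)\in C^{2,\alpha}(\overline{\mathbb D})^5\times C^{3,\alpha}(\overline E)$ with sum of norms at most $\delta_0$ and, at $y_2=\pm\theta_0$, $\hat V_2=\partial_2^2\hat V_2=\partial_2(\hat V_1,\hat V_3,\hat V_4,\hat V_5)=0$, $\partial_2\hat V_6=\partial_2^3\hat V_6=0$; at $y_3=\pm1$, $\hat V_3=\partial_3^2\hat V_3=\partial_3(\hat V_1,\hat V_2,\hat V_4,\hat V_5)=0$, $\partial_3\hat V_6=\partial_3^3\hat V_6=0$. *Source term.* Given $\Psi^-$ and $(\hat V,\hat V_6)\in\mathcal X$, evaluate $\hat V_j$ at $(r_s,y')$, put $\xi=r_s+\hat V_6(y')$, evaluate $\Psi^-$ at $(\xi,y')$, and put $U_1^+=\bar U^+(\xi)+\hat V_1$, $U_2^+=\hat V_2$, $U_3^+=\hat V_3$, $h=\bar B^++\hat V_5-\frac12|U^+|^2$, $$\rho^+=\Big(\tfrac{\gamma-1}{\gamma(\bar K^++\hat V_4)}\Big)^{\frac1{\gamma-1}}h^{\frac1{\gamma-1}},\qquad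 P^+=\Big(\tfrac{\gamma-1}\gamma\Big)^{\frac\gamma{\gamma-1}}\Big(\tfrac1{\bar K^++\hat V_4}\Big)^{\frac1{\gamma-1}}h^{\frac\gamma{\gamma-1}},\qquad \dot\rho=\rho^+-\bar\rho^+(\xi).$$ With $[f]=f^+-f^-$ put $J=[\rho U_2^2+P][\rho U_3^2+P]-[\rho U_2U_3]^2$, $J_2=[\rho U_3^2+P][\rho U_1U_2]-[\rho U_1U_3][\rho U_2U_3]$, $J_3=[\rho U_2^2+P][\rho U_1U_3]-[\rho U_1U_2][\rho U_2U_3]$, $$g_2=\frac1{r_s}\Big(\frac{\xi J_2}{J}-a_0r_s\hat V_2\Big),\qquad g_3=\frac{J_3}{J}-a_0\hat V_3,$$ $$R_{01}=-[\bar\rho\bar U](\xi)+\rho^-U_1^--(\bar\rho^-\bar U^-)(\xi)-(\hat V_1+\bar U^+(\xi)-\bar U^+(r_s))\dot\rho+\tfrac{[\rho U_2]J_2+[\rho U_3]J_3}{J}-(\bar\rho^+(\xi)-\bar\rho^+(r_s))\hat V_1,$$ $$\begin{aligned}R_{02}=&-\{[\bar\rho\bar U^2+\bar P](\xi)-\tfrac1{r_s}[\bar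 P(r_s)]\hat V_6\}+\rho^-(U_1^-)^2+P^--(\bar\rho^-(\bar U^-)^2+\bar P^-)(\xi)\\&-\{\rho^+(U_1^+)^2+P^+-(\bar\rho^+(\bar U^+)^2+\bar P^+)(\xi)-2(\bar\rho^+\bar U^+)(r_s)\hat V_1-(\bar U^+(r_s)^2+c^2)\dot\rho-\bar\rho^+(r_s)^\gamma\hat V_4\}\\&+\tfrac{[\rho U_1U_2]J_2+[\rho U_1U_3]J_3}{J},\end{aligned}$$ $$\begin{aligned}R_{03}=&\,B^--\bar B^--\bar U^+(\xi)\hat V_1-\tfrac12\textstyle\sum_{j\le3}\hat V_j^2+\bar U^+(r_s)\hat V_1-\tfrac\gamma{\gamma-1}\{(\bar K^++\hat V_4)(\rho^+)^{\gamma-1}-\bar K^+\bar\rho^+(\xi)^{\gamma-1}\}\\&+\tfrac{c^2}{\bar\rho^+(r_s)}\dot\rho+\tfrac{\gamma\bar\rho^+(r_s)^{\gamma-1}}{\gamma-1}\hat V_4,\end{aligned}$$ and, with background "$+$" values at $r_s$, $$R_1=\frac{(c^2+\gamma\bar U^2)R_{01}-\gamma\bar UR_{02}+(\gamma-1)\bar\rho\bar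 UR_{03}}{\bar\rho(c^2-\bar U^2)},\qquad q_1=a_1\Big(\frac1{r_s}\partial_2g_2+\partial_3g_3\Big)+\Big(\frac1{r_s^2}\partial_2^2+\partial_3^2\Big)R_1 .$$ Let $\dot V=(\dot V_1,\dot V_2,\dot V_3)\in C^{2,\alpha}(\overline{\mathbb D})^3$ be any solution of the div-curl system $$\begin{cases}\partial_1\dot V_1+\frac{\dot V_1}{y_1}+\frac1{y_1}\partial_2\dot V_2+\partial_3\dot V_3=0,\quad \frac1{y_1}\partial_2\dot V_3-\partial_3\dot V_2=\tilde G_1,\\ \partial_3\dot V_1-\partial_1\dot V_3=\tilde G_2,\quad \partial_1\dot V_2-\frac1{y_1}\partial_2\dot V_1+\frac{\dot V_2}{y_1}=\tilde G_3\end{cases}\quad\text{in }\mathbb D$$ for some sources $\tilde G_i\in C^{1,\alpha}(\overline{\mathbb D})$, with $\dot V_1=0$ at $y_1=r_s,r_2$, $\dot V_2=0$ at $y_2=\pm\theta_0$, $\dot V_3=0$ at $y_3=\pm1$. Put $$q_5(y')=q_1(y')+a_0a_1\Big(\frac1{r_s}\partial_2\dot V_2+\partial_3\dot V_3\Big)(r_s,y').$$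 *Potential.* A *front potential* is a function $\phi\in C^3(\overline{\mathbb D})$ such that $v_\phi(y'):=\partial_{1}\phi(r_s,y')-a_4\phi(r_s,y')$ satisfies $$\Big(\frac1{r_s^2}\partial_2^2+\partial_3^2\Big)v_\phi=a_3q_5\ \text{in }E,\qquad \frac1{r_s}\partial_2v_\phi(\pm\theta_0,y_3)=0,\quad\partial_3v_\phi(y_2,\pm1)=0 .$$ These conditions are unchanged when a constant is added to $\phi$. **Lemma (the oblique boundary condition on the shock front).** For every background, $\alpha$, $d$ and $C_0>0$ as above there are $\epsilon_0>0$ and $\delta_0>0$ such that for all $0<\epsilon<\epsilon_0$, every incoming flow $\Psi^-$, every $(\hat V,\hat V_6)\in\mathcal X$ and every $\dot V$ as above: 1. $q_5$ is integrable and $\iint_Eq_5\,dy'=0$. 2. There is a unique $m_1\in C^{2,\alpha}(\overline E)$ with $$\Big(\frac1{r_s^2}\partial_2^2+\partial_3^2\Big)m_1=a_3q_5\ \text{in }E,\quad\frac1{r_s}\partial_2m_1(\pm\theta_0,y_3)=0,\quad\partial_3m_1(y_2,\pm1)=0,\quad\iint_Em_1\,dy'=0$$ (the Neumann conditions for all $y_3\in[-1,1]$,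 resp. $y_2\in[-\theta_0,\theta_0]$). 3. For every front potential $\phi$ there is exactly one constant $c$ such that $\phi+c$ satisfies the oblique boundary condition $\partial_{1}(\phi+c)(r_s,y')-a_4(\phi+c)(r_s,y')=m_1(y')$ for all $y'\in\overline E$. If $\phi$ is normalized by $\iint_E(\partial_{1}\phi-a_4\phi)(r_s,y')\,dy'=0$, then $c=0$, that is, $\partial_{1}\phi(r_s,y')-a_4\phi(r_s,y')=m_1(y')$ on $\overline E$. -/

import Mathlib

open Set MeasureTheory
open scoped ENNReal ContDiff

noncomputable section

namespace TransonicShock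

/-! ### Hölder spaces up to the boundary, partial derivatives, boxes -/

section Holder

variable {X : Type*} [NormedAddCommGroup X] [NormedSpace ℝ X]

/-- The `C^{k,α}(S)` norm (with values in `[0,∞]`): the sum of the suprema over `S` of the norms of
the derivatives of order at most `k`, plus the `α`-Hölder seminorm of the derivative of order `k`.
It is used on closed boxes, where the derivatives within `S` are the continuous extensions of the
interior derivatives. -/
def holderNorm (k : ℕ) (α : ℝ) (S : Set X) (f : X → ℝ) : ℝ≥0∞ :=
  (∑ j ∈ Finset.range (k + 1), ⨆ x ∈ S, ‖iteratedFDerivWithin ℝ j f S x‖ₑ) +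
    ⨆ x ∈ S, ⨆ y ∈ S, ⨆ _ : x ≠ y,
      ‖iteratedFDerivWithin ℝ k f S x - iteratedFDerivWithin ℝ k f S y‖ₑ / (edist x y) ^ α

/-- `f ∈ C^{k,α}(S)`. -/
def MemHolder (k : ℕ) (α : ℝ) (S : Set X) (f : X → ℝ) : Prop :=
  ContDiffOn ℝ k f S ∧ holderNorm k α S f < ⊤

/-- Derivative of `f` in the direction `v`, taken within `S` (one-sided at the boundary of `S`). -/
def pd (S : Set X) (v : X) (f : X → ℝ) : X → ℝ := fun x => fderivWithin ℝ f S x v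

end Holder

/-- Coordinate directions for functions of `(y₁, (y₂, y₃))`. -/
def e1 : ℝ × ℝ × ℝ := (1, 0, 0)
def e2 : ℝ × ℝ × ℝ := (0, 1, 0)
def e3 : ℝ × ℝ × ℝ := (0, 0, 1)

/-- Coordinate directions for functions of `y' = (y₂, y₃)`. -/
def f2 : ℝ × ℝ := (1, 0)
def f3 : ℝ × ℝ := (0, 1)

/-- The cross-section `E = (-θ₀, θ₀) × (-1, 1)` and its closure. -/
def crossSec (θ₀ : ℝ) : Set (ℝ × ℝ) := Ioo (-θ₀) θ₀ ×ˢ Ioo (-1) 1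
def crossSecBar (θ₀ : ℝ) : Set (ℝ × ℝ) := Icc (-θ₀) θ₀ ×ˢ Icc (-1) 1

/-- The domain `(a, b) × E` and its closure. -/
def box (a b θ₀ : ℝ) : Set (ℝ × ℝ × ℝ) := Ioo a b ×ˢ crossSec θ₀
def boxBar (a b θ₀ : ℝ) : Set (ℝ × ℝ × ℝ) := Icc a b ×ˢ crossSecBar θ₀

/-! ### The background transonic shock -/

/-- A smooth cylindrically symmetric steady Euler flow of a polytropic gas, with radial velocity
`U > 0`, density `ρ > 0`, constant `K > 0` and pressure `K ρ^γ`, on the interval `I` of radii. -/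
structure IsRadialFlow (γ K : ℝ) (U ρ : ℝ → ℝ) (I : Set ℝ) : Prop where
  K_pos : 0 < K
  smooth_U : ContDiffOn ℝ ∞ U I
  smooth_ρ : ContDiffOn ℝ ∞ ρ I
  U_pos : ∀ r ∈ I, 0 < U r
  ρ_pos : ∀ r ∈ I, 0 < ρ r
  mass : ∀ r ∈ I, derivWithin (fun s => ρ s * U s) I r + ρ r * U r / r = 0
  momentum : ∀ r ∈ I,
    U r * derivWithin U I r + derivWithin (fun s => K * ρ s ^ γ) I r / ρ r = 0

/-- Squared sound speed `c²(ρ, K) = γ K ρ^(γ-1)`. -/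
def soundSq (γ ρ K : ℝ) : ℝ := γ * K * ρ ^ (γ - 1)

/-- The Bernoulli quantity of a state with squared speed `q`, density `ρ` and entropy function
`K`. -/
def bernQ (γ q ρ K : ℝ) : ℝ := q / 2 + γ / (γ - 1) * K * ρ ^ (γ - 1)

/-- The nozzle `r₁ < r < r₂`, `(θ, x₃) ∈ E`, and a cylindrically symmetric transonic shock in it with
front `r = rs`. The supersonic state (suffix `m`) is defined on all of `[r₁, r₂]`; the subsonic
state (suffix `p`) is extended slightly ahead of the shock, to `[rb, r₂]` with `r₁ ≤ rb < rs`. -/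
structure Background where
  γ : ℝ
  r₁ : ℝ
  r₂ : ℝ
  rs : ℝ
  rb : ℝ
  θ₀ : ℝ
  Km : ℝ
  Kp : ℝ
  Um : ℝ → ℝ
  ρm : ℝ → ℝ
  Up : ℝ → ℝ
  ρp : ℝ → ℝ
  one_lt_γ : 1 < γ
  r₁_pos : 0 < r₁
  r₁_le_rb : r₁ ≤ rb
  r₁_lt_rs : r₁ < rs
  rb_lt_rs : rb < rs
  rs_lt_r₂ : rs < r₂
  θ₀_pos : 0 < θ₀
  θ₀_lt : θ₀ < Real.pi / 2
  flow_m : IsRadialFlow γ Km Um ρm (Icc r₁ r₂)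
  flow_p : IsRadialFlow γ Kp Up ρp (Icc rb r₂)
  supersonic : ∀ r ∈ Icc r₁ r₂, soundSq γ (ρm r) Km < Um r ^ 2
  subsonic : ∀ r ∈ Icc rb r₂, Up r ^ 2 < soundSq γ (ρp r) Kp
  jump_mass : ρp rs * Up rs = ρm rs * Um rs
  jump_momentum :
    ρp rs * Up rs ^ 2 + Kp * ρp rs ^ γ = ρm rs * Um rs ^ 2 + Km * ρm rs ^ γ
  jump_bernoulli :
    bernQ γ (Up rs ^ 2) (ρp rs) Kp = bernQ γ (Um rs ^ 2) (ρm rs) Km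
  entropy : Km < Kp

namespace Background

variable (b : Background)

/-- Background pressures. -/
def Pm (r : ℝ) : ℝ := b.Km * b.ρm r ^ b.γ
def Pp (r : ℝ) : ℝ := b.Kp * b.ρp r ^ b.γ

/-- Background Bernoulli constants. -/
def Bm : ℝ := bernQ b.γ (b.Um b.rs ^ 2) (b.ρm b.rs) b.Km
def Bp : ℝ := bernQ b.γ (b.Up b.rs ^ 2) (b.ρp b.rs) b.Kp

/-- Jump `[P̄(rs)]` of the background pressure. -/
def jumpP : ℝ := b.Pp b.rs - b.Pm b.rs

/-- Squared sound speed behind the background shock. -/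
def cs2 : ℝ := soundSq b.γ (b.ρp b.rs) b.Kp

/-- Squared Mach number behind the background shock. -/
def Ms2 : ℝ := b.Up b.rs ^ 2 / b.cs2

def a0 : ℝ := b.ρp b.rs * b.Up b.rs / b.jumpP

def a1 : ℝ := b.γ * b.Up b.rs * b.jumpP / (b.rs * b.ρp b.rs * (b.cs2 - b.Up b.rs ^ 2))

def a3 : ℝ := ((b.γ - 1) * b.Ms2 + 1) / (b.γ * b.Ms2)

def a4 : ℝ := b.a0 * b.a1 * b.a3

def b11 : ℝ := (b.cs2 + b.γ * b.Up b.rs ^ 2) / (b.ρp b.rs * (b.cs2 - b.Up b.rs ^ 2))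

def b12 : ℝ := -(b.γ * b.Up b.rs) / (b.ρp b.rs * (b.cs2 - b.Up b.rs ^ 2))

def b13 : ℝ :=
  (b.γ - 1) * (b.ρp b.rs * b.Up b.rs) / (b.ρp b.rs * (b.cs2 - b.Up b.rs ^ 2))

/-- `E`, its closure, and the closures of `Ω = (r₁, r₂) × E` and `𝔻 = (rs, r₂) × E`. -/
def E : Set (ℝ × ℝ) := crossSec b.θ₀
def Ebar : Set (ℝ × ℝ) := crossSecBar b.θ₀
def Ω : Set (ℝ × ℝ × ℝ) := box b.r₁ b.r₂ b.θ₀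
def Ωbar : Set (ℝ × ℝ × ℝ) := boxBar b.r₁ b.r₂ b.θ₀
def D : Set (ℝ × ℝ × ℝ) := box b.rs b.r₂ b.θ₀
def Dbar : Set (ℝ × ℝ × ℝ) := boxBar b.rs b.r₂ b.θ₀

/-- The walls `y₂ = ± θ₀` and `y₃ = ± 1` of `𝔻`. -/
def wall2 : Set (ℝ × ℝ × ℝ) := {y | y.1 ∈ Ioo b.rs b.r₂ ∧ |y.2.1| = b.θ₀ ∧ y.2.2 ∈ Ioo (-1) 1}
def wall3 : Set (ℝ × ℝ × ℝ) :=
  {y | y.1 ∈ Ioo b.rs b.r₂ ∧ y.2.1 ∈ Ioo (-b.θ₀) b.θ₀ ∧ |y.2.2| = 1}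

/-- The closed edges `y₂ = ± θ₀` and `y₃ = ± 1` of `E`. -/
def edge2 : Set (ℝ × ℝ) := {y | |y.1| = b.θ₀ ∧ y.2 ∈ Icc (-1) 1}
def edge3 : Set (ℝ × ℝ) := {y | y.1 ∈ Icc (-b.θ₀) b.θ₀ ∧ |y.2| = 1}

/-- Partial derivatives on the closure of `E` and the operator `rs⁻² ∂₂² + ∂₃²`. -/
def dE2 (f : ℝ × ℝ → ℝ) : ℝ × ℝ → ℝ := pd b.Ebar f2 f
def dE3 (f : ℝ × ℝ → ℝ) : ℝ × ℝ → ℝ := pd b.Ebar f3 f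
def lapE (f : ℝ × ℝ → ℝ) (y : ℝ × ℝ) : ℝ :=
  1 / b.rs ^ 2 * b.dE2 (b.dE2 f) y + b.dE3 (b.dE3 f) y

/-- Partial derivatives on the closure of `𝔻`. -/
def dD1 (f : ℝ × ℝ × ℝ → ℝ) : ℝ × ℝ × ℝ → ℝ := pd b.Dbar e1 f
def dD2 (f : ℝ × ℝ × ℝ → ℝ) : ℝ × ℝ × ℝ → ℝ := pd b.Dbar e2 f
def dD3 (f : ℝ × ℝ × ℝ → ℝ) : ℝ × ℝ × ℝ → ℝ := pd b.Dbar e3 f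

/-- Partial derivatives on the closure of `Ω`. -/
def dΩ1 (f : ℝ × ℝ × ℝ → ℝ) : ℝ × ℝ × ℝ → ℝ := pd b.Ωbar e1 f
def dΩ2 (f : ℝ × ℝ × ℝ → ℝ) : ℝ × ℝ × ℝ → ℝ := pd b.Ωbar e2 f
def dΩ3 (f : ℝ × ℝ × ℝ → ℝ) : ℝ × ℝ × ℝ → ℝ := pd b.Ωbar e3 f

end Background

/-! ### The incoming supersonic flow -/

/-- Velocity components (radial, angular, axial), pressure and entropy function. -/
structure State (X : Type*) where
  U1 : X → ℝ
  U2 : X → ℝ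
  U3 : X → ℝ
  P : X → ℝ
  K : X → ℝ

/-- Density `(P / K)^(1/γ)` of a state. -/
def State.rho {X : Type*} (γ : ℝ) (Ψ : State X) (x : X) : ℝ := (Ψ.P x / Ψ.K x) ^ (1 / γ)

/-- Bernoulli quantity of a state. -/
def State.bern {X : Type*} (γ : ℝ) (Ψ : State X) (x : X) : ℝ :=
  bernQ γ (Ψ.U1 x ^ 2 + Ψ.U2 x ^ 2 + Ψ.U3 x ^ 2) (Ψ.rho γ x) (Ψ.K x)

/-- Admissible inlet perturbations: `C^{2,α}` up to the boundary of `E`, with the compatibility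
conditions on the edges. -/
structure IsInletData (b : Background) (α : ℝ) (d : State (ℝ × ℝ)) : Prop where
  reg_U1 : MemHolder 2 α b.Ebar d.U1
  reg_U2 : MemHolder 2 α b.Ebar d.U2
  reg_U3 : MemHolder 2 α b.Ebar d.U3
  reg_P : MemHolder 2 α b.Ebar d.P
  reg_K : MemHolder 2 α b.Ebar d.K
  edge2 : ∀ y ∈ b.edge2, d.U2 y = 0 ∧ b.dE2 (b.dE2 d.U2) y = 0 ∧
    b.dE2 d.U1 y = 0 ∧ b.dE2 d.U3 y = 0 ∧ b.dE2 d.P y = 0 ∧ b.dE2 d.K y = 0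
  edge3 : ∀ y ∈ b.edge3, d.U3 y = 0 ∧ b.dE3 (b.dE3 d.U3) y = 0 ∧
    b.dE3 d.U1 y = 0 ∧ b.dE3 d.U2 y = 0 ∧ b.dE3 d.P y = 0 ∧ b.dE3 d.K y = 0

/-- The steady compressible Euler system in cylindrical coordinates at the point
`x = (r, (θ, x₃))` of `Ω`. -/
structure EulerAt (b : Background) (Ψ : State (ℝ × ℝ × ℝ)) (x : ℝ × ℝ × ℝ) : Prop where
  mass : b.dΩ1 (fun z => Ψ.rho b.γ z * Ψ.U1 z) x + Ψ.rho b.γ x * Ψ.U1 x / x.1 +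
    1 / x.1 * b.dΩ2 (fun z => Ψ.rho b.γ z * Ψ.U2 z) x +
    b.dΩ3 (fun z => Ψ.rho b.γ z * Ψ.U3 z) x = 0
  momentum1 : Ψ.U1 x * b.dΩ1 Ψ.U1 x + Ψ.U2 x / x.1 * b.dΩ2 Ψ.U1 x + Ψ.U3 x * b.dΩ3 Ψ.U1 x +
    1 / Ψ.rho b.γ x * b.dΩ1 Ψ.P x - Ψ.U2 x ^ 2 / x.1 = 0
  momentum2 : Ψ.U1 x * b.dΩ1 Ψ.U2 x + Ψ.U2 x / x.1 * b.dΩ2 Ψ.U2 x + Ψ.U3 x * b.dΩ3 Ψ.U2 x +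
    1 / (x.1 * Ψ.rho b.γ x) * b.dΩ2 Ψ.P x + Ψ.U1 x * Ψ.U2 x / x.1 = 0
  momentum3 : Ψ.U1 x * b.dΩ1 Ψ.U3 x + Ψ.U2 x / x.1 * b.dΩ2 Ψ.U3 x + Ψ.U3 x * b.dΩ3 Ψ.U3 x +
    1 / Ψ.rho b.γ x * b.dΩ3 Ψ.P x = 0
  entropy : Ψ.U1 x * b.dΩ1 Ψ.K x + Ψ.U2 x / x.1 * b.dΩ2 Ψ.K x + Ψ.U3 x * b.dΩ3 Ψ.K x = 0

/-- `Ψ` is a `C^{2,α}` solution of the Euler system in `Ω` with inlet value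
`background + ε * data` at `r = r₁`, slip conditions on the walls, and `C^{2,α}` distance at most
`C₀ ε` from the supersonic background state. -/
structure IsIncomingFlow (b : Background) (α ε C₀ : ℝ) (d : State (ℝ × ℝ))
    (Ψ : State (ℝ × ℝ × ℝ)) : Prop where
  reg_U1 : MemHolder 2 α b.Ωbar Ψ.U1
  reg_U2 : MemHolder 2 α b.Ωbar Ψ.U2
  reg_U3 : MemHolder 2 α b.Ωbar Ψ.U3
  reg_P : MemHolder 2 α b.Ωbar Ψ.P
  reg_K : MemHolder 2 α b.Ωbar Ψ.K
  euler : ∀ x ∈ b.Ω, EulerAt b Ψ x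
  inlet : ∀ y ∈ b.Ebar,
    Ψ.U1 (b.r₁, y) = b.Um b.r₁ + ε * d.U1 y ∧ Ψ.U2 (b.r₁, y) = ε * d.U2 y ∧
    Ψ.U3 (b.r₁, y) = ε * d.U3 y ∧ Ψ.P (b.r₁, y) = b.Pm b.r₁ + ε * d.P y ∧
    Ψ.K (b.r₁, y) = b.Km + ε * d.K y
  slip2 : ∀ r ∈ Icc b.r₁ b.r₂, ∀ y ∈ b.edge2, Ψ.U2 (r, y) = 0
  slip3 : ∀ r ∈ Icc b.r₁ b.r₂, ∀ y ∈ b.edge3, Ψ.U3 (r, y) = 0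
  close : holderNorm 2 α b.Ωbar (fun x => Ψ.U1 x - b.Um x.1) + holderNorm 2 α b.Ωbar Ψ.U2 +
    holderNorm 2 α b.Ωbar Ψ.U3 + holderNorm 2 α b.Ωbar (fun x => Ψ.P x - b.Pm x.1) +
    holderNorm 2 α b.Ωbar (fun x => Ψ.K x - b.Km) ≤ ENNReal.ofReal (C₀ * ε)

/-! ### The class of approximate downstream flows and shock fronts -/

/-- A downstream perturbation `(V₁, …, V₅)` on `𝔻` and a front perturbation `V₆` on `E`. -/
structure Perturbation where
  V1 : ℝ × ℝ × ℝ → ℝ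
  V2 : ℝ × ℝ × ℝ → ℝ
  V3 : ℝ × ℝ × ℝ → ℝ
  V4 : ℝ × ℝ × ℝ → ℝ
  V5 : ℝ × ℝ × ℝ → ℝ
  V6 : ℝ × ℝ → ℝ

/-- The class `𝒳` of radius `δ`: `V₁, …, V₅ ∈ C^{2,α}`, `V₆ ∈ C^{3,α}`, sum of norms at most `δ`,
and the compatibility conditions on the walls. -/
structure MemX (b : Background) (α δ : ℝ) (V : Perturbation) : Prop where
  reg1 : MemHolder 2 α b.Dbar V.V1
  reg2 : MemHolder 2 α b.Dbar V.V2
  reg3 : MemHolder 2 α b.Dbar V.V3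
  reg4 : MemHolder 2 α b.Dbar V.V4
  reg5 : MemHolder 2 α b.Dbar V.V5
  reg6 : MemHolder 3 α b.Ebar V.V6
  small : holderNorm 2 α b.Dbar V.V1 + holderNorm 2 α b.Dbar V.V2 + holderNorm 2 α b.Dbar V.V3 +
    holderNorm 2 α b.Dbar V.V4 + holderNorm 2 α b.Dbar V.V5 + holderNorm 3 α b.Ebar V.V6
      ≤ ENNReal.ofReal δ
  wall2 : ∀ y ∈ b.wall2, V.V2 y = 0 ∧ b.dD2 (b.dD2 V.V2) y = 0 ∧
    b.dD2 V.V1 y = 0 ∧ b.dD2 V.V3 y = 0 ∧ b.dD2 V.V4 y = 0 ∧ b.dD2 V.V5 y = 0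
  wall3 : ∀ y ∈ b.wall3, V.V3 y = 0 ∧ b.dD3 (b.dD3 V.V3) y = 0 ∧
    b.dD3 V.V1 y = 0 ∧ b.dD3 V.V2 y = 0 ∧ b.dD3 V.V4 y = 0 ∧ b.dD3 V.V5 y = 0
  edge2 : ∀ y ∈ b.edge2, b.dE2 V.V6 y = 0 ∧ b.dE2 (b.dE2 (b.dE2 V.V6)) y = 0
  edge3 : ∀ y ∈ b.edge3, b.dE3 V.V6 y = 0 ∧ b.dE3 (b.dE3 (b.dE3 V.V6)) y = 0

/-! ### The error terms of the Rankine-Hugoniot conditions on the front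

All functions below are functions of `y' ∈ E`; the downstream quantities are evaluated at
`(rs, y')` and the upstream quantities at `(rs + V₆(y'), y')`. -/

section Front

variable (b : Background) (Ψ : State (ℝ × ℝ × ℝ)) (V : Perturbation)

/-- Radius of the perturbed front. -/
def front (y : ℝ × ℝ) : ℝ := b.rs + V.V6 y

/-- The point of the perturbed front over `y'`. -/
def frontPt (y : ℝ × ℝ) : ℝ × ℝ × ℝ := (front b V y, y)

/-- Downstream velocity components at the front. -/
def u1 (y : ℝ × ℝ) : ℝ := b.Up (front b V y) + V.V1 (b.rs, y)
def u2 (y : ℝ × ℝ) : ℝ := V.V2 (b.rs, y)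
def u3 (y : ℝ × ℝ) : ℝ := V.V3 (b.rs, y)

/-- `B̄ + V₅ - ((Ū + V₁)² + V₂² + V₃²) / 2`, the downstream enthalpy. -/
def enth (y : ℝ × ℝ) : ℝ :=
  b.Bp + V.V5 (b.rs, y) - u1 b V y ^ 2 / 2 - (u2 b V y ^ 2 + u3 b V y ^ 2) / 2

/-- Downstream density and pressure at the front. -/
def rhoT (y : ℝ × ℝ) : ℝ :=
  ((b.γ - 1) / (b.γ * (b.Kp + V.V4 (b.rs, y)))) ^ (1 / (b.γ - 1)) *
    enth b V y ^ (1 / (b.γ - 1))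
def pT (y : ℝ × ℝ) : ℝ :=
  ((b.γ - 1) / b.γ) ^ (b.γ / (b.γ - 1)) * (1 / (b.Kp + V.V4 (b.rs, y))) ^ (1 / (b.γ - 1)) *
    enth b V y ^ (b.γ / (b.γ - 1))

/-- Upstream velocity, density and pressure at the front. -/
def w1 (y : ℝ × ℝ) : ℝ := Ψ.U1 (frontPt b V y)
def w2 (y : ℝ × ℝ) : ℝ := Ψ.U2 (frontPt b V y)
def w3 (y : ℝ × ℝ) : ℝ := Ψ.U3 (frontPt b V y)
def rhoM (y : ℝ × ℝ) : ℝ := Ψ.rho b.γ (frontPt b V y)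
def pM (y : ℝ × ℝ) : ℝ := Ψ.P (frontPt b V y)

/-- The jumps `[ρU₂]`, `[ρU₃]`, `[ρU₁U₂]`, `[ρU₁U₃]`, `[ρU₂U₃]`, `[ρU₂²+P]`, `[ρU₃²+P]`. -/
def j2 (y : ℝ × ℝ) : ℝ := rhoT b V y * u2 b V y - rhoM b Ψ V y * w2 b Ψ V y
def j3 (y : ℝ × ℝ) : ℝ := rhoT b V y * u3 b V y - rhoM b Ψ V y * w3 b Ψ V y
def j12 (y : ℝ × ℝ) : ℝ :=
  rhoT b V y * u1 b V y * u2 b V y - rhoM b Ψ V y * w1 b Ψ V y * w2 b Ψ V y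
def j13 (y : ℝ × ℝ) : ℝ :=
  rhoT b V y * u1 b V y * u3 b V y - rhoM b Ψ V y * w1 b Ψ V y * w3 b Ψ V y
def j23 (y : ℝ × ℝ) : ℝ :=
  rhoT b V y * u2 b V y * u3 b V y - rhoM b Ψ V y * w2 b Ψ V y * w3 b Ψ V y
def j22 (y : ℝ × ℝ) : ℝ :=
  rhoT b V y * u2 b V y ^ 2 + pT b V y - (rhoM b Ψ V y * w2 b Ψ V y ^ 2 + pM b Ψ V y)
def j33 (y : ℝ × ℝ) : ℝ :=
  rhoT b V y * u3 b V y ^ 2 + pT b V y - (rhoM b Ψ V y * w3 b Ψ V y ^ 2 + pM b Ψ V y)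

def J (y : ℝ × ℝ) : ℝ := j22 b Ψ V y * j33 b Ψ V y - j23 b Ψ V y ^ 2
def J2 (y : ℝ × ℝ) : ℝ := j33 b Ψ V y * j12 b Ψ V y - j13 b Ψ V y * j23 b Ψ V y
def J3 (y : ℝ × ℝ) : ℝ := j22 b Ψ V y * j13 b Ψ V y - j12 b Ψ V y * j23 b Ψ V y

/-- The error terms in `∂₂V₆ / rs = a₀ V₂ + g₂` and `∂₃V₆ = a₀ V₃ + g₃`. -/
def g2 (y : ℝ × ℝ) : ℝ :=
  1 / b.rs * (front b V y * J2 b Ψ V y / J b Ψ V y - b.a0 * b.rs * V.V2 (b.rs, y))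
def g3 (y : ℝ × ℝ) : ℝ := J3 b Ψ V y / J b Ψ V y - b.a0 * V.V3 (b.rs, y)

/-- `ρ - ρ̄` downstream at the front. -/
def rhoDot (y : ℝ × ℝ) : ℝ := rhoT b V y - b.ρp (front b V y)

def R01 (y : ℝ × ℝ) : ℝ :=
  -(b.ρp (front b V y) * b.Up (front b V y) - b.ρm (front b V y) * b.Um (front b V y))
    + rhoM b Ψ V y * w1 b Ψ V y - b.ρm (front b V y) * b.Um (front b V y)
    - (V.V1 (b.rs, y) + b.Up (front b V y) - b.Up b.rs) * rhoDot b V y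
    + (j2 b Ψ V y * J2 b Ψ V y + j3 b Ψ V y * J3 b Ψ V y) / J b Ψ V y
    - (b.ρp (front b V y) - b.ρp b.rs) * V.V1 (b.rs, y)

def R02 (y : ℝ × ℝ) : ℝ :=
  -((b.ρp (front b V y) * b.Up (front b V y) ^ 2 + b.Pp (front b V y))
      - (b.ρm (front b V y) * b.Um (front b V y) ^ 2 + b.Pm (front b V y))
      - 1 / b.rs * b.jumpP * V.V6 y)
    + (rhoM b Ψ V y * w1 b Ψ V y ^ 2 + pM b Ψ V y)
    - (b.ρm (front b V y) * b.Um (front b V y) ^ 2 + b.Pm (front b V y))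
    - (rhoT b V y * u1 b V y ^ 2 + pT b V y
        - (b.ρp (front b V y) * b.Up (front b V y) ^ 2 + b.Pp (front b V y))
        - 2 * (b.ρp b.rs * b.Up b.rs) * V.V1 (b.rs, y)
        - (b.Up b.rs ^ 2 + b.cs2) * rhoDot b V y
        - b.ρp b.rs ^ b.γ * V.V4 (b.rs, y))
    + (j12 b Ψ V y * J2 b Ψ V y + j13 b Ψ V y * J3 b Ψ V y) / J b Ψ V y

def R03 (y : ℝ × ℝ) : ℝ :=
  Ψ.bern b.γ (frontPt b V y) - b.Bm - b.Up (front b V y) * V.V1 (b.rs, y)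
    - (V.V1 (b.rs, y) ^ 2 + V.V2 (b.rs, y) ^ 2 + V.V3 (b.rs, y) ^ 2) / 2
    + b.Up b.rs * V.V1 (b.rs, y)
    - b.γ / (b.γ - 1) * ((b.Kp + V.V4 (b.rs, y)) * rhoT b V y ^ (b.γ - 1)
        - b.Kp * b.ρp (front b V y) ^ (b.γ - 1))
    + b.cs2 / b.ρp b.rs * rhoDot b V y
    + b.γ * b.ρp b.rs ^ (b.γ - 1) / (b.γ - 1) * V.V4 (b.rs, y)

/-- The error term in `V₁(rs, ·) = a₁ V₆ + R₁`. -/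
def R1 (y : ℝ × ℝ) : ℝ := b.b11 * R01 b Ψ V y + b.b12 * R02 b Ψ V y + b.b13 * R03 b Ψ V y

/-- `q₁ = a₁ (∂₂g₂ / rs + ∂₃g₃) + (rs⁻² ∂₂² + ∂₃²) R₁`. -/
def q1 (y : ℝ × ℝ) : ℝ :=
  b.a1 * (1 / b.rs * b.dE2 (g2 b Ψ V) y + b.dE3 (g3 b Ψ V) y) + b.lapE (R1 b Ψ V) y

/-- `q₅ = q₁ + a₀ a₁ (∂₂V̇₂ / rs + ∂₃V̇₃)(rs, ·)`. -/
def q5 (W2 W3 : ℝ × ℝ × ℝ → ℝ) (y : ℝ × ℝ) : ℝ :=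
  q1 b Ψ V y + b.a0 * b.a1 * (1 / b.rs * b.dD2 W2 (b.rs, y) + b.dD3 W3 (b.rs, y))

end Front

/-- `(W1, W2, W3) ∈ C^{2,α}` solves the divergence-curl system in `𝔻` with zero divergence, curl
`(G1, G2, G3) ∈ C^{1,α}` (cylindrical coordinates) and zero normal component on the boundary. -/
structure IsDivCurlSolution (b : Background) (α : ℝ) (G1 G2 G3 W1 W2 W3 : ℝ × ℝ × ℝ → ℝ) :
    Prop where
  regG1 : MemHolder 1 α b.Dbar G1
  regG2 : MemHolder 1 α b.Dbar G2
  regG3 : MemHolder 1 α b.Dbar G3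
  reg1 : MemHolder 2 α b.Dbar W1
  reg2 : MemHolder 2 α b.Dbar W2
  reg3 : MemHolder 2 α b.Dbar W3
  div : ∀ y ∈ b.D, b.dD1 W1 y + W1 y / y.1 + 1 / y.1 * b.dD2 W2 y + b.dD3 W3 y = 0
  curl1 : ∀ y ∈ b.D, 1 / y.1 * b.dD2 W3 y - b.dD3 W2 y = G1 y
  curl2 : ∀ y ∈ b.D, b.dD3 W1 y - b.dD1 W3 y = G2 y
  curl3 : ∀ y ∈ b.D, b.dD1 W2 y - 1 / y.1 * b.dD2 W1 y + W2 y / y.1 = G3 y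
  front : ∀ y ∈ b.E, W1 (b.rs, y) = 0
  exit : ∀ y ∈ b.E, W1 (b.r₂, y) = 0
  wall2 : ∀ y ∈ b.wall2, W2 y = 0
  wall3 : ∀ y ∈ b.wall3, W3 y = 0

/-! ### The Poisson problem on `E` and the oblique derivative condition -/

/-- `m` satisfies `(rs⁻² ∂₂² + ∂₃²) m = f` in `E` and the homogeneous Neumann conditions. -/
structure SolvesNeumann (b : Background) (f m : ℝ × ℝ → ℝ) : Prop where
  poisson : ∀ y ∈ b.E, b.lapE m y = f y
  neumann2 : ∀ y ∈ b.edge2, 1 / b.rs * b.dE2 m y = 0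
  neumann3 : ∀ y ∈ b.edge3, b.dE3 m y = 0

/-- `m ∈ C^{2,α}` solves the Neumann problem and has mean zero. -/
structure IsMeanZeroSolution (b : Background) (α : ℝ) (f m : ℝ × ℝ → ℝ) : Prop where
  reg : MemHolder 2 α b.Ebar m
  solves : SolvesNeumann b f m
  mean : (∫ y in b.E, m y) = 0

/-- The oblique trace `(∂₁φ - a₄ φ)(rs, ·)` of a potential on the front. -/
def obliqueTrace (b : Background) (φ : ℝ × ℝ × ℝ → ℝ) (y : ℝ × ℝ) : ℝ :=
  b.dD1 φ (b.rs, y) - b.a4 * φ (b.rs, y)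

/-- The conditions that the potential `φ` satisfies on the front: the second order boundary
condition `(rs⁻² ∂₂² + ∂₃²)(∂₁φ - a₄ φ) = a₃ q` in `E`, and the Neumann conditions for
`∂₁φ - a₄ φ` on the edges. -/
structure IsFrontPotential (b : Background) (q : ℝ × ℝ → ℝ) (φ : ℝ × ℝ × ℝ → ℝ) : Prop where
  reg : ContDiffOn ℝ 3 φ b.Dbar
  front : SolvesNeumann b (fun y => b.a3 * q y) (obliqueTrace b φ)

end TransonicShock

end

open TransonicShock

set_option linter.unusedSectionVars false

namespace TransonicShock

open Filter Topology NNReal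

/-! Write Δ' for rs⁻² ∂₂² + ∂₃². The source has the form `q5` = div X + Δ'R₁, where X collects
a₁(g₂, g₃) and a₀a₁(V̇₂, V̇₃), with the weight 1/rs on the angular component (`q5_decomposition`).
Everything rests on two edge conditions: the normal component of X and the normal derivative of R₁
vanish on the edges of E. They make `q5` mean-zero by the divergence theorem, and they make R₁
itself an admissible part of the solution.

The edge conditions come from reflection symmetry. Changing the sign of the upstream and downstream
angular velocities together leaves R₁ unchanged and reverses g₂ (`errors_flip_angular`); the axial
velocities and g₃ behave alike (`errors_flip_axial`). On an edge the normal velocities vanish and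
all other data have zero normal derivative, so the odd term vanishes and the even one is stationary
(`pd_comp_eq_zero_of_flip`). Downstream this is part of the definition of the class 𝒳. Upstream it
is known only at the inlet and has to be propagated: on a wall the normal derivatives of K and of
the two tangential velocities satisfy a closed homogeneous linear transport system
(`IsAdvection.wall2`, `IsAdvection.wall3`), and such a system has only the zero solution for zero
inflow data (`eq_zero_of_transport`). Smallness of ε and δ₀ serves to keep U₁, P and K positive and
the point values of the data where the error terms are C³ functions of them (`exists_small`).

For existence of m₁, the term a₃R₁ is split off, since Δ'R₁ is only Hölder continuous; the remaining
right-hand side a₃ div X is C¹. After rescaling y₂ it is extended evenly and periodically to the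
plane. Convolution of w with a truncated logarithmic potential gives a function whose Laplacian is w
minus its mean over discs (`exists_potential`). Choosing w = F + k * w, with k the normalized
indicator of a disc minus a period cell, turns the Laplacian into F minus a constant
(`exists_neumann`); the contraction principle applies because k has mass below one. The Neumann
conditions are the evenness of the extension, and the constant vanishes by the mean-zero property.
The C^{2,α} bound comes from the integrable fractional smoothness of the kernel z/|z|².

Two solutions differ by a constant by the energy identity (`exists_const_of_solvesNeumann`). Hence
the oblique trace of a front potential is m₁ + κ. Adding c to the potential changes the trace by
-a₄c, and a₄ ≠ 0, so exactly one c removes κ; a trace of mean zero already has κ = 0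
(`IsFrontPotential.oblique`). -/

/-! ### The truncated gradient of the logarithmic potential in the plane -/

/-- Squared Euclidean norm on `ℝ × ℝ`. -/
def nsq (z : ℝ × ℝ) : ℝ := z.1 ^ 2 + z.2 ^ 2

lemma nsq_nonneg (z : ℝ × ℝ) : 0 ≤ nsq z := by unfold nsq; positivity

lemma abs_fst_le_norm (z : ℝ × ℝ) : |z.1| ≤ ‖z‖ := norm_fst_le z
lemma abs_snd_le_norm (z : ℝ × ℝ) : |z.2| ≤ ‖z‖ := norm_snd_le z

lemma norm_sq_le_nsq (z : ℝ × ℝ) : ‖z‖ ^ 2 ≤ nsq z := by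
  rw [Prod.norm_def, nsq]
  rcases max_choice ‖z.1‖ ‖z.2‖ with h | h <;> rw [h, Real.norm_eq_abs, sq_abs] <;>
    nlinarith [sq_nonneg z.1, sq_nonneg z.2]

lemma nsq_pos {z : ℝ × ℝ} (hz : z ≠ 0) : 0 < nsq z :=
  lt_of_lt_of_le (by have := norm_pos_iff.2 hz; positivity) (norm_sq_le_nsq z)

lemma continuous_nsq : Continuous nsq := by unfold nsq; fun_prop

lemma abs_nsq_sub_le (z w : ℝ × ℝ) : |nsq z - nsq w| ≤ 2 * (‖z‖ + ‖w‖) * ‖z - w‖ := by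
  have e : nsq z - nsq w = (z - w).1 * (z.1 + w.1) + (z - w).2 * (z.2 + w.2) := by
    simp only [nsq, Prod.fst_sub, Prod.snd_sub]; ring
  have h1 := abs_fst_le_norm (z - w)
  have h2 := abs_snd_le_norm (z - w)
  have h3 : |z.1 + w.1| ≤ ‖z‖ + ‖w‖ :=
    (abs_add_le _ _).trans (add_le_add (abs_fst_le_norm z) (abs_fst_le_norm w))
  have h4 : |z.2 + w.2| ≤ ‖z‖ + ‖w‖ :=
    (abs_add_le _ _).trans (add_le_add (abs_snd_le_norm z) (abs_snd_le_norm w))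
  rw [e]
  refine (abs_add_le _ _).trans ?_
  rw [abs_mul, abs_mul]
  have := mul_le_mul h1 h3 (abs_nonneg _) (norm_nonneg _)
  have := mul_le_mul h2 h4 (abs_nonneg _) (norm_nonneg _)
  linarith

/-- The radial truncation `(1 - s / R²)₊`. -/
noncomputable def cut (R s : ℝ) : ℝ := max 0 (1 - s / R ^ 2)

lemma cut_nonneg (R s : ℝ) : 0 ≤ cut R s := le_max_left _ _

lemma cut_le_one {R s : ℝ} (hs : 0 ≤ s) : cut R s ≤ 1 :=
  max_le zero_le_one (by have : 0 ≤ s / R ^ 2 := by positivity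
                         linarith)

lemma cut_eq_zero {R s : ℝ} (hR : 0 < R) (hs : R ^ 2 ≤ s) : cut R s = 0 := by
  rw [cut, max_eq_left]
  have := (one_le_div (by positivity : 0 < R ^ 2)).2 hs
  linarith

lemma cut_eq {R s : ℝ} (hR : 0 < R) (hs : s ≤ R ^ 2) : cut R s = 1 - s / R ^ 2 := by
  rw [cut, max_eq_right]
  have := (div_le_one (by positivity : 0 < R ^ 2)).2 hs
  linarith

lemma continuous_cut (R : ℝ) : Continuous (cut R) := by unfold cut; fun_prop

lemma abs_cut_sub_le (R s t : ℝ) : |cut R s - cut R t| ≤ |s - t| / R ^ 2 := by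
  refine (abs_max_sub_max_le_max _ _ _ _).trans ?_
  have : 1 - s / R ^ 2 - (1 - t / R ^ 2) = -((s - t) / R ^ 2) := by ring
  rw [this, abs_neg, sub_self, abs_zero, abs_div, abs_of_nonneg (sq_nonneg R)]
  exact max_le (by positivity) le_rfl

/-- The kernel `c(z) (1 - |z|² / R²)₊ / |z|²` for a linear functional `c`. -/
noncomputable def ker (R : ℝ) (c : ℝ × ℝ →L[ℝ] ℝ) (z : ℝ × ℝ) : ℝ := c z * cut R (nsq z) / nsq z

/-- The dominating function `‖z‖^(-s)` on the ball of radius `R`. -/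
noncomputable def dom (R s : ℝ) : ℝ × ℝ → ℝ :=
  indicator (Metric.ball 0 R) (fun z => ‖z‖ ^ (-s))

lemma dom_nonneg (R s : ℝ) (z : ℝ × ℝ) : 0 ≤ dom R s z :=
  indicator_nonneg (fun _ _ => by positivity) _

/-- In dimension two the radial weight is y, so everything reduces to integrability of y^(1-s) near
0. The norm is the sup norm of `ℝ × ℝ`, for which radial integration holds as well. -/
lemma integrable_dom {R s : ℝ} (hs : s < 2) : Integrable (dom R s) := by
  have h := integrable_fun_norm_addHaar (E := ℝ × ℝ) (F := ℝ) volume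
    (f := indicator (Iio R) (fun y => y ^ (-s)))
  have e : (fun z : ℝ × ℝ => indicator (Iio R) (fun y => y ^ (-s)) ‖z‖) = dom R s := by
    ext z
    simp only [dom, indicator, mem_Iio, Metric.mem_ball, dist_zero_right]
  rw [e] at h
  rw [h]
  rcases le_or_gt R 0 with hR | hR
  · refine (integrableOn_congr_fun (fun y (hy : 0 < y) => ?_) measurableSet_Ioi).2
      (integrableOn_zero)
    have : ¬ y < R := by linarith
    simp [indicator, this]
  · have h1 : IntervalIntegrable (fun y : ℝ => y ^ (1 - s)) volume 0 R :=
      intervalIntegral.intervalIntegrable_rpow' (by linarith)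
    rw [intervalIntegrable_iff_integrableOn_Ioo_of_le hR.le] at h1
    have h2 : IntegrableOn (indicator (Ioo 0 R) (fun y : ℝ => y ^ (1 - s))) (Ioi 0) :=
      ((integrable_indicator_iff measurableSet_Ioo).2 h1).integrableOn
    refine (integrableOn_congr_fun (fun y (hy : 0 < y) => ?_) measurableSet_Ioi).2 h2
    have hd : Module.finrank ℝ (ℝ × ℝ) = 2 := by simp
    by_cases hyR : y < R
    · simp only [indicator, mem_Iio, hyR, mem_Ioo, hy, and_self, if_true, hd, smul_eq_mul]
      rw [sub_eq_add_neg, Real.rpow_add hy, Real.rpow_one]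
      norm_num
    · simp [indicator, hyR]

section Kernel

variable {R : ℝ} {c : ℝ × ℝ →L[ℝ] ℝ}

lemma norm_lt_of_nsq_lt (hR : 0 < R) {z : ℝ × ℝ} (h : nsq z < R ^ 2) : ‖z‖ < R :=
  lt_of_pow_lt_pow_left₀ 2 hR.le ((norm_sq_le_nsq z).trans_lt h)

lemma abs_ker_le (hR : 0 < R) (hc : ∀ z, |c z| ≤ ‖z‖) (z : ℝ × ℝ) : |ker R c z| ≤ dom R 1 z := by
  rcases eq_or_ne z 0 with rfl | hz
  · simpa [ker] using dom_nonneg R 1 0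
  rcases lt_or_ge (nsq z) (R ^ 2) with h | h
  · have hb : z ∈ Metric.ball (0 : ℝ × ℝ) R := by simpa using norm_lt_of_nsq_lt hR h
    have hz' := norm_pos_iff.2 hz
    rw [dom, indicator_of_mem hb, Real.rpow_neg_one, ker, abs_div, abs_mul,
      abs_of_nonneg (nsq_nonneg z), abs_of_nonneg (cut_nonneg _ _), div_le_iff₀ (nsq_pos hz)]
    calc |c z| * cut R (nsq z) ≤ ‖z‖ * 1 :=
          mul_le_mul (hc z) (cut_le_one (nsq_nonneg z)) (cut_nonneg _ _) (norm_nonneg z)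
      _ = ‖z‖⁻¹ * ‖z‖ ^ 2 := by field_simp
      _ ≤ _ := by gcongr; exact norm_sq_le_nsq z
  · rw [ker, cut_eq_zero hR h]; simpa using dom_nonneg R 1 z

lemma measurable_ker (R : ℝ) (c : ℝ × ℝ →L[ℝ] ℝ) : Measurable (ker R c) := by
  unfold ker
  exact ((c.continuous.measurable).mul ((continuous_cut R).comp continuous_nsq).measurable).div
    continuous_nsq.measurable

lemma integrable_ker (hR : 0 < R) (hc : ∀ z, |c z| ≤ ‖z‖) : Integrable (ker R c) :=
  (integrable_dom (R := R) (s := 1) (by norm_num)).mono' (measurable_ker R c).aestronglyMeasurable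
    (Eventually.of_forall fun z => abs_ker_le hR hc z)

/-- At distance comparable with h, a factor ‖z‖^α ≤ (3h)^α can be traded for a worse but still
integrable singularity; 3^α ≤ 3. -/
lemma dom_one_le {α h : ℝ} (hα0 : 0 < α) (hα1 : α < 1) {z : ℝ × ℝ} (hz : ‖z‖ ≤ 3 * h) :
    dom R 1 z ≤ 3 * h ^ α * dom R (1 + α) z := by
  have hh : 0 ≤ h := by linarith [norm_nonneg z]
  by_cases hb : z ∈ Metric.ball (0 : ℝ × ℝ) R
  · rw [dom, dom, indicator_of_mem hb, indicator_of_mem hb]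
    rcases eq_or_ne z 0 with rfl | hz0
    · rw [norm_zero, Real.zero_rpow (by norm_num)]; positivity
    have hz' := norm_pos_iff.2 hz0
    have e : ‖z‖ ^ (-1 : ℝ) = ‖z‖ ^ α * ‖z‖ ^ (-(1 + α)) := by
      rw [← Real.rpow_add hz']; congr 1; ring
    rw [e]
    refine mul_le_mul_of_nonneg_right ?_ (by positivity)
    calc ‖z‖ ^ α ≤ (3 * h) ^ α := Real.rpow_le_rpow hz'.le hz hα0.le
      _ = 3 ^ α * h ^ α := Real.mul_rpow (by norm_num) hh
      _ ≤ 3 * h ^ α := by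
        gcongr
        exact (Real.rpow_le_rpow_of_exponent_le (by norm_num) hα1.le).trans_eq (Real.rpow_one 3)
  · rw [dom, dom, indicator_of_notMem hb, indicator_of_notMem hb, mul_zero]

/-- The kernel is of size 1/‖z‖ with increments of order h/‖z‖². Close to the origin, relative to h
= ‖z - w‖, the size bound suffices; far from it the increment bound is used and h/‖z‖² is
interpolated to h^α ‖z‖^(-(1+α)). -/
lemma abs_ker_sub_le_aux (hR : 0 < R) (hc : ∀ z, |c z| ≤ ‖z‖) {α : ℝ} (hα0 : 0 < α) (hα1 : α < 1)
    {z w : ℝ × ℝ} (hzw : ‖z‖ ≤ ‖w‖) :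
    |ker R c z - ker R c w| ≤
      14 * ‖z - w‖ ^ α * (dom R (1 + α) z + dom R (1 + α) w) := by
  set h := ‖z - w‖ with hh
  have hh0 : 0 ≤ h := norm_nonneg _
  have hw : ‖w‖ ≤ ‖z‖ + h := by
    have := norm_sub_le z (z - w)
    simpa using this
  have d1 := dom_nonneg R (1 + α) z
  have d2 := dom_nonneg R (1 + α) w
  have hp : 0 ≤ h ^ α := by positivity
  -- In the near case both points have norm at most 3h and no cancellation is needed. In the far
  -- case ‖w‖ ≤ (3/2)‖z‖.
  rcases le_or_gt ‖z‖ (2 * h) with h2 | h2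
  · have a1 := (abs_ker_le hR hc z).trans (dom_one_le (R := R) hα0 hα1 (z := z) (h := h)
      (by linarith))
    have a2 := (abs_ker_le hR hc w).trans (dom_one_le (R := R) hα0 hα1 (z := w) (h := h)
      (by linarith))
    have := mul_nonneg hp d1
    have := mul_nonneg hp d2
    calc _ ≤ |ker R c z| + |ker R c w| := abs_sub _ _
      _ ≤ _ := by nlinarith
  · have hz0 : 0 < ‖z‖ := by linarith
    have hw0 : 0 < ‖w‖ := by linarith
    rcases le_or_gt R ‖z‖ with hRz | hRz
    · have e1 : ker R c z = 0 := by
        rw [ker, cut_eq_zero hR ((pow_le_pow_left₀ hR.le hRz 2).trans (norm_sq_le_nsq z))]; simp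
      have e2 : ker R c w = 0 := by
        rw [ker, cut_eq_zero hR
          ((pow_le_pow_left₀ hR.le (hRz.trans hzw) 2).trans (norm_sq_le_nsq w))]; simp
      rw [e1, e2]; simp; positivity
    · have hb : z ∈ Metric.ball (0 : ℝ × ℝ) R := by simpa using hRz
      have nz := nsq_pos (norm_pos_iff.1 hz0)
      have nw := nsq_pos (norm_pos_iff.1 hw0)
      have lz := norm_sq_le_nsq z
      have lw := norm_sq_le_nsq w
      have hn : |nsq z - nsq w| ≤ 5 * h * ‖z‖ := by
        refine (abs_nsq_sub_le z w).trans ?_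
        nlinarith
      have hcw := hc w
      have key : |ker R c z - ker R c w| ≤ 14 * (h / ‖z‖ ^ 2) := by
        -- Numerator, cutoff and denominator are changed one at a time. The three terms cost 1, 7.5
        -- and 5 times h/‖z‖², whence the constant 14.
        have e : ker R c z - ker R c w = c (z - w) * cut R (nsq z) / nsq z
            + c w * (cut R (nsq z) - cut R (nsq w)) / nsq z
            + cut R (nsq w) * (c w / nsq w) * ((nsq w - nsq z) / nsq z) := by
          rw [map_sub, ker, ker]; field_simp; ring
        have t1 : |c (z - w) * cut R (nsq z) / nsq z| ≤ h / ‖z‖ ^ 2 := by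
          rw [abs_div, abs_mul, abs_of_nonneg (cut_nonneg _ _), abs_of_pos nz]
          have := mul_le_mul (hc (z - w)) (cut_le_one (R := R) (nsq_nonneg z)) (cut_nonneg _ _)
            (norm_nonneg _)
          rw [mul_one] at this
          gcongr
        have t2 : |c w * (cut R (nsq z) - cut R (nsq w)) / nsq z| ≤ 7.5 * (h / ‖z‖ ^ 2) := by
          rw [abs_div, abs_mul, abs_of_pos nz]
          have b1 : |cut R (nsq z) - cut R (nsq w)| ≤ 5 * h * ‖z‖ / ‖z‖ ^ 2 := by
            refine (abs_cut_sub_le R _ _).trans ?_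
            gcongr
          have b2 : |c w| ≤ 1.5 * ‖z‖ := by linarith
          calc _ ≤ (1.5 * ‖z‖) * (5 * h * ‖z‖ / ‖z‖ ^ 2) / ‖z‖ ^ 2 := by gcongr
            _ = _ := by field_simp; ring
        have t3 : |cut R (nsq w) * (c w / nsq w) * ((nsq w - nsq z) / nsq z)| ≤
            5 * (h / ‖z‖ ^ 2) := by
          rw [abs_mul, abs_mul, abs_div, abs_div, abs_of_nonneg (cut_nonneg _ _), abs_of_pos nz,
            abs_of_pos nw, abs_sub_comm (nsq w)]
          have b1 : |c w| / nsq w ≤ 1 / ‖z‖ := by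
            rw [div_le_div_iff₀ nw hz0]
            nlinarith
          have b2 := cut_le_one (R := R) (nsq_nonneg w)
          calc _ ≤ 1 * (1 / ‖z‖) * ((5 * h * ‖z‖) / ‖z‖ ^ 2) := by gcongr
            _ = _ := by field_simp
        rw [e]
        refine (abs_add_le _ _).trans ?_
        have := abs_add_le (c (z - w) * cut R (nsq z) / nsq z)
          (c w * (cut R (nsq z) - cut R (nsq w)) / nsq z)
        have : 0 ≤ h / ‖z‖ ^ 2 := by positivity
        linarith
      -- Interpolation: h = h^α h^(1-α) and h ≤ ‖z‖ in the far case.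
      have e2 : h / ‖z‖ ^ 2 ≤ h ^ α * dom R (1 + α) z := by
        rw [dom, indicator_of_mem hb]
        rcases hh0.eq_or_lt with h0 | h0
        · rw [← h0, zero_div, Real.zero_rpow hα0.ne', zero_mul]
        have : ‖z‖ ^ (-(1 + α)) = ‖z‖ ^ (1 - α) / ‖z‖ ^ 2 := by
          rw [← Real.rpow_natCast, ← Real.rpow_sub hz0]; congr 1; push_cast; ring
        rw [this, ← mul_div_assoc]
        gcongr
        calc h = h ^ α * h ^ (1 - α) := by rw [← Real.rpow_add h0]; simp
          _ ≤ _ := by gcongr <;> linarith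
      have := mul_nonneg hp d2
      nlinarith

/-- Pointwise Hölder bound for the kernel, with integrable majorant. -/
lemma abs_ker_sub_le (hR : 0 < R) (hc : ∀ z, |c z| ≤ ‖z‖) {α : ℝ} (hα0 : 0 < α) (hα1 : α < 1)
    (z w : ℝ × ℝ) :
    |ker R c z - ker R c w| ≤
      14 * ‖z - w‖ ^ α * (dom R (1 + α) z + dom R (1 + α) w) := by
  rcases le_total ‖z‖ ‖w‖ with h | h
  · exact abs_ker_sub_le_aux hR hc hα0 hα1 h
  · rw [abs_sub_comm, norm_sub_rev, add_comm (dom R _ z)]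
    exact abs_ker_sub_le_aux hR hc hα0 hα1 h

end Kernel

/-! ### Convolution of integrable kernels with Lipschitz functions -/

section Convolution

variable {F : Type*} [NormedAddCommGroup F] [NormedSpace ℝ F]

/-- Rademacher's theorem, transported by z ↦ x - z, which preserves null sets. -/
lemma ae_differentiableAt_sub {w : ℝ × ℝ → ℝ} {C : ℝ≥0} (hw : LipschitzWith C w) (x : ℝ × ℝ) :
    ∀ᵐ z : ℝ × ℝ, DifferentiableAt ℝ w (x - z) :=
  (quasiMeasurePreserving_sub_left_of_right_invariant volume x).ae hw.ae_differentiableAt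

lemma integrable_mul_comp_sub {k : ℝ × ℝ → ℝ} (hk : Integrable k) {g : ℝ × ℝ → F}
    (hg : AEStronglyMeasurable g) {B : ℝ} (hB : ∀ z, ‖g z‖ ≤ B) (x : ℝ × ℝ) :
    Integrable (fun z => k z • g (x - z)) :=
  hk.smul_bdd B
    (hg.comp_quasiMeasurePreserving (quasiMeasurePreserving_sub_left_of_right_invariant volume x))
    (Eventually.of_forall fun _ => hB _)

/-- The derivative falls on the Lipschitz factor, so the kernel need only be integrable. Difference
quotients are dominated by |k| C, and almost everywhere differentiability of w is enough under the
integral. -/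
lemma hasFDerivAt_integral_comp_sub {k w : ℝ × ℝ → ℝ} (hk : Integrable k) {C : ℝ≥0}
    (hw : LipschitzWith C w) {B : ℝ} (hB : ∀ z, |w z| ≤ B) (x : ℝ × ℝ) :
    HasFDerivAt (fun x => ∫ z, k z * w (x - z)) (∫ z, k z • fderiv ℝ w (x - z)) x := by
  have hint := fun x => integrable_mul_comp_sub hk (g := w)
    hw.continuous.aestronglyMeasurable (B := B) hB x
  simp only [smul_eq_mul] at hint
  refine (hasFDerivAt_integral_of_dominated_loc_of_lip (bound := fun z => |k z| * C) univ_mem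
    (Eventually.of_forall fun x => (hint x).aestronglyMeasurable) (hint x) ?_ ?_
    (hk.abs.mul_const _) ?_).2
  · exact hk.aestronglyMeasurable.smul
      ((measurable_fderiv ℝ w).comp (measurable_const.sub measurable_id)).aestronglyMeasurable
  · refine Eventually.of_forall fun z => LipschitzOnWith.of_dist_le_mul fun a _ b _ => ?_
    have := hw.dist_le_mul (a - z) (b - z)
    rw [dist_sub_right] at this
    rw [Real.dist_eq, ← mul_sub, abs_mul, Real.coe_nnabs, abs_of_nonneg (a := |k z| * C)
      (by positivity), mul_assoc]
    rw [Real.dist_eq] at this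
    gcongr
  · filter_upwards [ae_differentiableAt_sub hw x] with z hz
    have h1 : HasFDerivAt (fun x' => w (x' - z)) (fderiv ℝ w (x - z)) x :=
      (hasFDerivAt_comp_sub z).2 hz.hasFDerivAt
    exact h1.const_mul (k z)

/-- Used with g the gradient of w, which is merely bounded and measurable: all Hölder regularity
comes from the kernel. The constant 28 is twice that of `abs_ker_sub_le`, one share for each
translate of the majorant. -/
lemma norm_integral_ker_sub_le {R : ℝ} {c : ℝ × ℝ →L[ℝ] ℝ} (hR : 0 < R)
    (hc : ∀ z, |c z| ≤ ‖z‖) {α : ℝ} (hα0 : 0 < α) (hα1 : α < 1) {g : ℝ × ℝ → F}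
    (hg : AEStronglyMeasurable g) {B : ℝ} (hB : ∀ z, ‖g z‖ ≤ B) (x y : ℝ × ℝ) :
    ‖(∫ z, ker R c z • g (x - z)) - ∫ z, ker R c z • g (y - z)‖ ≤
      (28 * B * ∫ z, dom R (1 + α) z) * ‖x - y‖ ^ α := by
  have hB0 : 0 ≤ B := (norm_nonneg _).trans (hB 0)
  -- The substitution moves the dependence on x from g to the kernel.
  have e : ∀ x : ℝ × ℝ, (∫ z, ker R c z • g (x - z)) = ∫ z, ker R c (x - z) • g z := fun x => by
    rw [← integral_sub_left_eq_self (fun z => ker R c (x - z) • g z) volume x]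
    simp
  have hd := integrable_dom (R := R) (s := 1 + α) (by linarith)
  have hi : ∀ x : ℝ × ℝ, Integrable (fun z => ker R c (x - z) • g z) := fun x =>
    ((integrable_ker hR hc).comp_sub_left x).smul_bdd B hg
      (Eventually.of_forall fun _ => hB _)
  rw [e, e, ← integral_sub (hi x) (hi y)]
  have hdx : ∀ x : ℝ × ℝ, Integrable fun z => dom R (1 + α) (x - z) := fun x => hd.comp_sub_left x
  calc _ ≤ ∫ z, 14 * ‖x - y‖ ^ α * B * (dom R (1 + α) (x - z) + dom R (1 + α) (y - z)) := by
        refine norm_integral_le_of_norm_le (((hdx x).add (hdx y)).const_mul _)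
          (Eventually.of_forall fun z => ?_)
        rw [← sub_smul, norm_smul, Real.norm_eq_abs]
        have h1 := abs_ker_sub_le hR hc hα0 hα1 (x - z) (y - z)
        rw [sub_sub_sub_cancel_right] at h1
        calc _ ≤ 14 * ‖x - y‖ ^ α * (dom R (1 + α) (x - z) + dom R (1 + α) (y - z)) * B :=
              mul_le_mul h1 (hB z) (norm_nonneg _) ((abs_nonneg _).trans h1)
          _ = _ := by ring
    _ = _ := by
        rw [integral_const_mul, integral_add (hdx x) (hdx y),
          integral_sub_left_eq_self (dom R (1 + α)), integral_sub_left_eq_self (dom R (1 + α))]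
        ring

end Convolution

/-! ### The truncated logarithmic potential -/

/-- The regularized profile `(1 - s / R²)₊ / (s₊ + η)`. -/
noncomputable def prof (R η s : ℝ) : ℝ := cut R s / (max s 0 + η)

/-- The regularized radial potential, as a function of the squared distance. -/
noncomputable def potS (R η s : ℝ) : ℝ := 2⁻¹ * ∫ σ in s..R ^ 2, prof R η σ

/-- The functional `z ↦ v · z`. -/
noncomputable def dotL (v : ℝ × ℝ) : ℝ × ℝ →L[ℝ] ℝ :=
  v.1 • ContinuousLinearMap.fst ℝ ℝ ℝ + v.2 • ContinuousLinearMap.snd ℝ ℝ ℝ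

@[simp] lemma dotL_apply (v z : ℝ × ℝ) : dotL v z = v.1 * z.1 + v.2 * z.2 := by simp [dotL]

section Potential

variable {R η : ℝ}

lemma prof_nonneg (hη : 0 ≤ η) (s : ℝ) : 0 ≤ prof R η s :=
  div_nonneg (cut_nonneg _ _) (by positivity)

lemma continuous_prof (hη : 0 < η) : Continuous (prof R η) := by
  unfold prof
  exact (continuous_cut R).div (by fun_prop) fun s => by positivity

lemma continuousOn_prof (hη : 0 ≤ η) : ContinuousOn (prof R η) (Ioi 0) := by
  unfold prof
  refine (continuous_cut R).continuousOn.div (by fun_prop) fun s (hs : 0 < s) => ?_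
  have : 0 < max s 0 := lt_max_of_lt_left hs
  positivity

lemma hasDerivAt_potS (hη : 0 < η) (s : ℝ) : HasDerivAt (potS R η) (-(2⁻¹ * prof R η s)) s := by
  have h := intervalIntegral.integral_hasDerivAt_left
    ((continuous_prof (R := R) hη).intervalIntegrable s (R ^ 2))
    (continuous_prof hη).aestronglyMeasurable.stronglyMeasurableAtFilter
    (continuous_prof hη).continuousAt
  exact (h.const_mul 2⁻¹).congr_deriv (by ring)

lemma potS_eq_zero (hR : 0 < R) {s : ℝ} (hs : R ^ 2 ≤ s) : potS R η s = 0 := by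
  rw [potS, intervalIntegral.integral_symm,
    intervalIntegral.integral_congr (g := fun _ => 0) fun σ hσ => ?_]
  · simp
  · rw [uIcc_of_le hs] at hσ
    simp [prof, cut_eq_zero hR hσ.1]

lemma intervalIntegrable_prof (hη : 0 ≤ η) (hR : 0 < R) {s : ℝ} (hs : 0 < s) :
    IntervalIntegrable (prof R η) volume s (R ^ 2) :=
  ((continuousOn_prof hη).mono fun _ hx => by
    have : 0 < R ^ 2 := by positivity
    exact lt_of_lt_of_le (lt_min hs this) hx.1).intervalIntegrable

/-- The logarithm is bounded crudely by log t ≤ t - 1 with t = R/√s. This is uniform in η and lets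
the majorant 1/‖z‖ of the kernel serve for the potential too. -/
lemma abs_potS_le (hη : 0 ≤ η) (hR : 0 < R) {s : ℝ} (hs : 0 < s) (hsR : s < R ^ 2) :
    |potS R η s| ≤ R / √s := by
  have h0 : 0 ≤ ∫ σ in s..R ^ 2, prof R η σ :=
    intervalIntegral.integral_nonneg hsR.le fun σ _ => prof_nonneg hη σ
  have h1 : ∫ σ in s..R ^ 2, prof R η σ ≤ ∫ σ in s..R ^ 2, 1 / σ := by
    refine intervalIntegral.integral_mono_on hsR.le (intervalIntegrable_prof hη hR hs) ?_ ?_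
    · refine ContinuousOn.intervalIntegrable (continuousOn_const.div continuousOn_id fun σ hσ => ?_)
      rw [uIcc_of_le hsR.le] at hσ
      exact (hs.trans_le hσ.1).ne'
    · intro σ hσ
      have : 0 < σ := hs.trans_le hσ.1
      have := cut_le_one (R := R) this.le
      rw [prof, max_eq_left (by linarith)]
      gcongr
      linarith
  rw [integral_one_div_of_pos hs (by positivity)] at h1
  have h2 : Real.log (R ^ 2 / s) = 2 * Real.log (R / √s) := by
    conv_lhs => rw [← Real.sq_sqrt hs.le, ← div_pow, Real.log_pow]
    norm_num
  have h3 := Real.log_le_sub_one_of_pos (x := R / √s) (by positivity)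
  rw [potS, abs_of_nonneg (by positivity)]
  linarith

/-- The truncated logarithmic potential and its regularizations. -/
noncomputable def pot (R η : ℝ) (z : ℝ × ℝ) : ℝ := potS R η (nsq z)

lemma hasFDerivAt_pot (hη : 0 < η) (z : ℝ × ℝ) :
    HasFDerivAt (pot R η) (-(prof R η (nsq z)) • dotL z) z := by
  have h1 : HasFDerivAt nsq ((2 : ℝ) • dotL z) z := by
    have a := ((hasFDerivAt_fst (𝕜 := ℝ) (p := z)).pow 2).add
      ((hasFDerivAt_snd (𝕜 := ℝ) (p := z)).pow 2)
    refine a.congr_fderiv ?_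
    ext <;> simp
  have h2 := (hasDerivAt_potS (R := R) hη (nsq z)).comp_hasFDerivAt z h1
  refine h2.congr_fderiv ?_
  rw [smul_smul]; congr 1; ring

lemma continuous_dotL : Continuous dotL := by unfold dotL; fun_prop

lemma hasCompactSupport_pot (hR : 0 < R) : HasCompactSupport (pot R η) := by
  refine HasCompactSupport.of_support_subset_isCompact
    (isCompact_closedBall (0 : ℝ × ℝ) R) fun z hz => ?_
  by_contra h
  rw [mem_closedBall_zero_iff, not_le] at h
  exact hz (potS_eq_zero hR ((pow_le_pow_left₀ hR.le h.le 2).trans (norm_sq_le_nsq z)))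

/-- This is what the regularization is for: with η > 0 the potential is C¹ with compact support, and
integration by parts against a Lipschitz function is available. -/
lemma exists_lipschitzWith_pot (hR : 0 < R) (hη : 0 < η) : ∃ C, LipschitzWith C (pot R η) := by
  have h : ContDiff ℝ 1 (pot R η) := by
    rw [contDiff_one_iff_fderiv]
    refine ⟨fun z => (hasFDerivAt_pot hη z).differentiableAt, ?_⟩
    have : fderiv ℝ (pot R η) = fun z => -(prof R η (nsq z)) • dotL z :=
      funext fun z => (hasFDerivAt_pot hη z).fderiv
    rw [this]
    exact ((continuous_prof hη).comp continuous_nsq).neg.smul continuous_dotL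
  exact h.lipschitzWith_of_hasCompactSupport (hasCompactSupport_pot hR) one_ne_zero

/-- For fixed s > 0 the interval of integration stays at distance m = min(s, R²) from 0, where the
profiles differ by at most η/m². -/
lemma tendsto_potS (hR : 0 < R) {s : ℝ} (hs : 0 < s) :
    Tendsto (fun η => potS R η s) (𝓝[>] 0) (𝓝 (potS R 0 s)) := by
  have hR2 : 0 < R ^ 2 := by positivity
  set m := min s (R ^ 2)
  have hm : 0 < m := lt_min hs hR2
  have key : ∀ η > 0, |potS R η s - potS R 0 s| ≤ 2⁻¹ * (1 / m ^ 2 * |R ^ 2 - s|) * η := by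
    intro η hη
    rw [potS, potS, ← mul_sub, ← intervalIntegral.integral_sub
      (intervalIntegrable_prof hη.le hR hs) (intervalIntegrable_prof le_rfl hR hs), abs_mul,
      abs_of_pos (by norm_num : (0 : ℝ) < 2⁻¹)]
    have := intervalIntegral.norm_integral_le_of_norm_le_const (a := s) (b := R ^ 2)
      (f := fun σ => prof R η σ - prof R 0 σ) (C := 1 / m ^ 2 * η) fun σ hσ => ?_
    · rw [Real.norm_eq_abs] at this
      linarith
    · have hmσ : m ≤ σ := hσ.1.le
      have hσ0 : 0 < σ := hm.trans_le hmσ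
      have e : prof R η σ - prof R 0 σ = -(cut R σ * (η / (σ * (σ + η)))) := by
        rw [prof, prof, max_eq_left hσ0.le]; field_simp; ring
      rw [e, norm_neg, Real.norm_eq_abs, abs_mul, abs_of_nonneg (cut_nonneg _ _),
        abs_of_pos (by positivity)]
      calc _ ≤ 1 * (η / (m * m)) := by
            have := cut_le_one (R := R) hσ0.le
            gcongr
            linarith
        _ = _ := by ring
  rw [tendsto_iff_norm_sub_tendsto_zero]
  refine squeeze_zero' (Eventually.of_forall fun _ => norm_nonneg _)
    (eventually_nhdsWithin_of_forall fun η hη => key η hη) ?_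
  have : Tendsto (fun η : ℝ => 2⁻¹ * (1 / m ^ 2 * |R ^ 2 - s|) * η) (𝓝 0) (𝓝 0) := by
    have h : Continuous fun η : ℝ => 2⁻¹ * (1 / m ^ 2 * |R ^ 2 - s|) * η := by fun_prop
    simpa using h.tendsto 0
  exact this.mono_left nhdsWithin_le_nhds

lemma ae_ne_zero : ∀ᵐ z : ℝ × ℝ, z ≠ 0 := by
  have : volume ({0} : Set (ℝ × ℝ)) = 0 := measure_singleton 0
  rw [ae_iff]; simp

lemma abs_pot_le (hη : 0 ≤ η) (hR : 0 < R) {z : ℝ × ℝ} (hz : z ≠ 0) :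
    |pot R η z| ≤ R * dom R 1 z := by
  rcases lt_or_ge (nsq z) (R ^ 2) with h | h
  · have hb : z ∈ Metric.ball (0 : ℝ × ℝ) R := by simpa using norm_lt_of_nsq_lt hR h
    refine (abs_potS_le hη hR (nsq_pos hz) h).trans ?_
    have hz' := norm_pos_iff.2 hz
    rw [dom, indicator_of_mem hb, Real.rpow_neg_one, ← div_eq_mul_inv]
    have := Real.le_sqrt_of_sq_le (norm_sq_le_nsq z)
    gcongr
  · rw [pot, potS_eq_zero hR h]
    simpa using mul_nonneg hR.le (dom_nonneg R 1 z)

lemma aestronglyMeasurable_pot (hR : 0 < R) : AEStronglyMeasurable (pot R 0) := by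
  refine aestronglyMeasurable_of_tendsto_ae (𝓝[>] (0 : ℝ))
    (f := fun η => if 0 < η then pot R η else 0) (fun η => ?_) ?_
  · split_ifs with h
    · exact (exists_lipschitzWith_pot hR h).choose_spec.continuous.aestronglyMeasurable
    · exact aestronglyMeasurable_zero
  · filter_upwards [ae_ne_zero] with z hz
    refine (tendsto_potS hR (nsq_pos hz)).congr' ?_
    filter_upwards [self_mem_nhdsWithin] with η (hη : 0 < η)
    simp [hη, pot]

lemma integrable_pot (hR : 0 < R) : Integrable (pot R 0) :=
  ((integrable_dom (R := R) (s := 1) (by norm_num)).const_mul R).mono'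
    (aestronglyMeasurable_pot hR) (by
      filter_upwards [ae_ne_zero] with z hz using abs_pot_le le_rfl hR hz)

lemma ker_eq_prof_zero (c : ℝ × ℝ →L[ℝ] ℝ) (z : ℝ × ℝ) : ker R c z = prof R 0 (nsq z) * c z := by
  rw [ker, prof, max_eq_left (nsq_nonneg z), add_zero]; ring

lemma abs_prof_mul_le (hη : 0 ≤ η) (c : ℝ × ℝ →L[ℝ] ℝ) {z : ℝ × ℝ} (hz : z ≠ 0) :
    |prof R η (nsq z) * c z| ≤ |ker R c z| := by
  have := nsq_pos hz
  rw [ker_eq_prof_zero, abs_mul, abs_mul, abs_of_nonneg (prof_nonneg hη _),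
    abs_of_nonneg (prof_nonneg le_rfl _), prof, prof, max_eq_left this.le]
  have := cut_nonneg R (nsq z)
  gcongr

lemma tendsto_prof {s : ℝ} (hs : 0 < s) : Tendsto (fun η => prof R η s) (𝓝[>] 0) (𝓝 (prof R 0 s)) := by
  have : ContinuousAt (fun η => prof R η s) 0 := by
    unfold prof
    refine continuousAt_const.div (by fun_prop) ?_
    rw [max_eq_left hs.le, add_zero]; exact hs.ne'
  exact this.tendsto.mono_left nhdsWithin_le_nhds

/-- The gradient of the potential of a Lipschitz function. -/
lemma integral_pot_mul_fderiv (hR : 0 < R) {v : ℝ × ℝ} (hv : ∀ z, |dotL v z| ≤ ‖z‖)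
    {w : ℝ × ℝ → ℝ} {C : ℝ≥0} (hw : LipschitzWith C w) {B : ℝ} (hB : ∀ z, |w z| ≤ B)
    (x : ℝ × ℝ) :
    ∫ z, pot R 0 z * fderiv ℝ w (x - z) v = -∫ z, ker R (dotL v) z * w (x - z) := by
  have hu : LipschitzWith C (fun z => w (x - z)) := by
    refine LipschitzWith.of_dist_le_mul fun a b => ?_
    have := hw.dist_le_mul (x - a) (x - b)
    rwa [dist_sub_left] at this
  have hDmeas : Measurable fun z => fderiv ℝ w (x - z) v :=
    (measurable_fderiv_apply_const ℝ w v).comp (measurable_const.sub measurable_id)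
  have hDb : ∀ z, |fderiv ℝ w (x - z) v| ≤ C * ‖v‖ := fun z =>
    (ContinuousLinearMap.le_opNorm _ _).trans
      (mul_le_mul_of_nonneg_right (norm_fderiv_le_of_lipschitz ℝ hw) (norm_nonneg v))
  -- With η > 0 both factors are Lipschitz and one has compact support, so integration by parts
  -- leaves no boundary term. The gradient of the regularized potential is minus the regularized
  -- kernel; the reflection z ↦ x - z contributes the other sign.
  have key : ∀ η > 0, ∫ z, pot R η z * fderiv ℝ w (x - z) v =
      -∫ z, prof R η (nsq z) * dotL v z * w (x - z) := by
    intro η hη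
    obtain ⟨D, hD⟩ := exists_lipschitzWith_pot hR hη
    have h := LipschitzWith.integral_lineDeriv_mul_eq (μ := volume) hu hD
      (hasCompactSupport_pot hR) v
    have e1 : ∀ z, lineDeriv ℝ (pot R η) z (-v) = prof R η (nsq z) * dotL v z := fun z => by
      rw [((hasFDerivAt_pot hη z).hasLineDerivAt (-v)).lineDeriv]
      simp; ring
    have e2 : ∀ᵐ z, lineDeriv ℝ (fun z => w (x - z)) z v * pot R η z =
        -(pot R η z * fderiv ℝ w (x - z) v) := by
      filter_upwards [ae_differentiableAt_sub hw x] with z hz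
      have h1 : HasFDerivAt (fun z => w (x - z)) (-fderiv ℝ w (x - z)) z := by
        have := hz.hasFDerivAt.comp z ((hasFDerivAt_id z).const_sub x)
        simpa [Function.comp_def] using this
      rw [(h1.hasLineDerivAt v).lineDeriv]
      simp; ring
    rw [integral_congr_ae e2, integral_neg] at h
    simp only [e1] at h
    linarith
  -- Both sides pass to the limit η → 0 by dominated convergence: the potential is controlled by a
  -- multiple of `dom R 1`, the regularized kernel by the unregularized one.
  have t1 : Tendsto (fun η => ∫ z, pot R η z * fderiv ℝ w (x - z) v) (𝓝[>] 0)
      (𝓝 (∫ z, pot R 0 z * fderiv ℝ w (x - z) v)) := by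
    refine tendsto_integral_filter_of_dominated_convergence
      (fun z => R * dom R 1 z * (C * ‖v‖)) ?_ ?_ ?_ ?_
    · filter_upwards [self_mem_nhdsWithin] with η (hη : 0 < η)
      exact (exists_lipschitzWith_pot hR hη).choose_spec.continuous.aestronglyMeasurable.mul
        hDmeas.aestronglyMeasurable
    · filter_upwards [self_mem_nhdsWithin] with η (hη : 0 < η)
      filter_upwards [ae_ne_zero] with z hz
      rw [Real.norm_eq_abs, abs_mul]
      have h1 := abs_pot_le hη.le hR hz
      exact mul_le_mul h1 (hDb z) (abs_nonneg _) ((abs_nonneg _).trans h1)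
    · exact ((integrable_dom (by norm_num)).const_mul R).mul_const _
    · filter_upwards [ae_ne_zero] with z hz
      exact (tendsto_potS hR (nsq_pos hz)).mul_const _
  have t2 : Tendsto (fun η => ∫ z, prof R η (nsq z) * dotL v z * w (x - z)) (𝓝[>] 0)
      (𝓝 (∫ z, ker R (dotL v) z * w (x - z))) := by
    refine tendsto_integral_filter_of_dominated_convergence
      (fun z => |ker R (dotL v) z| * B) ?_ ?_ ?_ ?_
    · filter_upwards [self_mem_nhdsWithin] with η (hη : 0 < η)
      have := (continuous_prof (R := R) hη).comp continuous_nsq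
      have := hw.continuous
      exact Continuous.aestronglyMeasurable (by fun_prop)
    · filter_upwards [self_mem_nhdsWithin] with η (hη : 0 < η)
      filter_upwards [ae_ne_zero] with z hz
      rw [Real.norm_eq_abs, abs_mul]
      exact mul_le_mul (abs_prof_mul_le hη.le _ hz) (hB _) (abs_nonneg _) (abs_nonneg _)
    · exact (integrable_ker hR hv).abs.mul_const _
    · filter_upwards [ae_ne_zero] with z hz
      rw [ker_eq_prof_zero]
      exact ((tendsto_prof (nsq_pos hz)).mul_const _).mul_const _
  refine tendsto_nhds_unique t1 (t2.neg.congr' ?_)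
  filter_upwards [self_mem_nhdsWithin] with η hη
  exact (key η hη).symm

end Potential

/-! ### The Laplacian of the potential, in polar coordinates -/

section Polar

open Real (cos sin)

/-- The unit vector of angle `θ`. -/
noncomputable def ang (θ : ℝ) : ℝ × ℝ := (cos θ, sin θ)

lemma continuous_ang : Continuous ang := by unfold ang; fun_prop

lemma polarCoord_symm_eq (p : ℝ × ℝ) : polarCoord.symm p = p.1 • ang p.2 := by
  simp [polarCoord_symm_apply, ang]

lemma nsq_smul_ang (ρ θ : ℝ) : nsq (ρ • ang θ) = ρ ^ 2 := by
  simp only [nsq, ang, Prod.smul_mk, smul_eq_mul]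
  linear_combination ρ ^ 2 * Real.cos_sq_add_sin_sq θ

lemma norm_ang_le (θ : ℝ) : ‖ang θ‖ ≤ 1 := by
  rw [Prod.norm_def]
  exact max_le (Real.abs_cos_le_one θ) (Real.abs_sin_le_one θ)

lemma measurableSet_polarTarget : MeasurableSet polarCoord.target :=
  polarCoord.open_target.measurableSet

/-- The change of variables formula for the indicator of the exceptional null set gives a vanishing
integral with weight equal to the radius. The radius is positive on the target, so the preimage is
null. -/
lemma ae_polarCoord_symm {p : ℝ × ℝ → Prop} (hm : MeasurableSet {z | p z}) (hp : ∀ᵐ z, p z) :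
    ∀ᵐ q ∂volume.restrict polarCoord.target, p (polarCoord.symm q) := by
  have h := lintegral_comp_polarCoord_symm (indicator {z | p z}ᶜ 1)
  have hmc := hm.compl
  have h0 : volume {z | p z}ᶜ = 0 := ae_iff.1 hp
  rw [lintegral_indicator_one hmc, h0] at h
  have hmeas : Measurable fun q : ℝ × ℝ =>
      ENNReal.ofReal q.1 • (indicator {z | p z}ᶜ (1 : ℝ × ℝ → ℝ≥0∞)) (polarCoord.symm q) := by
    refine (by fun_prop : Measurable fun q : ℝ × ℝ => ENNReal.ofReal q.1).smul ?_
    exact (measurable_const.indicator hmc).comp continuous_polarCoord_symm.measurable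
  rw [lintegral_eq_zero_iff hmeas] at h
  filter_upwards [h, ae_restrict_mem measurableSet_polarTarget] with q hq hq2
  by_contra hcon
  have h1 : 0 < q.1 := by
    have := hq2.1; exact this
  have : polarCoord.symm q ∈ {z | p z}ᶜ := hcon
  rw [indicator_of_mem this] at hq
  simp at hq
  linarith

variable {R : ℝ} {u : ℝ × ℝ → ℝ} {C : ℝ≥0}

lemma lipschitzWith_ray (hu : LipschitzWith C u) (θ : ℝ) :
    LipschitzWith C fun ρ : ℝ => u (ρ • ang θ) := by
  refine LipschitzWith.of_dist_le_mul fun a b => (hu.dist_le_mul _ _).trans ?_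
  rw [dist_eq_norm, ← sub_smul, norm_smul, dist_eq_norm]
  have := norm_ang_le θ
  have := norm_nonneg (a - b)
  gcongr
  nlinarith

/-- Integration by parts on [0, R]. The cutoff equals 1 at the centre and 0 at R, and its derivative
is -2ρ/R²: the factor ρ is exactly the polar area weight, which is why this cutoff, affine in the
squared distance, yields a mean over the disc. -/
lemma integral_cut_mul_deriv (hR : 0 < R) {g : ℝ → ℝ} (hg : LipschitzWith C g) :
    ∫ ρ in Ioi (0 : ℝ), cut R (ρ ^ 2) * deriv g ρ =
      -g 0 + 2 / R ^ 2 * ∫ ρ in Ioo 0 R, ρ * g ρ := by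
  have h1 : ∫ ρ in Ioi (0 : ℝ), cut R (ρ ^ 2) * deriv g ρ =
      ∫ ρ in Ioc 0 R, cut R (ρ ^ 2) * deriv g ρ := by
    refine setIntegral_eq_of_subset_of_forall_sdiff_eq_zero measurableSet_Ioi
      (fun x hx => hx.1) fun x hx => ?_
    have hx' : R ≤ x := by
      by_contra! h; exact hx.2 ⟨hx.1, h.le⟩
    rw [cut_eq_zero hR (pow_le_pow_left₀ hR.le hx' 2), zero_mul]
  have h2 : ∫ ρ in Ioc 0 R, cut R (ρ ^ 2) * deriv g ρ =
      ∫ ρ in (0 : ℝ)..R, (1 - ρ ^ 2 / R ^ 2) * deriv g ρ := by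
    rw [intervalIntegral.integral_of_le hR.le]
    refine setIntegral_congr_fun measurableSet_Ioc fun ρ hρ => ?_
    rw [cut_eq hR (pow_le_pow_left₀ hρ.1.le hρ.2 2)]
  have hd : ∀ ρ : ℝ, HasDerivAt (fun ρ : ℝ => 1 - ρ ^ 2 / R ^ 2) (-(2 * ρ / R ^ 2)) ρ := fun ρ => by
    simpa using ((hasDerivAt_pow 2 ρ).div_const (R ^ 2)).const_sub 1
  have hac : AbsolutelyContinuousOnInterval (fun ρ : ℝ => 1 - ρ ^ 2 / R ^ 2) 0 R := by
    obtain ⟨K, hK⟩ := (isCompact_uIcc (a := (0 : ℝ)) (b := R)).exists_bound_of_continuousOn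
      (f := fun ρ : ℝ => -(2 * ρ / R ^ 2)) (by fun_prop)
    refine LipschitzOnWith.absolutelyContinuousOnInterval (K := K.toNNReal) ?_
    refine (convex_uIcc 0 R).lipschitzOnWith_of_nnnorm_hasDerivWithin_le
      (fun x _ => (hd x).hasDerivWithinAt) fun x hx => ?_
    rw [← norm_toNNReal]
    exact Real.toNNReal_le_toNNReal (hK x hx)
  rw [h1, h2, hac.integral_mul_deriv_eq_deriv_mul
    hg.lipschitzOnWith.absolutelyContinuousOnInterval]
  have h3 : ∫ ρ in (0 : ℝ)..R, deriv (fun ρ : ℝ => 1 - ρ ^ 2 / R ^ 2) ρ * g ρ =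
      -(2 / R ^ 2 * ∫ ρ in Ioo 0 R, ρ * g ρ) := by
    rw [← integral_Ioc_eq_integral_Ioo, ← intervalIntegral.integral_of_le hR.le,
      ← intervalIntegral.integral_const_mul, ← intervalIntegral.integral_neg]
    congr 1; ext ρ
    rw [(hd ρ).deriv]; ring
  rw [h3]
  field_simp
  ring

lemma restrict_polarTarget :
    (volume : Measure (ℝ × ℝ)).restrict polarCoord.target =
      (volume.restrict (Ioi (0 : ℝ))).prod (volume.restrict (Ioo (-Real.pi) Real.pi)) := by
  rw [Measure.prod_restrict]; rfl

/-- Integral representation of a bounded Lipschitz function by its gradient on a disc. -/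
lemma integral_cut_div_mul_fderiv (hR : 0 < R) (hu : LipschitzWith C u) :
    ∫ z, cut R (nsq z) / nsq z * fderiv ℝ u z z =
      -(2 * Real.pi * u 0) + 2 / R ^ 2 * ∫ z in {z | nsq z < R ^ 2}, u z := by
  -- `G` has the derivative along each ray, as needed for integrating by parts on every ray; `H` has
  -- the gradient and is visibly measurable and bounded. They agree almost everywhere by
  -- Rademacher's theorem.
  set G : ℝ × ℝ → ℝ := fun p => cut R (p.1 ^ 2) * deriv (fun ρ : ℝ => u (ρ • ang p.2)) p.1 with hG
  set H : ℝ × ℝ → ℝ := fun p => cut R (p.1 ^ 2) *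
    (cos p.2 * fderiv ℝ u (p.1 • ang p.2) (1, 0) + sin p.2 * fderiv ℝ u (p.1 • ang p.2) (0, 1))
    with hH
  have hpi : -Real.pi ≤ Real.pi := by linarith [Real.pi_pos]
  have eang : ∀ (z : ℝ × ℝ) (θ : ℝ), fderiv ℝ u z (ang θ) =
      cos θ * fderiv ℝ u z (1, 0) + sin θ * fderiv ℝ u z (0, 1) := fun z θ => by
    have : ang θ = cos θ • ((1, 0) : ℝ × ℝ) + sin θ • ((0, 1) : ℝ × ℝ) := by simp [ang]
    rw [this, map_add, map_smul, map_smul, smul_eq_mul, smul_eq_mul]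
  have hae : ∀ᵐ q ∂volume.restrict polarCoord.target, H q = G q := by
    filter_upwards [ae_polarCoord_symm (p := fun z => DifferentiableAt ℝ u z)
      (measurableSet_of_differentiableAt ℝ u) hu.ae_differentiableAt] with q hq
    rw [polarCoord_symm_eq] at hq
    have h1 : HasDerivAt (fun ρ : ℝ => ρ • ang q.2) (ang q.2) q.1 := by
      simpa using (hasDerivAt_id q.1).smul_const (ang q.2)
    have h2 := hq.hasFDerivAt.comp_hasDerivAt q.1 h1
    simp only [hG, hH]
    rw [← eang, ← h2.deriv]; rfl
  have hHmeas : Measurable H := by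
    have m : ∀ v, Measurable fun p : ℝ × ℝ => fderiv ℝ u (p.1 • ang p.2) v := fun v =>
      (measurable_fderiv_apply_const ℝ u v).comp
        (continuous_fst.smul (continuous_ang.comp continuous_snd)).measurable
    have := m (1, 0)
    have := m (0, 1)
    have := (continuous_cut R).measurable
    fun_prop
  have hHint : IntegrableOn H polarCoord.target := by
    have hfin : IntegrableOn (indicator (Ioo (0 : ℝ) R ×ˢ Ioo (-Real.pi) Real.pi)
        (fun _ => (C : ℝ))) polarCoord.target := by
      refine ((integrable_indicator_iff (measurableSet_Ioo.prod measurableSet_Ioo)).2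
        (integrableOn_const ?_)).integrableOn
      rw [Measure.volume_eq_prod, Measure.prod_prod]
      exact ENNReal.mul_ne_top (by simp) (by simp)
    refine hfin.mono' hHmeas.aestronglyMeasurable ?_
    filter_upwards [ae_restrict_mem measurableSet_polarTarget] with q hq
    have hq1 : 0 < q.1 := hq.1
    simp only [hH]
    rw [← eang, Real.norm_eq_abs, abs_mul, abs_of_nonneg (cut_nonneg _ _)]
    by_cases hqR : q.1 < R
    · rw [indicator_of_mem (show q ∈ Ioo (0 : ℝ) R ×ˢ Ioo (-Real.pi) Real.pi from
        ⟨⟨hq1, hqR⟩, hq.2⟩)]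
      have h1 : |fderiv ℝ u (q.1 • ang q.2) (ang q.2)| ≤ C * 1 :=
        (ContinuousLinearMap.le_opNorm _ _).trans (mul_le_mul
          (norm_fderiv_le_of_lipschitz ℝ hu) (norm_ang_le _) (norm_nonneg _) C.2)
      calc _ ≤ 1 * ((C : ℝ) * 1) := mul_le_mul (cut_le_one (by positivity)) h1 (abs_nonneg _)
            zero_le_one
        _ = C := by ring
    · rw [cut_eq_zero hR (pow_le_pow_left₀ hR.le (not_lt.1 hqR) 2), zero_mul]
      exact indicator_nonneg (fun _ _ => C.2) _
  have hGint : IntegrableOn G polarCoord.target := hHint.congr hae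
  -- The Jacobian ρ and the factor ρ from z = ρ · `ang` θ cancel the denominator ρ².
  have step1 : ∫ z, cut R (nsq z) / nsq z * fderiv ℝ u z z = ∫ p in polarCoord.target, G p := by
    rw [← integral_comp_polarCoord_symm, ← integral_congr_ae hae]
    refine setIntegral_congr_fun measurableSet_polarTarget fun p hp => ?_
    have hp1 : 0 < p.1 := hp.1
    simp only [hH]
    rw [polarCoord_symm_eq, nsq_smul_ang, map_smul, eang]
    simp only [smul_eq_mul]
    field_simp
  have step2 : ∫ p in polarCoord.target, G p =
      ∫ θ in Ioo (-Real.pi) Real.pi, (-u 0 + 2 / R ^ 2 * ∫ ρ in Ioo 0 R, ρ * u (ρ • ang θ)) := by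
    rw [IntegrableOn, restrict_polarTarget] at hGint
    rw [restrict_polarTarget, integral_prod_symm _ hGint]
    congr 1; ext θ
    simp only [hG]
    rw [integral_cut_mul_deriv hR (lipschitzWith_ray hu θ)]
    simp
  have hQint : IntegrableOn (fun p : ℝ × ℝ => p.1 * u (p.1 • ang p.2))
      (Ioo 0 R ×ˢ Ioo (-Real.pi) Real.pi) := by
    have hc : Continuous fun p : ℝ × ℝ => p.1 * u (p.1 • ang p.2) :=
      continuous_fst.mul (hu.continuous.comp
        (continuous_fst.smul (continuous_ang.comp continuous_snd)))
    exact (hc.continuousOn.integrableOn_compact (isCompact_Icc.prod isCompact_Icc)).mono_set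
      (prod_mono Ioo_subset_Icc_self Ioo_subset_Icc_self)
  have step3 : ∫ z in {z | nsq z < R ^ 2}, u z =
      ∫ θ in Ioo (-Real.pi) Real.pi, ∫ ρ in Ioo 0 R, ρ * u (ρ • ang θ) := by
    have hms : MeasurableSet {z | nsq z < R ^ 2} :=
      (isOpen_lt continuous_nsq continuous_const).measurableSet
    rw [← integral_indicator hms, ← integral_comp_polarCoord_symm]
    have : ∫ p in polarCoord.target, p.1 • indicator {z | nsq z < R ^ 2} u (polarCoord.symm p) =
        ∫ p in Ioo 0 R ×ˢ Ioo (-Real.pi) Real.pi, p.1 * u (p.1 • ang p.2) := by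
      rw [setIntegral_eq_of_subset_of_forall_sdiff_eq_zero (s := Ioo 0 R ×ˢ Ioo (-Real.pi) Real.pi)
        measurableSet_polarTarget (fun p hp => ⟨hp.1.1, hp.2⟩) fun p hp => ?_]
      · refine setIntegral_congr_fun (measurableSet_Ioo.prod measurableSet_Ioo) fun p hp => ?_
        have : p.1 • ang p.2 ∈ {z | nsq z < R ^ 2} := by
          rw [mem_ofPred_eq, nsq_smul_ang]
          exact pow_lt_pow_left₀ hp.1.2 hp.1.1.le two_ne_zero
        simp only [polarCoord_symm_eq, indicator_of_mem this, smul_eq_mul]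
      · have hp1 : 0 < p.1 := hp.1.1
        have hpR : R ≤ p.1 := by
          by_contra! h; exact hp.2 ⟨⟨hp1, h⟩, hp.1.2⟩
        have : p.1 • ang p.2 ∉ {z | nsq z < R ^ 2} := by
          rw [mem_ofPred_eq, nsq_smul_ang, not_lt]
          exact pow_le_pow_left₀ hR.le hpR 2
        simp only [polarCoord_symm_eq, indicator_of_notMem this, smul_zero]
    rw [this]
    rw [IntegrableOn, Measure.volume_eq_prod, ← Measure.prod_restrict] at hQint
    rw [Measure.volume_eq_prod, ← Measure.prod_restrict, integral_prod_symm _ hQint]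
  rw [step1, step2, step3, integral_add, integral_const_mul]
  · congr 1
    simp [Real.pi_pos.le]
    left; ring
  · exact integrableOn_const (by simp)
  · rw [IntegrableOn, Measure.volume_eq_prod, ← Measure.prod_restrict] at hQint
    exact hQint.integral_prod_right.const_mul _

/-- The integral representation for the constant function 1, whose gradient vanishes. -/
lemma volume_disc (hR : 0 < R) : volume.real {z | nsq z < R ^ 2} = Real.pi * R ^ 2 := by
  have h := integral_cut_div_mul_fderiv hR (u := fun _ => 1) (C := 0)
    (LipschitzWith.const 1)
  simp at h
  field_simp at h
  linarith

end Polar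

/-! ### Even periodic extension -/

/-- The piecewise linear map of period `4L`, equal to the identity on `[-L, L]` and even about
`± L`. -/
noncomputable def fold (L x : ℝ) : ℝ := ‖((x + L : ℝ) : AddCircle (4 * L))‖ - L

section Fold

variable {L : ℝ}

lemma fold_of_mem {x : ℝ} (hx : x ∈ Icc (-L) L) : fold L x = x := by
  have hL : 0 ≤ L := by linarith [hx.1, hx.2]
  rcases hL.eq_or_lt with rfl | hL
  · have : x = 0 := le_antisymm hx.2 (by linarith [hx.1])
    subst this; simp [fold]
  have h0 : 0 ≤ x + L := by linarith [hx.1]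
  rw [fold, (AddCircle.norm_coe_eq_abs_iff (4 * L) (by positivity)).2, abs_of_nonneg h0]
  · ring
  · rw [abs_of_nonneg h0, abs_of_pos (by positivity)]
    linarith [hx.2]

lemma fold_mem (hL : 0 < L) (x : ℝ) : fold L x ∈ Icc (-L) L := by
  have h1 := AddCircle.norm_le_half_period (4 * L) (x := ((x + L : ℝ) : AddCircle (4 * L)))
    (by positivity)
  rw [abs_of_pos (by positivity)] at h1
  have h2 := norm_nonneg ((x + L : ℝ) : AddCircle (4 * L))
  exact ⟨by unfold fold; linarith, by unfold fold; linarith⟩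

lemma fold_add (L x : ℝ) : fold L (x + 4 * L) = fold L x := by
  have : x + 4 * L + L = (x + L) + 4 * L := by ring
  rw [fold, this, AddCircle.coe_add_period, fold]

lemma fold_reflect (L x : ℝ) : fold L (-(2 * L) - x) = fold L x := by
  have : -(2 * L) - x + L = -(x + L) := by ring
  rw [fold, this, AddCircle.coe_neg, norm_neg, fold]

lemma abs_fold_sub_le (L x y : ℝ) : |fold L x - fold L y| ≤ |x - y| := by
  have h : fold L x - fold L y =
      ‖((x + L : ℝ) : AddCircle (4 * L))‖ - ‖((y + L : ℝ) : AddCircle (4 * L))‖ := by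
    unfold fold; ring
  rw [h]
  refine (abs_norm_sub_norm_le _ _).trans ?_
  rw [← AddCircle.coe_sub, add_sub_add_right_eq_sub]
  exact QuotientAddGroup.norm_mk_le_norm

end Fold

/-! ### Symmetries of the extended functions. -/

/-- Periodicity `4L₁`, `4L₂` and evenness about `-L₁`, `-L₂`. -/
structure IsFolded (L₁ L₂ : ℝ) (f : ℝ × ℝ → ℝ) : Prop where
  per1 : ∀ x : ℝ × ℝ, f (x.1 + 4 * L₁, x.2) = f x
  per2 : ∀ x : ℝ × ℝ, f (x.1, x.2 + 4 * L₂) = f x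
  ev1 : ∀ x : ℝ × ℝ, f (-(2 * L₁) - x.1, x.2) = f x
  ev2 : ∀ x : ℝ × ℝ, f (x.1, -(2 * L₂) - x.2) = f x

/-- Evenness in each of the two variables. -/
structure IsBiEven (k : ℝ × ℝ → ℝ) : Prop where
  ev1 : ∀ z : ℝ × ℝ, k (-z.1, z.2) = k z
  ev2 : ∀ z : ℝ × ℝ, k (z.1, -z.2) = k z

lemma integral_neg_fst (f : ℝ × ℝ → ℝ) : ∫ z : ℝ × ℝ, f (-z.1, z.2) = ∫ z, f z := by
  have h : MeasurePreserving (Prod.map Neg.neg id : ℝ × ℝ → ℝ × ℝ) :=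
    (Measure.measurePreserving_neg (volume : Measure ℝ)).prod (MeasurePreserving.id _)
  exact h.integral_comp
    ((MeasurableEquiv.neg ℝ).prodCongr (MeasurableEquiv.refl ℝ)).measurableEmbedding f

lemma integral_neg_snd (f : ℝ × ℝ → ℝ) : ∫ z : ℝ × ℝ, f (z.1, -z.2) = ∫ z, f z := by
  have h : MeasurePreserving (Prod.map id Neg.neg : ℝ × ℝ → ℝ × ℝ) :=
    (MeasurePreserving.id _).prod (Measure.measurePreserving_neg (volume : Measure ℝ))
  exact h.integral_comp
    ((MeasurableEquiv.refl ℝ).prodCongr (MeasurableEquiv.neg ℝ)).measurableEmbedding f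

/-- Periods pass directly to w(x - z). A reflection of x is absorbed by reflecting the same
coordinate of z, which an even kernel does not notice. -/
lemma IsFolded.conv {L₁ L₂ : ℝ} {w k : ℝ × ℝ → ℝ} (hw : IsFolded L₁ L₂ w) (hk : IsBiEven k) :
    IsFolded L₁ L₂ (fun x => ∫ z, k z * w (x - z)) where
  per1 x := by
    congr 1; ext z; congr 1
    rw [← hw.per1 (x - z)]; congr 1; ext <;> simp; ring
  per2 x := by
    congr 1; ext z; congr 1
    rw [← hw.per2 (x - z)]; congr 1; ext <;> simp; ring
  ev1 x := by
    rw [← integral_neg_fst]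
    congr 1; ext z
    rw [hk.ev1, ← hw.ev1 (x - z)]; congr 2; ext <;> simp; ring
  ev2 x := by
    rw [← integral_neg_snd]
    congr 1; ext z
    rw [hk.ev2, ← hw.ev2 (x - z)]; congr 2; ext <;> simp; ring

lemma isFolded_comp_fold (L₁ L₂ : ℝ) (F : ℝ × ℝ → ℝ) :
    IsFolded L₁ L₂ (fun x => F (fold L₁ x.1, fold L₂ x.2)) where
  per1 x := by simp only [fold_add]
  per2 x := by simp only [fold_add]
  ev1 x := by simp only [fold_reflect]
  ev2 x := by simp only [fold_reflect]

lemma IsFolded.add {L₁ L₂ : ℝ} {f g : ℝ × ℝ → ℝ} (hf : IsFolded L₁ L₂ f) (hg : IsFolded L₁ L₂ g) :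
    IsFolded L₁ L₂ (fun x => f x + g x) where
  per1 x := by simp only [hf.per1, hg.per1]
  per2 x := by simp only [hf.per2, hg.per2]
  ev1 x := by simp only [hf.ev1, hg.ev1]
  ev2 x := by simp only [hf.ev2, hg.ev2]

/-- The normal derivative of a folded function vanishes on the lines `x₁ = ± L₁`. -/
lemma IsFolded.fderiv_fst {L₁ L₂ : ℝ} {f : ℝ × ℝ → ℝ} (hf : IsFolded L₁ L₂ f)
    (hd : Differentiable ℝ f) {x : ℝ × ℝ} (hx : |x.1| = L₁) : fderiv ℝ f x (1, 0) = 0 := by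
  -- Evenness about -L₁ is assumed; evenness about L₁ follows from it and the period 4L₁, since
  -- (-2L₁ - (L₁ + t)) + 4L₁ = L₁ - t.
  have hs : ∀ t : ℝ, f (x + t • ((1, 0) : ℝ × ℝ)) = f (x - t • ((1, 0) : ℝ × ℝ)) := fun t => by
    rcases abs_eq (by rw [← hx]; positivity : 0 ≤ L₁) |>.1 hx with h | h
    · rw [← hf.ev1, ← hf.per1]; congr 1; ext <;> simp [h]; ring
    · rw [← hf.ev1]; congr 1; ext <;> simp [h]; ring
  have h1 : HasDerivAt (fun t : ℝ => f (x + t • ((1, 0) : ℝ × ℝ))) (fderiv ℝ f x (1, 0)) 0 :=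
    (hd x).hasFDerivAt.hasLineDerivAt _
  have h2 : HasDerivAt (fun t : ℝ => f (x - t • ((1, 0) : ℝ × ℝ))) (fderiv ℝ f x (-(1, 0))) 0 := by
    have := (hd x).hasFDerivAt.hasLineDerivAt (-(1, 0))
    simpa only [HasLineDerivAt, smul_neg, ← sub_eq_add_neg] using this
  rw [map_neg] at h2
  rw [← funext hs] at h2
  have := h1.unique h2
  linarith

lemma IsFolded.fderiv_snd {L₁ L₂ : ℝ} {f : ℝ × ℝ → ℝ} (hf : IsFolded L₁ L₂ f)
    (hd : Differentiable ℝ f) {x : ℝ × ℝ} (hx : |x.2| = L₂) : fderiv ℝ f x (0, 1) = 0 := by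
  have hs : ∀ t : ℝ, f (x + t • ((0, 1) : ℝ × ℝ)) = f (x - t • ((0, 1) : ℝ × ℝ)) := fun t => by
    rcases abs_eq (by rw [← hx]; positivity : 0 ≤ L₂) |>.1 hx with h | h
    · rw [← hf.ev2, ← hf.per2]; congr 1; ext <;> simp [h]; ring
    · rw [← hf.ev2]; congr 1; ext <;> simp [h]; ring
  have h1 : HasDerivAt (fun t : ℝ => f (x + t • ((0, 1) : ℝ × ℝ))) (fderiv ℝ f x (0, 1)) 0 :=
    (hd x).hasFDerivAt.hasLineDerivAt _
  have h2 : HasDerivAt (fun t : ℝ => f (x - t • ((0, 1) : ℝ × ℝ))) (fderiv ℝ f x (-(0, 1))) 0 := by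
    have := (hd x).hasFDerivAt.hasLineDerivAt (-(0, 1))
    simpa only [HasLineDerivAt, smul_neg, ← sub_eq_add_neg] using this
  rw [map_neg] at h2
  rw [← funext hs] at h2
  have := h1.unique h2
  linarith

lemma integral_period {g : ℝ → ℝ} {L : ℝ} (hg : ∀ t, g (t + 4 * L) = g t) (a : ℝ) :
    ∫ t in (-(2 * L))..(2 * L), g (a - t) = ∫ t in (-(2 * L))..(2 * L), g t := by
  rw [intervalIntegral.integral_comp_sub_left]
  have h := Function.Periodic.intervalIntegral_add_eq (f := g) (T := 4 * L) hg (a - 2 * L)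
    (-(2 * L))
  convert h using 2 <;> ring

/-- The integral of a folded function over a translated period cell is constant. -/
lemma IsFolded.setIntegral_sub {L₁ L₂ : ℝ} (h1 : 0 < L₁) (h2 : 0 < L₂) {w : ℝ × ℝ → ℝ}
    (hw : IsFolded L₁ L₂ w) (hc : Continuous w) (x : ℝ × ℝ) :
    ∫ z in Icc (-(2 * L₁)) (2 * L₁) ×ˢ Icc (-(2 * L₂)) (2 * L₂), w (x - z) =
      ∫ z in Icc (-(2 * L₁)) (2 * L₁) ×ˢ Icc (-(2 * L₂)) (2 * L₂), w z := by
  have conv : ∀ v : ℝ × ℝ → ℝ, Continuous v →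
      ∫ z in Icc (-(2 * L₁)) (2 * L₁) ×ˢ Icc (-(2 * L₂)) (2 * L₂), v z =
      ∫ s in (-(2 * L₁))..(2 * L₁), ∫ t in (-(2 * L₂))..(2 * L₂), v (s, t) := fun v hv => by
    rw [Measure.volume_eq_prod, setIntegral_prod _
      (hv.continuousOn.integrableOn_compact (isCompact_Icc.prod isCompact_Icc)),
      intervalIntegral.integral_of_le (by linarith), integral_Icc_eq_integral_Ioc]
    congr 1; ext s
    rw [intervalIntegral.integral_of_le (by linarith), integral_Icc_eq_integral_Ioc]
  rw [conv _ (by fun_prop), conv _ hc]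
  have e1 : ∀ s, ∫ t in (-(2 * L₂))..(2 * L₂), w (x - (s, t)) =
      ∫ t in (-(2 * L₂))..(2 * L₂), w (x.1 - s, t) := fun s =>
    integral_period (g := fun t => w (x.1 - s, t)) (fun t => hw.per2 (x.1 - s, t)) x.2
  simp only [e1]
  exact integral_period (g := fun s => ∫ t in (-(2 * L₂))..(2 * L₂), w (s, t))
    (fun s => by simp only [hw.per1 (s, _)]) x.1

/-! ### Solution of `w = F + k * w` for a kernel of mass less than one -/

lemma abs_integral_mul_comp_sub_le {k : ℝ × ℝ → ℝ} (hk : Integrable k) (hk0 : ∀ z, 0 ≤ k z)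
    {f : ℝ × ℝ → ℝ} {B : ℝ} (hB : ∀ z, |f z| ≤ B) (x : ℝ × ℝ) :
    |∫ z, k z * f (x - z)| ≤ (∫ z, k z) * B := by
  rw [← integral_mul_const]
  refine norm_integral_le_of_norm_le (f := fun z => k z * f (x - z)) (hk.mul_const B)
    (Eventually.of_forall fun z => ?_)
  rw [Real.norm_eq_abs, abs_mul, abs_of_nonneg (hk0 z)]
  exact mul_le_mul_of_nonneg_left (hB _) (hk0 z)

/-- The map g ↦ f + k * g contracts the sup norm with ratio θ = ∫ k < 1. It is iterated inside a
closed invariant set of folded functions with a fixed Lipschitz constant, so that the fixed point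
inherits both properties. -/
lemma exists_fixed_conv {L₁ L₂ : ℝ} {k : ℝ × ℝ → ℝ} (hk : Integrable k) (hk0 : ∀ z, 0 ≤ k z)
    (hk1 : ∫ z, k z < 1) (hke : IsBiEven k) {f : ℝ × ℝ → ℝ} {C : ℝ≥0} (hf : LipschitzWith C f)
    {B : ℝ} (hB : ∀ z, |f z| ≤ B) (hfs : IsFolded L₁ L₂ f) :
    ∃ (w : ℝ × ℝ → ℝ) (K : ℝ≥0) (B' : ℝ), LipschitzWith K w ∧ (∀ z, |w z| ≤ B') ∧
      IsFolded L₁ L₂ w ∧ ∀ x, w x = f x + ∫ z, k z * w (x - z) := by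
  let θ : ℝ≥0 := ⟨∫ z, k z, integral_nonneg hk0⟩
  have hθc : (θ : ℝ) = ∫ z, k z := rfl
  have hθ1 : θ < 1 := by rw [← NNReal.coe_lt_coe]; exact hk1
  have hint : ∀ (g : BoundedContinuousFunction (ℝ × ℝ) ℝ) (x : ℝ × ℝ),
      Integrable fun z => k z * g (x - z) := fun g x =>
    integrable_mul_comp_sub hk g.continuous.aestronglyMeasurable (fun z => g.norm_coe_le_norm z) x
  have hcont : ∀ g : BoundedContinuousFunction (ℝ × ℝ) ℝ,
      Continuous fun x => ∫ z, k z * g (x - z) := fun g => by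
    refine continuous_of_dominated (bound := fun z => |k z| * ‖g‖)
      (fun x => (hint g x).aestronglyMeasurable)
      (fun x => Eventually.of_forall fun z => ?_) (hk.abs.mul_const _)
      (Eventually.of_forall fun z => ?_)
    · rw [norm_mul, Real.norm_eq_abs]
      exact mul_le_mul_of_nonneg_left (g.norm_coe_le_norm _) (abs_nonneg _)
    · exact continuous_const.mul (g.continuous.comp (by fun_prop))
  let T : BoundedContinuousFunction (ℝ × ℝ) ℝ → BoundedContinuousFunction (ℝ × ℝ) ℝ := fun g =>
    BoundedContinuousFunction.ofNormedAddCommGroup (fun x => f x + ∫ z, k z * g (x - z))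
      (hf.continuous.add (hcont g)) (B + (∫ z, k z) * ‖g‖) fun x =>
        (norm_add_le _ _).trans (add_le_add (hB x)
          (abs_integral_mul_comp_sub_le hk hk0 (fun z => g.norm_coe_le_norm z) x))
  have hT : ∀ g x, T g x = f x + ∫ z, k z * g (x - z) := fun g x => rfl
  have hTc : ∀ g h : BoundedContinuousFunction (ℝ × ℝ) ℝ, dist (T g) (T h) ≤ θ * dist g h := by
    intro g h
    rw [BoundedContinuousFunction.dist_le (by positivity)]
    intro x
    rw [hT, hT, dist_add_left, Real.dist_eq, ← integral_sub (hint g x) (hint h x)]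
    have := abs_integral_mul_comp_sub_le hk hk0 (f := fun z => g z - h z) (B := dist g h)
      (fun z => by rw [← Real.dist_eq]; exact BoundedContinuousFunction.dist_coe_le_dist z) x
    rw [hθc]
    simpa only [mul_sub] using this
  -- The Lipschitz constant left invariant by the map: C + θK = K.
  set K : ℝ≥0 := C / (1 - θ) with hK
  have hK1 : C + θ * K = K := by
    have : (1 - θ : ℝ≥0) ≠ 0 := (tsub_pos_of_lt hθ1).ne'
    have h2 : (1 - θ) * K = C := by rw [hK, mul_div_cancel₀ _ this]
    have h3 : (1 - θ) + θ = 1 := tsub_add_cancel_of_le hθ1.le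
    calc C + θ * K = ((1 - θ) + θ) * K := by rw [add_mul, h2]
      _ = K := by rw [h3, one_mul]
  let s : Set (BoundedContinuousFunction (ℝ × ℝ) ℝ) :=
    {g | LipschitzWith K g ∧ IsFolded L₁ L₂ g}
  have hev : ∀ x : ℝ × ℝ, Continuous fun g : BoundedContinuousFunction (ℝ × ℝ) ℝ => g x :=
    fun x => continuous_eval_const x
  have hs : IsClosed s := by
    have : s = {g | ∀ x y, dist (g x) (g y) ≤ K * dist x y} ∩
        ({g | ∀ x : ℝ × ℝ, g (x.1 + 4 * L₁, x.2) = g x} ∩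
        ({g | ∀ x : ℝ × ℝ, g (x.1, x.2 + 4 * L₂) = g x} ∩
        ({g | ∀ x : ℝ × ℝ, g (-(2 * L₁) - x.1, x.2) = g x} ∩
        {g | ∀ x : ℝ × ℝ, g (x.1, -(2 * L₂) - x.2) = g x}))) := by
      ext g
      exact ⟨fun h => ⟨fun x y => h.1.dist_le_mul x y, h.2.per1, h.2.per2, h.2.ev1, h.2.ev2⟩,
        fun h => ⟨LipschitzWith.of_dist_le_mul h.1, h.2.1, h.2.2.1, h.2.2.2.1, h.2.2.2.2⟩⟩
    rw [this]
    refine IsClosed.inter ?_ (IsClosed.inter ?_ (IsClosed.inter ?_ (IsClosed.inter ?_ ?_)))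
    · simp only [ofPred_forall]
      exact isClosed_iInter fun x => isClosed_iInter fun y =>
        isClosed_le ((hev x).dist (hev y)) continuous_const
    all_goals
      simp only [ofPred_forall]
      exact isClosed_iInter fun x => isClosed_eq (hev _) (hev _)
  have hmaps : MapsTo T s s := by
    intro g hg
    refine ⟨?_, ?_⟩
    · rw [← hK1]
      refine hf.add (LipschitzWith.of_dist_le_mul fun x y => ?_)
      rw [Real.dist_eq, ← integral_sub (hint g x) (hint g y), NNReal.coe_mul, mul_assoc]
      have := abs_integral_mul_comp_sub_le hk hk0 (f := fun z => g (x + z) - g (y + z))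
        (B := K * dist x y) (fun z => by
          rw [← Real.dist_eq]
          simpa using hg.1.dist_le_mul (x + z) (y + z)) 0
      rw [hθc]
      simpa only [mul_sub, zero_sub, ← sub_eq_add_neg] using this
    · exact hfs.add (hg.2.conv hke)
  obtain ⟨w, hw, hfix, -⟩ := ContractingWith.exists_fixedPoint' (K := θ) hs.isComplete hmaps
    ⟨hθ1, LipschitzWith.of_dist_le_mul fun a b => hTc a b⟩ (x := 0)
    ⟨by
      have := LipschitzWith.const' (α := ℝ × ℝ) (0 : ℝ) (K := K)
      exact this, ⟨fun _ => rfl, fun _ => rfl, fun _ => rfl, fun _ => rfl⟩⟩ (edist_ne_top _ _)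
  exact ⟨w, K, ‖w‖, hw.1, fun z => w.norm_coe_le_norm z, hw.2, fun x => by
    conv_lhs => rw [← hfix]
    rfl⟩

/-! ### The Neumann problem on a rectangle with Lipschitz right-hand side -/

lemma abs_dotL_fst_le (z : ℝ × ℝ) : |dotL (1, 0) z| ≤ ‖z‖ := by
  simpa using abs_fst_le_norm z

lemma abs_dotL_snd_le (z : ℝ × ℝ) : |dotL (0, 1) z| ≤ ‖z‖ := by
  simpa using abs_snd_le_norm z

lemma isBiEven_of_nsq {k : ℝ × ℝ → ℝ} (g : ℝ → ℝ) (h : ∀ z, k z = g (nsq z)) : IsBiEven k where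
  ev1 z := by simp [h, nsq]
  ev2 z := by simp [h, nsq]

/-- Regularity of a function whose gradient has Hölder continuously differentiable components. -/
lemma contDiff_two_of_gradient {E : Type*} [NormedAddCommGroup E] [NormedSpace ℝ E]
    {M N₁ N₂ : E → ℝ} {N₁' N₂' : E → E →L[ℝ] ℝ} {φ₁ φ₂ : E →L[ℝ] ℝ} (hφ₁ : ‖φ₁‖ ≤ 1)
    (hφ₂ : ‖φ₂‖ ≤ 1) (hM : ∀ x, HasFDerivAt M (N₁ x • φ₁ + N₂ x • φ₂) x)
    (hN₁ : ∀ x, HasFDerivAt N₁ (N₁' x) x) (hN₂ : ∀ x, HasFDerivAt N₂ (N₂' x) x) {C α : ℝ}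
    (hα : 0 < α) (h₁ : ∀ x y, ‖N₁' x - N₁' y‖ ≤ C * ‖x - y‖ ^ α)
    (h₂ : ∀ x y, ‖N₂' x - N₂' y‖ ≤ C * ‖x - y‖ ^ α) :
    ContDiff ℝ 2 M ∧
      (∀ x y, ‖fderiv ℝ (fderiv ℝ M) x - fderiv ℝ (fderiv ℝ M) y‖ ≤ (C + C) * ‖x - y‖ ^ α) ∧
      ∀ x v w, fderiv ℝ (fderiv ℝ M) x v w = N₁' x v * φ₁ w + N₂' x v * φ₂ w := by
  have hM1 : fderiv ℝ M = fun x => N₁ x • φ₁ + N₂ x • φ₂ := funext fun x => (hM x).fderiv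
  have hM2d : ∀ x, HasFDerivAt (fderiv ℝ M) ((N₁' x).smulRight φ₁ + (N₂' x).smulRight φ₂) x := by
    intro x
    rw [hM1]
    exact ((hN₁ x).smul_const φ₁).add ((hN₂ x).smul_const φ₂)
  have hM2 : fderiv ℝ (fderiv ℝ M) = fun x => (N₁' x).smulRight φ₁ + (N₂' x).smulRight φ₂ :=
    funext fun x => (hM2d x).fderiv
  have hHold : ∀ x y,
      ‖fderiv ℝ (fderiv ℝ M) x - fderiv ℝ (fderiv ℝ M) y‖ ≤ (C + C) * ‖x - y‖ ^ α := by
    intro x y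
    have e : fderiv ℝ (fderiv ℝ M) x - fderiv ℝ (fderiv ℝ M) y =
        (N₁' x - N₁' y).smulRight φ₁ + (N₂' x - N₂' y).smulRight φ₂ := by
      rw [hM2]
      ext v w; simp; ring
    have n₁ : ‖(N₁' x - N₁' y).smulRight φ₁‖ ≤ C * ‖x - y‖ ^ α := by
      rw [ContinuousLinearMap.norm_smulRight_apply]
      exact (mul_le_of_le_one_right (norm_nonneg _) hφ₁).trans (h₁ x y)
    have n₂ : ‖(N₂' x - N₂' y).smulRight φ₂‖ ≤ C * ‖x - y‖ ^ α := by
      rw [ContinuousLinearMap.norm_smulRight_apply]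
      exact (mul_le_of_le_one_right (norm_nonneg _) hφ₂).trans (h₂ x y)
    rw [e, add_mul]
    exact (ContinuousLinearMap.opNorm_add_le _ _).trans (add_le_add n₁ n₂)
  refine ⟨?_, hHold, fun x v w => by rw [hM2]; simp⟩
  have : (2 : WithTop ℕ∞) = 1 + 1 := by norm_num
  rw [this, contDiff_succ_iff_fderiv]
  refine ⟨fun x => (hM x).differentiableAt, by simp, ?_⟩
  rw [contDiff_one_iff_fderiv]
  refine ⟨fun x => (hM2d x).differentiableAt, ?_⟩
  rw [continuous_iff_continuousAt]
  intro x
  rw [ContinuousAt, tendsto_iff_norm_sub_tendsto_zero]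
  refine squeeze_zero (fun _ => norm_nonneg _) (fun y => hHold y x) ?_
  have : Continuous fun y : E => (C + C) * ‖y - x‖ ^ α :=
    continuous_const.mul (Continuous.rpow_const (by fun_prop) fun _ => Or.inr hα.le)
  simpa [Real.zero_rpow hα.ne'] using this.tendsto x

/-- The variant with the normalizing factor of the fundamental solution kept outside the
convolutions. -/
lemma contDiff_two_of_mul_gradient {E : Type*} [NormedAddCommGroup E] [NormedSpace ℝ E]
    {M N₁ N₂ : E → ℝ} {N₁' N₂' : E → E →L[ℝ] ℝ} {φ₁ φ₂ : E →L[ℝ] ℝ} (hφ₁ : ‖φ₁‖ ≤ 1)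
    (hφ₂ : ‖φ₂‖ ≤ 1) (a : ℝ) (hM : ∀ x, HasFDerivAt M ((a * N₁ x) • φ₁ + (a * N₂ x) • φ₂) x)
    (hN₁ : ∀ x, HasFDerivAt N₁ (N₁' x) x) (hN₂ : ∀ x, HasFDerivAt N₂ (N₂' x) x) {C α : ℝ}
    (hα : 0 < α) (h₁ : ∀ x y, ‖N₁' x - N₁' y‖ ≤ C * ‖x - y‖ ^ α)
    (h₂ : ∀ x y, ‖N₂' x - N₂' y‖ ≤ C * ‖x - y‖ ^ α) :
    ContDiff ℝ 2 M ∧ (∃ C, ∀ x y,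
      ‖fderiv ℝ (fderiv ℝ M) x - fderiv ℝ (fderiv ℝ M) y‖ ≤ C * ‖x - y‖ ^ α) ∧
      ∀ x v w, fderiv ℝ (fderiv ℝ M) x v w = a * (N₁' x v * φ₁ w + N₂' x v * φ₂ w) := by
  have hsc : ∀ N' : E → E →L[ℝ] ℝ, (∀ x y, ‖N' x - N' y‖ ≤ C * ‖x - y‖ ^ α) → ∀ x y,
      ‖a • N' x - a • N' y‖ ≤ |a| * C * ‖x - y‖ ^ α := fun N' h x y => by
    have e : a • N' x - a • N' y = a • (N' x - N' y) := by ext v; simp [mul_sub]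
    rw [e, norm_smul, Real.norm_eq_abs, mul_assoc]
    exact mul_le_mul_of_nonneg_left (h x y) (abs_nonneg a)
  obtain ⟨r1, r2, r3⟩ := contDiff_two_of_gradient hφ₁ hφ₂ hM (fun x => (hN₁ x).const_mul a)
    (fun x => (hN₂ x).const_mul a) hα (hsc _ h₁) (hsc _ h₂)
  refine ⟨r1, ⟨_, r2⟩, fun x v w => ?_⟩
  rw [r3]
  simp only [smul_apply, smul_eq_mul]
  ring

/-- The logarithmic potential of a bounded Lipschitz function is of class `C^{2,α}`, and its
Laplacian is the function minus its mean over discs of radius `R`. -/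
lemma exists_potential {R : ℝ} (hR : 0 < R) {L₁ L₂ : ℝ} {w : ℝ × ℝ → ℝ} {K : ℝ≥0} {B : ℝ}
    (hw : LipschitzWith K w) (hB : ∀ z, |w z| ≤ B) (hs : IsFolded L₁ L₂ w)
    {α : ℝ} (hα0 : 0 < α) (hα1 : α < 1) :
    ∃ M : ℝ × ℝ → ℝ, ContDiff ℝ 2 M ∧ IsFolded L₁ L₂ M ∧
      (∃ C, ∀ x y, ‖fderiv ℝ (fderiv ℝ M) x - fderiv ℝ (fderiv ℝ M) y‖ ≤ C * ‖x - y‖ ^ α) ∧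
      ∀ x, fderiv ℝ (fderiv ℝ M) x (1, 0) (1, 0) + fderiv ℝ (fderiv ℝ M) x (0, 1) (0, 1) =
        w x - 1 / (Real.pi * R ^ 2) * ∫ z in {z | nsq z < R ^ 2}, w (x - z) := by
  set a : ℝ := (2 * Real.pi)⁻¹ with ha
  set c₁ := dotL (1, 0) with hc₁
  set c₂ := dotL (0, 1) with hc₂
  set N : (ℝ × ℝ →L[ℝ] ℝ) → ℝ × ℝ → ℝ := fun c x => ∫ z, ker R c z * w (x - z) with hN
  set N' : (ℝ × ℝ →L[ℝ] ℝ) → ℝ × ℝ → (ℝ × ℝ →L[ℝ] ℝ) :=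
    fun c x => ∫ z, ker R c z • fderiv ℝ w (x - z) with hN'
  have hNd : ∀ c : ℝ × ℝ →L[ℝ] ℝ, (∀ z, |c z| ≤ ‖z‖) → ∀ x, HasFDerivAt (N c) (N' c x) x :=
    fun c hc x => hasFDerivAt_integral_comp_sub (integrable_ker hR hc) hw hB x
  have hgm : AEStronglyMeasurable (fderiv ℝ w) volume :=
    (measurable_fderiv ℝ w).aestronglyMeasurable
  have hgb : ∀ z, ‖fderiv ℝ w z‖ ≤ K := fun z => norm_fderiv_le_of_lipschitz ℝ hw
  have hgi : ∀ c : ℝ × ℝ →L[ℝ] ℝ, (∀ z, |c z| ≤ ‖z‖) → ∀ x,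
      Integrable fun z => ker R c z • fderiv ℝ w (x - z) := fun c hc x =>
    integrable_mul_comp_sub (integrable_ker hR hc) hgm hgb x
  set CH : ℝ := 28 * K * ∫ z, dom R (1 + α) z with hCH
  have hNH : ∀ c : ℝ × ℝ →L[ℝ] ℝ, (∀ z, |c z| ≤ ‖z‖) → ∀ x y,
      ‖N' c x - N' c y‖ ≤ CH * ‖x - y‖ ^ α := fun c hc x y =>
    norm_integral_ker_sub_le hR hc hα0 hα1 hgm hgb x y
  set U : ℝ × ℝ → ℝ := fun x => ∫ z, pot R 0 z * w (x - z) with hU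
  have hpi := integrable_pot hR
  -- The first derivative is put on w and moved back to the potential, so the gradient is again a
  -- convolution with w. The second derivative then falls on w once more, against an integrable
  -- kernel.
  have hUd : ∀ x, HasFDerivAt U (-(N c₁ x • ContinuousLinearMap.fst ℝ ℝ ℝ +
      N c₂ x • ContinuousLinearMap.snd ℝ ℝ ℝ)) x := by
    intro x
    have h := hasFDerivAt_integral_comp_sub hpi hw hB x
    refine h.congr_fderiv ?_
    have hi := integrable_mul_comp_sub hpi hgm hgb x
    have e : ∀ v, (∫ z, pot R 0 z • fderiv ℝ w (x - z)) v =
        ∫ z, pot R 0 z * fderiv ℝ w (x - z) v := fun v => by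
      rw [ContinuousLinearMap.integral_apply hi]; rfl
    ext
    · have := integral_pot_mul_fderiv hR abs_dotL_fst_le hw hB x
      simp only [ContinuousLinearMap.comp_apply, ContinuousLinearMap.inl_apply, e]
      simp [this, hN, hc₁]
    · have := integral_pot_mul_fderiv hR abs_dotL_snd_le hw hB x
      simp only [ContinuousLinearMap.comp_apply, ContinuousLinearMap.inr_apply, e]
      simp [this, hN, hc₂]
  set M : ℝ × ℝ → ℝ := fun x => -a * U x with hM
  have hMd : ∀ x, HasFDerivAt M ((a * N c₁ x) • ContinuousLinearMap.fst ℝ ℝ ℝ +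
      (a * N c₂ x) • ContinuousLinearMap.snd ℝ ℝ ℝ) x := fun x =>
    ((hUd x).const_mul (-a)).congr_fderiv (by
      rw [smul_neg, neg_smul, neg_neg, smul_add, smul_smul, smul_smul])
  obtain ⟨hC2, hHold, hM2⟩ := contDiff_two_of_mul_gradient
    (ContinuousLinearMap.norm_fst_le ℝ ℝ ℝ) (ContinuousLinearMap.norm_snd_le ℝ ℝ ℝ) a hMd
    (hNd c₁ abs_dotL_fst_le) (hNd c₂ abs_dotL_snd_le) hα0 (hNH c₁ abs_dotL_fst_le)
    (hNH c₂ abs_dotL_snd_le)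
  refine ⟨M, hC2, ?_, hHold, ?_⟩
  · have hUs : IsFolded L₁ L₂ U := hs.conv (isBiEven_of_nsq (potS R 0) fun z => rfl)
    exact ⟨fun x => by simp only [hM, hUs.per1], fun x => by simp only [hM, hUs.per2],
      fun x => by simp only [hM, hUs.ev1], fun x => by simp only [hM, hUs.ev2]⟩
  · intro x
    have hu : LipschitzWith K (fun z => w (x - z)) := by
      refine LipschitzWith.of_dist_le_mul fun p q => ?_
      have := hw.dist_le_mul (x - p) (x - q)
      rwa [dist_sub_left] at this
    have h1 := integral_cut_div_mul_fderiv hR hu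
    have e1 : ∀ v, N' c₁ x v = ∫ z, ker R c₁ z * fderiv ℝ w (x - z) v := fun v => by
      simp only [hN']
      rw [ContinuousLinearMap.integral_apply (hgi c₁ abs_dotL_fst_le x)]; rfl
    have e2 : ∀ v, N' c₂ x v = ∫ z, ker R c₂ z * fderiv ℝ w (x - z) v := fun v => by
      simp only [hN']
      rw [ContinuousLinearMap.integral_apply (hgi c₂ abs_dotL_snd_le x)]; rfl
    have i1 : Integrable fun z => ker R c₁ z * fderiv ℝ w (x - z) (1, 0) :=
      (hgi c₁ abs_dotL_fst_le x).apply_continuousLinearMap (1, 0)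
    have i2 : Integrable fun z => ker R c₂ z * fderiv ℝ w (x - z) (0, 1) :=
      (hgi c₂ abs_dotL_snd_le x).apply_continuousLinearMap (0, 1)
    -- The sum of the two pure second derivatives is the kernel paired with the radial derivative of
    -- w(x - ·), to which the polar representation applies.
    have h2 : N' c₁ x (1, 0) + N' c₂ x (0, 1) =
        -∫ z, cut R (nsq z) / nsq z * fderiv ℝ (fun z => w (x - z)) z z := by
      rw [e1, e2, ← integral_add i1 i2, ← integral_neg]
      refine integral_congr_ae ?_
      filter_upwards [ae_differentiableAt_sub hw x] with z hz
      have hf : HasFDerivAt (fun z => w (x - z)) (-fderiv ℝ w (x - z)) z := by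
        have := hz.hasFDerivAt.comp z ((hasFDerivAt_id z).const_sub x)
        simpa [Function.comp_def] using this
      have hz2 : z = z.1 • ((1, 0) : ℝ × ℝ) + z.2 • ((0, 1) : ℝ × ℝ) := by ext <;> simp
      have hv : fderiv ℝ w (x - z) z =
          z.1 * fderiv ℝ w (x - z) (1, 0) + z.2 * fderiv ℝ w (x - z) (0, 1) := by
        conv_lhs => rw [hz2]
        rw [map_add, map_smul, map_smul]
        simp
      rw [hf.fderiv, neg_apply, hv, ker, ker, hc₁, hc₂, dotL_apply, dotL_apply]
      ring
    have hR' : R ≠ 0 := hR.ne'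
    have hp : Real.pi ≠ 0 := Real.pi_ne_zero
    calc fderiv ℝ (fderiv ℝ M) x (1, 0) (1, 0) + fderiv ℝ (fderiv ℝ M) x (0, 1) (0, 1)
        = a * (N' c₁ x (1, 0) + N' c₂ x (0, 1)) := by
          rw [hM2, hM2]
          simp only [ContinuousLinearMap.coe_fst', ContinuousLinearMap.coe_snd', mul_one, mul_zero,
            add_zero, zero_add, mul_add]
      _ = _ := by
        rw [h2, h1, ha, sub_zero]
        field_simp
        ring

/-- Solvability of the Neumann problem on a rectangle in `C^{2,α}`, for a Lipschitz right-hand side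
and up to an additive constant. -/
lemma exists_neumann {L₁ L₂ : ℝ} (h1 : 0 < L₁) (h2 : 0 < L₂) {F : ℝ × ℝ → ℝ} {C : ℝ≥0}
    (hF : LipschitzOnWith C F (Icc (-L₁) L₁ ×ˢ Icc (-L₂) L₂))
    {α : ℝ} (hα0 : 0 < α) (hα1 : α < 1) :
    ∃ (M : ℝ × ℝ → ℝ) (κ : ℝ), ContDiff ℝ 2 M ∧
      (∃ C, ∀ x y, ‖fderiv ℝ (fderiv ℝ M) x - fderiv ℝ (fderiv ℝ M) y‖ ≤ C * ‖x - y‖ ^ α) ∧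
      (∀ x ∈ Icc (-L₁) L₁ ×ˢ Icc (-L₂) L₂, fderiv ℝ (fderiv ℝ M) x (1, 0) (1, 0) +
        fderiv ℝ (fderiv ℝ M) x (0, 1) (0, 1) = F x - κ) ∧
      (∀ x : ℝ × ℝ, |x.1| = L₁ → fderiv ℝ M x (1, 0) = 0) ∧
      (∀ x : ℝ × ℝ, |x.2| = L₂ → fderiv ℝ M x (0, 1) = 0) := by
  -- Large enough for the disc `D` to contain the period cell `Q` of side lengths 4L₁ and 4L₂.
  set R : ℝ := 2 * L₁ + 2 * L₂ + 1 with hRdef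
  have hR : 0 < R := by positivity
  set Q : Set (ℝ × ℝ) := Icc (-(2 * L₁)) (2 * L₁) ×ˢ Icc (-(2 * L₂)) (2 * L₂) with hQ
  set D : Set (ℝ × ℝ) := {z | nsq z < R ^ 2} with hD
  have hQm : MeasurableSet Q := measurableSet_Icc.prod measurableSet_Icc
  have hDm : MeasurableSet D := (isOpen_lt continuous_nsq continuous_const).measurableSet
  have hQD : Q ⊆ D := by
    intro z hz
    have a1 : z.1 ^ 2 ≤ (2 * L₁) ^ 2 := sq_le_sq' hz.1.1 hz.1.2
    have a2 : z.2 ^ 2 ≤ (2 * L₂) ^ 2 := sq_le_sq' hz.2.1 hz.2.2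
    simp only [hD, mem_ofPred_eq, nsq, hRdef]
    nlinarith
  set F' : ℝ × ℝ → ℝ := fun x => F (fold L₁ x.1, fold L₂ x.2) with hF'
  have hmem : ∀ x : ℝ × ℝ, ((fold L₁ x.1, fold L₂ x.2) : ℝ × ℝ) ∈ Icc (-L₁) L₁ ×ˢ Icc (-L₂) L₂ :=
    fun x => ⟨fold_mem h1 _, fold_mem h2 _⟩
  have hF'L : LipschitzWith C F' := by
    refine LipschitzWith.of_dist_le_mul fun x y => ?_
    refine (hF.dist_le_mul _ (hmem x) _ (hmem y)).trans ?_
    refine mul_le_mul_of_nonneg_left ?_ C.2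
    rw [Prod.dist_eq, Prod.dist_eq]
    exact max_le_max (abs_fold_sub_le _ _ _) (abs_fold_sub_le _ _ _)
  obtain ⟨B, hB⟩ := (isCompact_Icc.prod isCompact_Icc).exists_bound_of_continuousOn hF.continuousOn
  have hvD : volume D ≠ ⊤ := by
    intro h
    have := volume_disc hR
    rw [← hD, Measure.real, h, ENNReal.toReal_top] at this
    have : 0 < Real.pi * R ^ 2 := by positivity
    linarith
  have hvQ : volume.real Q = 16 * L₁ * L₂ := by
    rw [Measure.real, hQ, Measure.volume_eq_prod, Measure.prod_prod, Real.volume_Icc,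
      Real.volume_Icc, ENNReal.toReal_mul, ENNReal.toReal_ofReal (by linarith),
      ENNReal.toReal_ofReal (by linarith)]
    ring
  set b : ℝ := 1 / (Real.pi * R ^ 2) with hb
  have hb0 : 0 < b := by positivity
  -- The averaging kernel of the disc with the period cell removed. Its mass is 1 - 16L₁L₂/(πR²) <
  -- 1, and it is even in each variable because `D` and `Q` are.
  set k : ℝ × ℝ → ℝ := indicator (D \ Q) (fun _ => b) with hk
  have hkm : MeasurableSet (D \ Q) := hDm.diff hQm
  have hki : Integrable k := (integrable_indicator_iff hkm).2
    (integrableOn_const ((measure_mono sdiff_subset).trans_lt (lt_top_iff_ne_top.2 hvD)).ne)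
  have hk1 : ∫ z, k z < 1 := by
    rw [hk, integral_indicator hkm, setIntegral_const, smul_eq_mul,
      measureReal_sdiff hQD hQm hvD, volume_disc hR, hvQ, sub_mul, hb]
    have : Real.pi * R ^ 2 * (1 / (Real.pi * R ^ 2)) = 1 := by field_simp
    rw [this]
    have : 0 < 16 * L₁ * L₂ * (1 / (Real.pi * R ^ 2)) := by positivity
    linarith
  have hke : IsBiEven k := by
    have m1 : ∀ z : ℝ × ℝ, ((-z.1, z.2) : ℝ × ℝ) ∈ D \ Q ↔ z ∈ D \ Q := fun z => by
      simp only [hD, hQ, Set.mem_sdiff, mem_ofPred_eq, nsq, neg_sq, mem_prod, mem_Icc]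
      rw [neg_le_neg_iff, neg_le (a := z.1), and_comm (a := z.1 ≤ _)]
    have m2 : ∀ z : ℝ × ℝ, ((z.1, -z.2) : ℝ × ℝ) ∈ D \ Q ↔ z ∈ D \ Q := fun z => by
      simp only [hD, hQ, Set.mem_sdiff, mem_ofPred_eq, nsq, neg_sq, mem_prod, mem_Icc]
      rw [neg_le_neg_iff, neg_le (a := z.2), and_comm (a := z.2 ≤ _)]
    have mk : ∀ z z' : ℝ × ℝ, (z' ∈ D \ Q ↔ z ∈ D \ Q) → k z' = k z := fun z z' h => by
      by_cases hz : z ∈ D \ Q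
      · rw [hk, indicator_of_mem hz, indicator_of_mem (h.2 hz)]
      · rw [hk, indicator_of_notMem hz, indicator_of_notMem (mt h.1 hz)]
    exact ⟨fun z => mk _ _ (m1 z), fun z => mk _ _ (m2 z)⟩
  obtain ⟨w, K, B', hwL, hwB, hws, hweq⟩ := exists_fixed_conv hki
    (fun z => indicator_nonneg (fun _ _ => hb0.le) z) hk1 hke hF'L (fun z => hB _ (hmem z))
    (isFolded_comp_fold L₁ L₂ F)
  obtain ⟨M, hMc, hMs, hMH, hMl⟩ := exists_potential hR hwL hwB hws hα0 hα1
  have hMd : Differentiable ℝ M := hMc.differentiable (by norm_num)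
  refine ⟨M, b * ∫ z in Q, w z, hMc, hMH, fun x hx => ?_, fun x hx => hMs.fderiv_fst hMd hx,
    fun x hx => hMs.fderiv_snd hMd hx⟩
  have hint : IntegrableOn (fun z => w (x - z)) D := by
    refine Measure.integrableOn_of_bounded hvD
      (hwL.continuous.comp (by fun_prop)).aestronglyMeasurable
      (Eventually.of_forall fun z => hwB (x - z))
  have hsplit : ∫ z in D, w (x - z) = (∫ z in D \ Q, w (x - z)) + ∫ z in Q, w (x - z) := by
    rw [← setIntegral_union disjoint_sdiff_left hQm (hint.mono_set sdiff_subset)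
      (hint.mono_set hQD), sdiff_union_of_subset hQD]
  have hkw : ∫ z, k z * w (x - z) = b * ∫ z in D \ Q, w (x - z) := by
    rw [← integral_const_mul, ← integral_indicator hkm]
    congr 1; ext z
    by_cases hz : z ∈ D \ Q <;> simp [hk, hz]
  have hFx : F' x = F x := by
    simp only [hF', fold_of_mem hx.1, fold_of_mem hx.2]
  -- In w minus its disc mean the contribution of `D \ Q` cancels against k * w. The integral over
  -- the translated cell remains, and it does not depend on x by periodicity.
  rw [hMl, hweq x, hkw, hsplit, hws.setIntegral_sub h1 h2 hwL.continuous, hFx]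
  ring

/-! ### Calculus of `C^{2,α}` functions on convex bodies -/

/-- Compact convex sets with unique derivatives. -/
structure IsBody {X : Type*} [NormedAddCommGroup X] [NormedSpace ℝ X] (S : Set X) : Prop where
  convex : Convex ℝ S
  compact : IsCompact S
  unique : UniqueDiffOn ℝ S

section Calculus

variable {X Y Z G : Type*} [NormedAddCommGroup X] [NormedSpace ℝ X]
  [NormedAddCommGroup Y] [NormedSpace ℝ Y] [NormedAddCommGroup Z] [NormedSpace ℝ Z]
  [NormedAddCommGroup G] [NormedSpace ℝ G]

lemma IsBody.of_interior_nonempty {S : Set X} (hc : Convex ℝ S) (hk : IsCompact S)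
    (hi : (interior S).Nonempty) : IsBody S :=
  ⟨hc, hk, uniqueDiffOn_convex hc hi⟩

/-- Hölder continuity on a set. -/
def HolOn (α : ℝ) (S : Set X) (f : X → Y) : Prop :=
  ∃ C, 0 ≤ C ∧ ∀ x ∈ S, ∀ y ∈ S, ‖f x - f y‖ ≤ C * ‖x - y‖ ^ α

/-- The second derivative within a set. -/
noncomputable def hess (S : Set X) (f : X → Y) : X → X →L[ℝ] X →L[ℝ] Y :=
  fderivWithin ℝ (fderivWithin ℝ f S) S

/-- Functions of class `C^{2,α}` on a set. -/
def IsC2H (α : ℝ) (S : Set X) (f : X → Y) : Prop :=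
  ContDiffOn ℝ 2 f S ∧ HolOn α S (hess S f)

variable {α : ℝ} {S : Set X} {T : Set Y}

lemma HolOn.add {f g : X → Y} (hf : HolOn α S f) (hg : HolOn α S g) :
    HolOn α S (fun x => f x + g x) := by
  obtain ⟨A, hA, hf⟩ := hf
  obtain ⟨B, hB, hg⟩ := hg
  refine ⟨A + B, by positivity, fun x hx y hy => ?_⟩
  rw [add_sub_add_comm, add_mul]
  exact (norm_add_le _ _).trans (add_le_add (hf x hx y hy) (hg x hx y hy))

lemma HolOn.congr {f g : X → Y} (hf : HolOn α S f) (h : ∀ x ∈ S, g x = f x) : HolOn α S g := by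
  obtain ⟨A, hA, hf⟩ := hf
  exact ⟨A, hA, fun x hx y hy => by rw [h x hx, h y hy]; exact hf x hx y hy⟩

lemma HolOn.clm_comp {U : Set G} {a : G → Y →L[ℝ] Z} {b : G → X →L[ℝ] Y}
    (ha : HolOn α U a) (hb : HolOn α U b) (hab : ∃ C, ∀ x ∈ U, ‖a x‖ ≤ C)
    (hbb : ∃ C, ∀ x ∈ U, ‖b x‖ ≤ C) : HolOn α U (fun x => (a x).comp (b x)) := by
  obtain ⟨A, hA, ha⟩ := ha
  obtain ⟨C, hC, hb⟩ := hb
  obtain ⟨M, hM⟩ := hab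
  obtain ⟨N, hN⟩ := hbb
  refine ⟨A * |N| + |M| * C, by positivity, fun x hx y hy => ?_⟩
  have e : (a x).comp (b x) - (a y).comp (b y) =
      (a x - a y).comp (b x) + (a y).comp (b x - b y) := by
    ext v; simp
  have h1 := ha x hx y hy
  have h2 := hb x hx y hy
  have h3 : ‖b x‖ ≤ |N| := (hN x hx).trans (le_abs_self N)
  have h4 : ‖a y‖ ≤ |M| := (hM y hy).trans (le_abs_self M)
  have hp : 0 ≤ ‖x - y‖ ^ α := by positivity
  rw [e]
  calc _ ≤ ‖(a x - a y).comp (b x)‖ + ‖(a y).comp (b x - b y)‖ := norm_add_le _ _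
    _ ≤ ‖a x - a y‖ * ‖b x‖ + ‖a y‖ * ‖b x - b y‖ :=
        add_le_add (ContinuousLinearMap.opNorm_comp_le _ _)
          (ContinuousLinearMap.opNorm_comp_le _ _)
    _ ≤ (A * ‖x - y‖ ^ α) * |N| + |M| * (C * ‖x - y‖ ^ α) := by gcongr
    _ = _ := by ring

lemma bounded_clm_comp {U : Set G} {a : G → Y →L[ℝ] Z} {b : G → X →L[ℝ] Y}
    (ha : ∃ C, ∀ x ∈ U, ‖a x‖ ≤ C) (hb : ∃ C, ∀ x ∈ U, ‖b x‖ ≤ C) :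
    ∃ C, ∀ x ∈ U, ‖(a x).comp (b x)‖ ≤ C := by
  obtain ⟨A, hA⟩ := ha
  obtain ⟨B, hB⟩ := hb
  exact ⟨A * B, fun x hx => (ContinuousLinearMap.opNorm_comp_le _ _).trans
    (mul_le_mul (hA x hx) (hB x hx) (norm_nonneg _) ((norm_nonneg _).trans (hA x hx)))⟩

lemma HolOn.clm_apply (L : Y →L[ℝ] Z) {f : X → Y} (hf : HolOn α S f) :
    HolOn α S (fun x => L (f x)) := by
  obtain ⟨A, hA, hf⟩ := hf
  refine ⟨‖L‖ * A, by positivity, fun x hx y hy => ?_⟩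
  rw [← map_sub, mul_assoc]
  exact (L.le_opNorm _).trans (mul_le_mul_of_nonneg_left (hf x hx y hy) (norm_nonneg _))

lemma bounded_clm_apply (L : Y →L[ℝ] Z) {f : X → Y} (hf : ∃ C, ∀ x ∈ S, ‖f x‖ ≤ C) :
    ∃ C, ∀ x ∈ S, ‖L (f x)‖ ≤ C := by
  obtain ⟨A, hA⟩ := hf
  exact ⟨‖L‖ * A, fun x hx => (L.le_opNorm _).trans
    (mul_le_mul_of_nonneg_left (hA x hx) (norm_nonneg _))⟩

lemma IsBody.bounded_of_continuousOn (hS : IsBody S) {f : X → Y} (hf : ContinuousOn f S) :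
    ∃ C, ∀ x ∈ S, ‖f x‖ ≤ C := hS.compact.exists_bound_of_continuousOn hf

lemma IsBody.lipschitz_of_contDiffOn (hS : IsBody S) {f : X → Y} (hf : ContDiffOn ℝ 1 f S) :
    ∃ C : ℝ≥0, LipschitzOnWith C f S := by
  obtain ⟨C, hC⟩ := hS.bounded_of_continuousOn (hf.continuousOn_fderivWithin hS.unique le_rfl)
  refine ⟨C.toNNReal, hS.convex.lipschitzOnWith_of_nnnorm_fderivWithin_le
    (hf.differentiableOn one_ne_zero) fun x hx => ?_⟩
  rw [← norm_toNNReal]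
  exact Real.toNNReal_le_toNNReal (hC x hx)

/-- On a compact convex set a C¹ map is Lipschitz, and ‖x - y‖^(1-α) is bounded by a power of the
diameter. -/
lemma IsBody.holOn_of_contDiffOn (hS : IsBody S) (hα1 : α ≤ 1) {f : X → Y}
    (hf : ContDiffOn ℝ 1 f S) : HolOn α S f := by
  obtain ⟨C, hC⟩ := hS.lipschitz_of_contDiffOn hf
  obtain ⟨D, hD⟩ := Metric.isBounded_iff.1 hS.compact.isBounded
  refine ⟨C * |D| ^ (1 - α), by positivity, fun x hx y hy => ?_⟩
  have h1 := hC.dist_le_mul x hx y hy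
  rw [dist_eq_norm, dist_eq_norm] at h1
  have h2 : ‖x - y‖ ≤ |D| := by
    rw [← dist_eq_norm]; exact (hD hx hy).trans (le_abs_self D)
  rcases (norm_nonneg (x - y)).eq_or_lt with h0 | h0
  · rw [← h0, mul_zero] at h1
    exact h1.trans (by positivity)
  have h3 : ‖x - y‖ = ‖x - y‖ ^ (1 - α) * ‖x - y‖ ^ α := by
    rw [← Real.rpow_add h0]; simp
  have h4 : ‖x - y‖ ^ (1 - α) ≤ |D| ^ (1 - α) :=
    Real.rpow_le_rpow h0.le h2 (by linarith)
  calc _ ≤ C * ‖x - y‖ := h1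
    _ = C * (‖x - y‖ ^ (1 - α) * ‖x - y‖ ^ α) := by rw [← h3]
    _ ≤ C * (|D| ^ (1 - α) * ‖x - y‖ ^ α) := by gcongr
    _ = _ := by ring

lemma HolOn.comp (hα0 : 0 ≤ α) {h : Y → Z} {g : X → Y} (hh : HolOn α T h) {C : ℝ≥0}
    (hg : LipschitzOnWith C g S) (hm : MapsTo g S T) : HolOn α S (fun x => h (g x)) := by
  obtain ⟨A, hA, hh⟩ := hh
  refine ⟨A * (C : ℝ) ^ α, by positivity, fun x hx y hy => ?_⟩
  have h1 := hg.dist_le_mul x hx y hy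
  rw [dist_eq_norm, dist_eq_norm] at h1
  calc _ ≤ A * ‖g x - g y‖ ^ α := hh _ (hm hx) _ (hm hy)
    _ ≤ A * (C * ‖x - y‖) ^ α := by gcongr
    _ = _ := by rw [Real.mul_rpow C.coe_nonneg (norm_nonneg _)]; ring

lemma contDiffOn_fderivWithin_one (hS : IsBody S) {f : X → Y} (hf : ContDiffOn ℝ 2 f S) :
    ContDiffOn ℝ 1 (fderivWithin ℝ f S) S := hf.fderivWithin hS.unique (by norm_num)

lemma continuousOn_hess (hS : IsBody S) {f : X → Y} (hf : ContDiffOn ℝ 2 f S) :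
    ContinuousOn (hess S f) S :=
  (contDiffOn_fderivWithin_one hS hf).continuousOn_fderivWithin hS.unique le_rfl

lemma isC2H_of_contDiffOn_three (hS : IsBody S) (hα1 : α ≤ 1) {f : X → Y}
    (hf : ContDiffOn ℝ 3 f S) : IsC2H α S f := by
  have h2 : ContDiffOn ℝ 2 (fderivWithin ℝ f S) S := hf.fderivWithin hS.unique (by norm_num)
  exact ⟨hf.of_le (by norm_num), hS.holOn_of_contDiffOn hα1
    (contDiffOn_fderivWithin_one hS h2)⟩

/-- The second-order chain rule, written entirely with compositions of linear maps so that
`HolOn.clm_comp` applies to every term. -/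
lemma hess_comp (hS : IsBody S) (hT : IsBody T) {f : Y → Z} {g : X → Y} (hf : ContDiffOn ℝ 2 f T)
    (hg : ContDiffOn ℝ 2 g S) (hm : MapsTo g S T) {x : X} (hx : x ∈ S) :
    hess S (fun x => f (g x)) x =
      (ContinuousLinearMap.compL ℝ X Y Z (fderivWithin ℝ f T (g x))).comp (hess S g x) +
      ((ContinuousLinearMap.compL ℝ X Y Z).flip (fderivWithin ℝ g S x)).comp
        ((hess T f (g x)).comp (fderivWithin ℝ g S x)) := by
  have e : ∀ y ∈ S, fderivWithin ℝ (fun x => f (g x)) S y =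
      (fderivWithin ℝ f T (g y)).comp (fderivWithin ℝ g S y) := fun y hy =>
    fderivWithin_comp (g := f) (f := g) y ((hf.differentiableOn (by norm_num)) _ (hm hy))
      ((hg.differentiableOn (by norm_num)) _ hy) hm (hS.unique y hy)
  have h1 : HasFDerivWithinAt (fun y => fderivWithin ℝ f T (g y))
      ((hess T f (g x)).comp (fderivWithin ℝ g S x)) S x :=
    HasFDerivWithinAt.comp x
      (((contDiffOn_fderivWithin_one hT hf).differentiableOn one_ne_zero _
        (hm hx)).hasFDerivWithinAt)
      ((hg.differentiableOn (by norm_num) _ hx).hasFDerivWithinAt) hm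
  have h2 : HasFDerivWithinAt (fderivWithin ℝ g S) (hess S g x) S x :=
    ((contDiffOn_fderivWithin_one hS hg).differentiableOn one_ne_zero _ hx).hasFDerivWithinAt
  have h3 := h1.clm_comp h2
  rw [hess, fderivWithin_congr e (e x hx)]
  exact h3.fderivWithin (hS.unique x hx)

/-- Composition of `C^{2,α}` maps. -/
lemma IsC2H.comp (hα0 : 0 < α) (hα1 : α ≤ 1) (hS : IsBody S) (hT : IsBody T) {f : Y → Z}
    {g : X → Y} (hf : IsC2H α T f) (hg : IsC2H α S g) (hm : MapsTo g S T) :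
    IsC2H α S (fun x => f (g x)) := by
  refine ⟨hf.1.comp hg.1 hm, HolOn.congr ?_ fun x hx => hess_comp hS hT hf.1 hg.1 hm hx⟩
  obtain ⟨Cg, hgL⟩ := hS.lipschitz_of_contDiffOn (hg.1.of_le (by norm_num))
  have dg := contDiffOn_fderivWithin_one hS hg.1
  have df := contDiffOn_fderivWithin_one hT hf.1
  have hdg : HolOn α S (fderivWithin ℝ g S) := hS.holOn_of_contDiffOn hα1 dg
  have bdg := hS.bounded_of_continuousOn dg.continuousOn
  have hdf : HolOn α S (fun x => fderivWithin ℝ f T (g x)) :=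
    (hT.holOn_of_contDiffOn hα1 df).comp hα0.le hgL hm
  have bdf : ∃ C, ∀ x ∈ S, ‖fderivWithin ℝ f T (g x)‖ ≤ C := by
    obtain ⟨C, hC⟩ := hT.bounded_of_continuousOn df.continuousOn
    exact ⟨C, fun x hx => hC _ (hm hx)⟩
  have hhf : HolOn α S (fun x => hess T f (g x)) := hf.2.comp hα0.le hgL hm
  have bhf : ∃ C, ∀ x ∈ S, ‖hess T f (g x)‖ ≤ C := by
    obtain ⟨C, hC⟩ := hT.bounded_of_continuousOn (f := hess T f) (continuousOn_hess hT hf.1)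
    exact ⟨C, fun x hx => hC _ (hm hx)⟩
  have bhg := hS.bounded_of_continuousOn (f := hess S g) (continuousOn_hess hS hg.1)
  have h₁ : HolOn α S (fun x => ContinuousLinearMap.compL ℝ X Y Z (fderivWithin ℝ f T (g x))) :=
    HolOn.clm_apply (Y := Y →L[ℝ] Z) (Z := (X →L[ℝ] Y) →L[ℝ] X →L[ℝ] Z) _ hdf
  have b₁ : ∃ C, ∀ x ∈ S, ‖ContinuousLinearMap.compL ℝ X Y Z (fderivWithin ℝ f T (g x))‖ ≤ C :=
    bounded_clm_apply (Y := Y →L[ℝ] Z) (Z := (X →L[ℝ] Y) →L[ℝ] X →L[ℝ] Z) _ bdf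
  have h₂ : HolOn α S
      (fun x => (ContinuousLinearMap.compL ℝ X Y Z).flip (fderivWithin ℝ g S x)) :=
    HolOn.clm_apply (Y := X →L[ℝ] Y) (Z := (Y →L[ℝ] Z) →L[ℝ] X →L[ℝ] Z) _ hdg
  have b₂ : ∃ C, ∀ x ∈ S,
      ‖(ContinuousLinearMap.compL ℝ X Y Z).flip (fderivWithin ℝ g S x)‖ ≤ C :=
    bounded_clm_apply (Y := X →L[ℝ] Y) (Z := (Y →L[ℝ] Z) →L[ℝ] X →L[ℝ] Z) _ bdg
  have h₃ : HolOn α S (fun x => (hess T f (g x)).comp (fderivWithin ℝ g S x)) :=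
    HolOn.clm_comp hhf hdg bhf bdg
  have b₃ := bounded_clm_comp bhf bdg
  have h₄ := HolOn.clm_comp h₁ hg.2 b₁ bhg
  have h₅ := HolOn.clm_comp h₂ h₃ b₂ b₃
  exact h₄.add h₅

/-- A map into `ℝ^ι` is of class `C^{2,α}` if its components are. -/
lemma IsC2H.pi {ι : Type*} [Fintype ι] (hS : IsBody S) {f : X → ι → ℝ}
    (h : ∀ i, IsC2H α S (fun x => f x i)) : IsC2H α S f := by
  have hf : ContDiffOn ℝ 2 f S := contDiffOn_pi.2 fun i => (h i).1
  refine ⟨hf, ?_⟩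
  have key : ∀ i, ∀ x ∈ S, ∀ v w, hess S f x v w i = hess S (fun x => f x i) x v w := by
    intro i x hx v w
    have e : ∀ y ∈ S, fderivWithin ℝ (fun x => f x i) S y =
        (ContinuousLinearMap.proj i).comp (fderivWithin ℝ f S y) := fun y hy =>
      (((ContinuousLinearMap.proj (R := ℝ) (φ := fun _ : ι => ℝ) i).hasFDerivAt.comp_hasFDerivWithinAt
        y (hf.differentiableOn (by norm_num) y hy).hasFDerivWithinAt)).fderivWithin (hS.unique y hy)
    have h2 : HasFDerivWithinAt (fderivWithin ℝ f S) (hess S f x) S x :=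
      ((contDiffOn_fderivWithin_one hS hf).differentiableOn one_ne_zero _ hx).hasFDerivWithinAt
    have h3 := (((ContinuousLinearMap.compL ℝ X (ι → ℝ) ℝ)
      (ContinuousLinearMap.proj (R := ℝ) (φ := fun _ : ι => ℝ) i)).hasFDerivAt).comp_hasFDerivWithinAt
        x h2
    rw [hess, hess, fderivWithin_congr e (e x hx)]
    have h4 := h3.fderivWithin (hS.unique x hx)
    have h5 : fderivWithin ℝ (fun y => (ContinuousLinearMap.proj (R := ℝ) (φ := fun _ : ι => ℝ)
      i).comp (fderivWithin ℝ f S y)) S x = _ := h4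
    rw [h5]
    rfl
  choose C hC hb using fun i => (h i).2
  have hC0 := Finset.sum_nonneg fun i (_ : i ∈ Finset.univ) => hC i
  refine ⟨∑ i, C i, hC0, fun x hx y hy => ?_⟩
  have h0 : 0 ≤ ‖x - y‖ ^ α := by positivity
  refine ContinuousLinearMap.opNorm_le_bound₂ _ (by positivity) fun v w => ?_
  refine (pi_norm_le_iff_of_nonneg (by positivity)).2 fun i => ?_
  have e : (hess S f x - hess S f y) v w i =
      (hess S (fun x => f x i) x - hess S (fun x => f x i) y) v w := by
    have := key i x hx v w
    have := key i y hy v w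
    simp_all
  rw [e]
  refine (ContinuousLinearMap.le_opNorm₂ _ v w).trans ?_
  have h1 : ‖hess S (fun x => f x i) x - hess S (fun x => f x i) y‖ ≤
      (∑ i, C i) * ‖x - y‖ ^ α := by
    refine (hb i x hx y hy).trans ?_
    gcongr
    exact Finset.single_le_sum (fun i _ => hC i) (Finset.mem_univ i)
  gcongr

lemma IsC2H.add (hS : IsBody S) {f g : X → Y} (hf : IsC2H α S f) (hg : IsC2H α S g) :
    IsC2H α S (fun x => f x + g x) := by
  refine ⟨hf.1.add hg.1, HolOn.congr (hf.2.add hg.2) fun x hx => ?_⟩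
  have e : ∀ y ∈ S, fderivWithin ℝ (fun x => f x + g x) S y =
      fderivWithin ℝ f S y + fderivWithin ℝ g S y := fun y hy =>
    fderivWithin_fun_add (hS.unique y hy) (hf.1.differentiableOn (by norm_num) y hy)
      (hg.1.differentiableOn (by norm_num) y hy)
  rw [hess, fderivWithin_congr e (e x hx)]
  exact fderivWithin_fun_add (hS.unique x hx)
    ((contDiffOn_fderivWithin_one hS hf.1).differentiableOn one_ne_zero x hx)
    ((contDiffOn_fderivWithin_one hS hg.1).differentiableOn one_ne_zero x hx)

/-! ### Relation with the Hölder norms -/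

/-- Currying is a linear isometry; this identifies the seminorm in `holderNorm` with the one for
`hess`. -/
lemma norm_iteratedFDerivWithin_two_sub (hS : IsBody S) (f : X → ℝ) {x y : X} (hx : x ∈ S)
    (hy : y ∈ S) : ‖iteratedFDerivWithin ℝ 2 f S x - iteratedFDerivWithin ℝ 2 f S y‖ =
      ‖hess S f x - hess S f y‖ := by
  rw [iteratedFDerivWithin_succ_eq_comp_right hS.unique hx,
    iteratedFDerivWithin_succ_eq_comp_right hS.unique hy, Function.comp_apply, Function.comp_apply,
    ← dist_eq_norm, LinearIsometryEquiv.dist_map,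
    dist_iteratedFDerivWithin_one _ _ (hS.unique x hx) (hS.unique y hy), dist_eq_norm]
  rfl

lemma MemHolder.isC2H (hS : IsBody S) {f : X → ℝ} (hα0 : 0 ≤ α) (hf : MemHolder 2 α S f) :
    IsC2H α S f := by
  refine ⟨hf.1, ?_⟩
  set N := ⨆ x ∈ S, ⨆ y ∈ S, ⨆ _ : x ≠ y,
      ‖iteratedFDerivWithin ℝ 2 f S x - iteratedFDerivWithin ℝ 2 f S y‖ₑ / (edist x y) ^ α with hN
  have hNt : N ≠ ⊤ := ((le_add_self).trans_lt hf.2).ne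
  refine ⟨N.toReal, ENNReal.toReal_nonneg, fun x hx y hy => ?_⟩
  rw [← norm_iteratedFDerivWithin_two_sub hS f hx hy]
  rcases eq_or_ne x y with rfl | hxy
  · rw [sub_self, norm_zero]; positivity
  have h1 : ‖iteratedFDerivWithin ℝ 2 f S x - iteratedFDerivWithin ℝ 2 f S y‖ₑ /
      (edist x y) ^ α ≤ N :=
    (le_iSup (fun _ : x ≠ y => _) hxy).trans ((le_iSup₂ (f := fun y (_ : y ∈ S) => ⨆ _ : x ≠ y,
      ‖iteratedFDerivWithin ℝ 2 f S x - iteratedFDerivWithin ℝ 2 f S y‖ₑ / (edist x y) ^ α)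
        y hy).trans (le_iSup₂ (f := fun x (_ : x ∈ S) => ⨆ y ∈ S, ⨆ _ : x ≠ y,
      ‖iteratedFDerivWithin ℝ 2 f S x - iteratedFDerivWithin ℝ 2 f S y‖ₑ / (edist x y) ^ α) x hx))
  have hpos : 0 < dist x y := dist_pos.2 hxy
  have he : (edist x y) ^ α = ENNReal.ofReal (‖x - y‖ ^ α) := by
    rw [edist_dist, ENNReal.ofReal_rpow_of_nonneg dist_nonneg hα0, dist_eq_norm]
  rw [he, ENNReal.div_le_iff (by
      rw [dist_eq_norm] at hpos
      simpa using Real.rpow_pos_of_pos hpos α) ENNReal.ofReal_ne_top, ← ofReal_norm,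
    ← ENNReal.ofReal_toReal hNt, ← ENNReal.ofReal_mul ENNReal.toReal_nonneg] at h1
  exact (ENNReal.ofReal_le_ofReal_iff (by positivity)).1 h1

/-- The suprema of the lower derivatives are finite by compactness, so only the Hölder seminorm
carries information. -/
lemma IsC2H.memHolder (hS : IsBody S) {f : X → ℝ} (hα0 : 0 ≤ α) (hf : IsC2H α S f) :
    MemHolder 2 α S f := by
  obtain ⟨h2, C, hC, hH⟩ := hf
  refine ⟨h2, ENNReal.add_lt_top.2 ⟨ENNReal.sum_lt_top.2 fun j hj => ?_, ?_⟩⟩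
  · have hj' : j ≤ 2 := by have := Finset.mem_range.1 hj; omega
    obtain ⟨B, hB⟩ := hS.bounded_of_continuousOn
      (h2.continuousOn_iteratedFDerivWithin (m := j) (by exact_mod_cast hj') hS.unique)
    refine lt_of_le_of_lt (iSup₂_le fun x hx => ?_) (ENNReal.ofReal_lt_top (r := B))
    rw [← ofReal_norm]
    exact ENNReal.ofReal_le_ofReal (hB x hx)
  · refine lt_of_le_of_lt (iSup₂_le fun x hx => iSup₂_le fun y hy => iSup_le fun hxy => ?_)
      (ENNReal.ofReal_lt_top (r := C))
    have hpos : 0 < dist x y := dist_pos.2 hxy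
    rw [dist_eq_norm] at hpos
    have he : (edist x y) ^ α = ENNReal.ofReal (‖x - y‖ ^ α) := by
      rw [edist_dist, ENNReal.ofReal_rpow_of_nonneg dist_nonneg hα0, dist_eq_norm]
    rw [he, ENNReal.div_le_iff (by simpa using Real.rpow_pos_of_pos hpos α) ENNReal.ofReal_ne_top,
      ← ofReal_norm, ← ENNReal.ofReal_mul hC,
      norm_iteratedFDerivWithin_two_sub hS f hx hy]
    exact ENNReal.ofReal_le_ofReal (hH x hx y hy)

lemma abs_le_of_holderNorm_le {k : ℕ} {f : X → ℝ} {δ : ℝ} (hδ : 0 ≤ δ)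
    (h : holderNorm k α S f ≤ ENNReal.ofReal δ) {x : X} (hx : x ∈ S) : |f x| ≤ δ := by
  have h1 : ‖iteratedFDerivWithin ℝ 0 f S x‖ₑ ≤ ENNReal.ofReal δ := by
    refine le_trans ?_ (le_self_add.trans h)
    refine le_trans ?_ (Finset.single_le_sum (fun _ _ => zero_le) (Finset.mem_range.2
      (Nat.succ_pos k)))
    exact le_iSup₂ (f := fun x (_ : x ∈ S) => ‖iteratedFDerivWithin ℝ 0 f S x‖ₑ) x hx
  rw [← ofReal_norm, norm_iteratedFDerivWithin_zero] at h1
  exact (ENNReal.ofReal_le_ofReal_iff hδ).1 h1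

end Calculus

/-! ### Partial derivatives within a body -/

section PartialDerivatives

variable {X : Type*} [NormedAddCommGroup X] [NormedSpace ℝ X] {S : Set X} {v : X} {f g : X → ℝ}

lemma pd_congr (h : EqOn f g S) {x : X} (hx : x ∈ S) : pd S v f x = pd S v g x := by
  rw [pd, pd, fderivWithin_congr h (h hx)]

lemma pd_add (hS : UniqueDiffOn ℝ S) (hf : DifferentiableOn ℝ f S) (hg : DifferentiableOn ℝ g S)
    {x : X} (hx : x ∈ S) : pd S v (fun y => f y + g y) x = pd S v f x + pd S v g x := by
  rw [pd, fderivWithin_fun_add (hS x hx) (hf x hx) (hg x hx)]; rfl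

lemma pd_sub (hS : UniqueDiffOn ℝ S) (hf : DifferentiableOn ℝ f S) (hg : DifferentiableOn ℝ g S)
    {x : X} (hx : x ∈ S) : pd S v (fun y => f y - g y) x = pd S v f x - pd S v g x := by
  rw [pd, fderivWithin_fun_sub (hS x hx) (hf x hx) (hg x hx)]; rfl

lemma pd_mul (hS : UniqueDiffOn ℝ S) (hf : DifferentiableOn ℝ f S) (hg : DifferentiableOn ℝ g S)
    {x : X} (hx : x ∈ S) :
    pd S v (fun y => f y * g y) x = pd S v f x * g x + f x * pd S v g x := by
  rw [pd, fderivWithin_fun_mul (hS x hx) (hf x hx) (hg x hx)]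
  simp only [pd, add_apply, smul_apply, smul_eq_mul]
  ring

lemma pd_const_mul (hS : UniqueDiffOn ℝ S) (hf : DifferentiableOn ℝ f S) (a : ℝ)
    {x : X} (hx : x ∈ S) : pd S v (fun y => a * f y) x = a * pd S v f x := by
  rw [pd, ((hf x hx).hasFDerivWithinAt.const_mul a).fderivWithin (hS x hx)]
  rfl

lemma contDiffOn_pd {n m : WithTop ℕ∞} (hS : UniqueDiffOn ℝ S) (hf : ContDiffOn ℝ n f S)
    (hmn : m + 1 ≤ n) (v : X) : ContDiffOn ℝ m (pd S v f) S :=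
  (hf.fderivWithin hS hmn).clm_apply contDiffOn_const

end PartialDerivatives

/-! ### The closed cross-section -/

namespace Background

variable (b : Background)

lemma rs_pos : 0 < b.rs := b.r₁_pos.trans b.r₁_lt_rs

lemma Ebar_eq : b.Ebar = Icc ((-b.θ₀, -1) : ℝ × ℝ) (b.θ₀, 1) := by
  rw [Ebar, crossSecBar, Icc_prod_eq]

lemma isOpen_E : IsOpen b.E := isOpen_Ioo.prod isOpen_Ioo

lemma E_subset : b.E ⊆ b.Ebar := prod_mono Ioo_subset_Icc_self Ioo_subset_Icc_self

lemma zero_mem_E : (0 : ℝ × ℝ) ∈ b.E := by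
  have := b.θ₀_pos
  exact ⟨⟨by simpa using this, by simpa using this⟩, by simp, by simp⟩

lemma E_subset_interior : b.E ⊆ interior b.Ebar :=
  interior_maximal b.E_subset b.isOpen_E

lemma isBody_Ebar : IsBody b.Ebar :=
  IsBody.of_interior_nonempty ((convex_Icc _ _).prod (convex_Icc _ _))
    (isCompact_Icc.prod isCompact_Icc) ⟨0, b.E_subset_interior b.zero_mem_E⟩

lemma Ebar_subset_closure : b.Ebar ⊆ closure b.E := by
  have := b.θ₀_pos
  rw [E, crossSec, closure_prod_eq, closure_Ioo (by linarith), closure_Ioo (by norm_num)]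
  exact subset_rfl

lemma E_ae_eq : b.E =ᵐ[volume] b.Ebar := by
  rw [Measure.volume_eq_prod]
  exact Measure.set_prod_ae_eq Ioo_ae_eq_Icc Ioo_ae_eq_Icc

lemma edge2_subset : b.edge2 ⊆ b.Ebar := fun _ hy => ⟨abs_le.1 hy.1.le, hy.2⟩
lemma edge3_subset : b.edge3 ⊆ b.Ebar := fun _ hy => ⟨hy.1, abs_le.1 hy.2.le⟩

lemma integrableOn_E {f : ℝ × ℝ → ℝ} (hf : ContinuousOn f b.Ebar) : IntegrableOn f b.E :=
  (hf.integrableOn_compact b.isBody_Ebar.compact).mono_set b.E_subset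

/-- The divergence theorem for a field that is tangential on the boundary of `E`. -/
lemma integral_div_eq_zero {f g : ℝ × ℝ → ℝ} (hf : ContDiffOn ℝ 1 f b.Ebar)
    (hg : ContDiffOn ℝ 1 g b.Ebar) (hf0 : ∀ y ∈ b.edge2, f y = 0) (hg0 : ∀ y ∈ b.edge3, g y = 0) :
    ∫ y in b.E, (b.dE2 f y + b.dE3 g y) = 0 := by
  have hθ := b.θ₀_pos
  have hu := b.isBody_Ebar.unique
  have hnhds : ∀ x ∈ Ioo (-b.θ₀) b.θ₀ ×ˢ Ioo (-1 : ℝ) 1, b.Ebar ∈ 𝓝 x := fun x hx =>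
    mem_interior_iff_mem_nhds.1 (b.E_subset_interior hx)
  have hc2 := (contDiffOn_pd (m := 0) hu hf (by norm_num) f2).continuousOn
  have hc3 := (contDiffOn_pd (m := 0) hu hg (by norm_num) f3).continuousOn
  have h := integral_divergence_prod_Icc_of_hasFDerivAt_of_le f g
    (fderivWithin ℝ f b.Ebar) (fderivWithin ℝ g b.Ebar) ((-b.θ₀, -1) : ℝ × ℝ) (b.θ₀, 1)
    ⟨by simpa using hθ.le, by norm_num⟩
    (by rw [← b.Ebar_eq]; exact hf.continuousOn) (by rw [← b.Ebar_eq]; exact hg.continuousOn)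
    (fun x hx => ((hf.differentiableOn one_ne_zero) x (b.E_subset hx)).hasFDerivWithinAt.hasFDerivAt
      (hnhds x hx))
    (fun x hx => ((hg.differentiableOn one_ne_zero) x (b.E_subset hx)).hasFDerivWithinAt.hasFDerivAt
      (hnhds x hx))
    (by rw [← b.Ebar_eq]; exact (hc2.add hc3).integrableOn_compact b.isBody_Ebar.compact)
  rw [← b.Ebar_eq] at h
  have z : ∀ (k : ℝ → ℝ) (p q : ℝ), p ≤ q → (∀ t ∈ Icc p q, k t = 0) → ∫ t in p..q, k t = 0 :=
    fun k p q hpq hk => by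
      rw [intervalIntegral.integral_congr (g := fun _ => 0) fun t ht => hk t (by
        rwa [uIcc_of_le hpq] at ht)]
      simp
  simp only at h
  rw [z (fun x => g (x, 1)) _ _ (by linarith) fun t ht => hg0 _ ⟨ht, by simp⟩,
    z (fun x => g (x, -1)) _ _ (by linarith) fun t ht => hg0 _ ⟨ht, by simp⟩,
    z (fun y => f (b.θ₀, y)) _ _ (by norm_num) fun t ht => hf0 _ ⟨by simp [abs_of_pos hθ], ht⟩,
    z (fun y => f (-b.θ₀, y)) _ _ (by norm_num) fun t ht => hf0 _ ⟨by simp [abs_of_pos hθ], ht⟩]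
    at h
  rw [setIntegral_congr_set b.E_ae_eq]
  norm_num at h
  exact h

/-- A harmonic function (for `rs⁻² ∂₂² + ∂₃²`) with vanishing normal derivative is constant. -/
lemma exists_const_of_neumann_zero {u : ℝ × ℝ → ℝ} (hu : ContDiffOn ℝ 2 u b.Ebar)
    (hs : SolvesNeumann b (fun _ => 0) u) : ∃ κ, ∀ y ∈ b.Ebar, u y = κ := by
  have hU := b.isBody_Ebar.unique
  have hrs := b.rs_pos
  have hd : DifferentiableOn ℝ u b.Ebar := hu.differentiableOn (by norm_num)
  have c2 : ContDiffOn ℝ 1 (b.dE2 u) b.Ebar := contDiffOn_pd hU hu (by norm_num) f2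
  have c3 : ContDiffOn ℝ 1 (b.dE3 u) b.Ebar := contDiffOn_pd hU hu (by norm_num) f3
  have d2 := c2.differentiableOn one_ne_zero
  have d3 := c3.differentiableOn one_ne_zero
  -- Energy identity: the weighted field u∇u is tangential on the boundary by the Neumann
  -- conditions, and its divergence is the weighted |∇u|² since the equation removes the
  -- second-order terms.
  have hdiv := b.integral_div_eq_zero (f := fun y => (1 / b.rs ^ 2) * (u y * b.dE2 u y))
    (g := fun y => u y * b.dE3 u y)
    (contDiffOn_const.mul ((hu.of_le (by norm_num)).mul c2)) ((hu.of_le (by norm_num)).mul c3)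
    (fun y hy => by
      have := hs.neumann2 y hy
      have h0 : b.dE2 u y = 0 := by
        rcases mul_eq_zero.1 this with h | h
        · exact absurd h (by positivity)
        · exact h
      simp [h0])
    (fun y hy => by simp [hs.neumann3 y hy])
  set h : ℝ × ℝ → ℝ := fun y => 1 / b.rs ^ 2 * b.dE2 u y ^ 2 + b.dE3 u y ^ 2 with hh
  have hhc : ContinuousOn h b.Ebar :=
    (continuousOn_const.mul (c2.continuousOn.pow 2)).add (c3.continuousOn.pow 2)
  have heq : ∀ y ∈ b.E, b.dE2 (fun y => (1 / b.rs ^ 2) * (u y * b.dE2 u y)) y +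
      b.dE3 (fun y => u y * b.dE3 u y) y = h y := by
    intro y hy
    have hy' := b.E_subset hy
    have e1 : b.dE2 (fun y => (1 / b.rs ^ 2) * (u y * b.dE2 u y)) y =
        (1 / b.rs ^ 2) * (b.dE2 u y * b.dE2 u y + u y * b.dE2 (b.dE2 u) y) := by
      rw [dE2, pd_const_mul (f := fun y => u y * b.dE2 u y) hU (hd.mul d2) _ hy', pd_mul hU hd d2 hy']; rfl
    have e2 : b.dE3 (fun y => u y * b.dE3 u y) y =
        b.dE3 u y * b.dE3 u y + u y * b.dE3 (b.dE3 u) y := by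
      rw [dE3, pd_mul hU hd d3 hy']; rfl
    have e3 := hs.poisson y hy
    rw [lapE] at e3
    rw [e1, e2]
    simp only [hh]
    linear_combination u y * e3
  rw [setIntegral_congr_fun b.isOpen_E.measurableSet heq,
    setIntegral_eq_zero_iff_of_nonneg_ae (Eventually.of_forall fun y => by
      simp only [hh, Pi.zero_apply]; positivity) (b.integrableOn_E hhc)] at hdiv
  -- Vanishing almost everywhere becomes vanishing on the open set and then on its closure, by
  -- continuity of the gradient.
  have hz : EqOn h 0 b.E := Measure.eqOn_open_of_ae_eq hdiv b.isOpen_E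
    (hhc.mono b.E_subset) continuousOn_const
  have hzb : EqOn h 0 b.Ebar := hz.of_subset_closure hhc continuousOn_const b.E_subset
    b.Ebar_subset_closure
  refine ⟨u 0, fun y hy => ?_⟩
  refine b.isBody_Ebar.convex.is_const_of_fderivWithin_eq_zero hd (fun x hx => ?_) hy
    (b.E_subset b.zero_mem_E)
  have h0 := hzb hx
  simp only [hh, Pi.zero_apply] at h0
  have p1 : 0 ≤ 1 / b.rs ^ 2 * b.dE2 u x ^ 2 := by positivity
  have p2 : 0 ≤ b.dE3 u x ^ 2 := sq_nonneg _
  have z3 : b.dE3 u x = 0 := pow_eq_zero_iff two_ne_zero |>.1 (by linarith)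
  have z2 : b.dE2 u x = 0 := by
    have : 1 / b.rs ^ 2 * b.dE2 u x ^ 2 = 0 := by linarith
    rcases mul_eq_zero.1 this with h | h
    · exact absurd h (by positivity)
    · exact pow_eq_zero_iff two_ne_zero |>.1 h
  ext
  · simpa [dE2, pd, f2] using z2
  · simpa [dE3, pd, f3] using z3

/-- The operator `rs⁻² ∂₂² + ∂₃²` is linear on `C²` functions. -/
lemma lapE_sub {u v : ℝ × ℝ → ℝ} (hu : ContDiffOn ℝ 2 u b.Ebar) (hv : ContDiffOn ℝ 2 v b.Ebar)
    {y : ℝ × ℝ} (hy : y ∈ b.Ebar) : b.lapE (fun y => u y - v y) y = b.lapE u y - b.lapE v y := by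
  have hU := b.isBody_Ebar.unique
  have du : DifferentiableOn ℝ u b.Ebar := hu.differentiableOn (by norm_num)
  have dv : DifferentiableOn ℝ v b.Ebar := hv.differentiableOn (by norm_num)
  have key : ∀ w, pd b.Ebar w (pd b.Ebar w (fun y => u y - v y)) y =
      pd b.Ebar w (pd b.Ebar w u) y - pd b.Ebar w (pd b.Ebar w v) y := fun w => by
    rw [pd_congr (g := fun z => pd b.Ebar w u z - pd b.Ebar w v z)
      (fun z hz => pd_sub hU du dv hz) hy,
      pd_sub hU ((contDiffOn_pd (m := 1) hU hu (by norm_num) w).differentiableOn one_ne_zero)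
      ((contDiffOn_pd (m := 1) hU hv (by norm_num) w).differentiableOn one_ne_zero) hy]
  simp only [lapE, dE2, dE3, key]
  ring

lemma lapE_add {u v : ℝ × ℝ → ℝ} (hu : ContDiffOn ℝ 2 u b.Ebar) (hv : ContDiffOn ℝ 2 v b.Ebar)
    {y : ℝ × ℝ} (hy : y ∈ b.Ebar) : b.lapE (fun y => u y + v y) y = b.lapE u y + b.lapE v y := by
  have hU := b.isBody_Ebar.unique
  have du : DifferentiableOn ℝ u b.Ebar := hu.differentiableOn (by norm_num)
  have dv : DifferentiableOn ℝ v b.Ebar := hv.differentiableOn (by norm_num)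
  have key : ∀ w, pd b.Ebar w (pd b.Ebar w (fun y => u y + v y)) y =
      pd b.Ebar w (pd b.Ebar w u) y + pd b.Ebar w (pd b.Ebar w v) y := fun w => by
    rw [pd_congr (g := fun z => pd b.Ebar w u z + pd b.Ebar w v z)
      (fun z hz => pd_add hU du dv hz) hy,
      pd_add hU ((contDiffOn_pd (m := 1) hU hu (by norm_num) w).differentiableOn one_ne_zero)
      ((contDiffOn_pd (m := 1) hU hv (by norm_num) w).differentiableOn one_ne_zero) hy]
  simp only [lapE, dE2, dE3, key]
  ring

lemma lapE_const_mul {u : ℝ × ℝ → ℝ} (hu : ContDiffOn ℝ 2 u b.Ebar) (a : ℝ)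
    {y : ℝ × ℝ} (hy : y ∈ b.Ebar) : b.lapE (fun y => a * u y) y = a * b.lapE u y := by
  have hU := b.isBody_Ebar.unique
  have du : DifferentiableOn ℝ u b.Ebar := hu.differentiableOn (by norm_num)
  have key : ∀ w, pd b.Ebar w (pd b.Ebar w (fun y => a * u y)) y =
      a * pd b.Ebar w (pd b.Ebar w u) y := fun w => by
    rw [pd_congr (g := fun z => a * pd b.Ebar w u z) (fun z hz => pd_const_mul hU du a hz) hy,
      pd_const_mul hU ((contDiffOn_pd (m := 1) hU hu (by norm_num) w).differentiableOn one_ne_zero)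
      a hy]
  simp only [lapE, dE2, dE3, key]
  ring

/-- Solutions of the Neumann problem are unique up to a constant. -/
lemma exists_const_of_solvesNeumann {F u v : ℝ × ℝ → ℝ} (hu : ContDiffOn ℝ 2 u b.Ebar)
    (hv : ContDiffOn ℝ 2 v b.Ebar) (su : SolvesNeumann b F u) (sv : SolvesNeumann b F v) :
    ∃ κ, ∀ y ∈ b.Ebar, u y = v y + κ := by
  have hU := b.isBody_Ebar.unique
  have du : DifferentiableOn ℝ u b.Ebar := hu.differentiableOn (by norm_num)
  have dv : DifferentiableOn ℝ v b.Ebar := hv.differentiableOn (by norm_num)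
  obtain ⟨κ, hκ⟩ := b.exists_const_of_neumann_zero (u := fun y => u y - v y) (hu.sub hv)
    ⟨fun y hy => by
      rw [b.lapE_sub hu hv (b.E_subset hy), su.poisson y hy, sv.poisson y hy, sub_self],
    fun y hy => by
      rw [dE2, pd_sub hU du dv (b.edge2_subset hy), mul_sub]
      have h1 := su.neumann2 y hy
      have h2 := sv.neumann2 y hy
      rw [dE2] at h1 h2
      rw [h1, h2, sub_self],
    fun y hy => by
      rw [dE3, pd_sub hU du dv (b.edge3_subset hy)]
      have h1 := su.neumann3 y hy
      have h2 := sv.neumann3 y hy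
      rw [dE3] at h1 h2
      rw [h1, h2, sub_self]⟩
  exact ⟨κ, fun y hy => by linarith [hκ y hy]⟩

/-- Solvability of the Neumann problem on `E` with `C¹` right-hand side, up to a constant. -/
lemma exists_solution_up_to_const {F : ℝ × ℝ → ℝ} (hF : ContDiffOn ℝ 1 F b.Ebar) {α : ℝ}
    (hα0 : 0 < α) (hα1 : α < 1) :
    ∃ (M : ℝ × ℝ → ℝ) (κ : ℝ), IsC2H α b.Ebar M ∧ SolvesNeumann b (fun y => F y - κ) M := by
  have hrs := b.rs_pos
  have hθ := b.θ₀_pos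
  have hU := b.isBody_Ebar.unique
  obtain ⟨C, hC⟩ := b.isBody_Ebar.lipschitz_of_contDiffOn hF
  -- The rescaling (y₂, y₃) ↦ (rs y₂, y₃) turns rs⁻² ∂₂² + ∂₃² into the Laplacian on a rectangle
  -- with half-widths L₁ and 1.
  set L₁ : ℝ := b.rs * b.θ₀ with hL₁
  have hL₁0 : 0 < L₁ := by positivity
  set T : Set (ℝ × ℝ) := Icc (-L₁) L₁ ×ˢ Icc (-1) 1 with hT
  set A : ℝ × ℝ →L[ℝ] ℝ × ℝ :=
    (b.rs • ContinuousLinearMap.fst ℝ ℝ ℝ).prod (ContinuousLinearMap.snd ℝ ℝ ℝ) with hA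
  set A' : ℝ × ℝ →L[ℝ] ℝ × ℝ :=
    (b.rs⁻¹ • ContinuousLinearMap.fst ℝ ℝ ℝ).prod (ContinuousLinearMap.snd ℝ ℝ ℝ) with hA'
  have hAA : ∀ y, A' (A y) = y := fun y => by ext <;> simp [hA, hA', hrs.ne']
  have hm : MapsTo A b.Ebar T := fun y hy => by
    refine ⟨⟨?_, ?_⟩, hy.2⟩
    · have := mul_le_mul_of_nonneg_left hy.1.1 hrs.le
      simpa [hA, hL₁] using this
    · have := mul_le_mul_of_nonneg_left hy.1.2 hrs.le
      simpa [hA, hL₁] using this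
  have hm' : MapsTo A' T b.Ebar := fun x hx => by
    refine ⟨⟨?_, ?_⟩, hx.2⟩
    · have := mul_le_mul_of_nonneg_left hx.1.1 (inv_pos.2 hrs).le
      have e : b.rs⁻¹ * -L₁ = -b.θ₀ := by rw [hL₁]; field_simp
      rw [e] at this
      simpa [hA'] using this
    · have := mul_le_mul_of_nonneg_left hx.1.2 (inv_pos.2 hrs).le
      have e : b.rs⁻¹ * L₁ = b.θ₀ := by rw [hL₁]; field_simp
      rw [e] at this
      simpa [hA'] using this
  have hFL : LipschitzOnWith (C * ‖A'‖₊) (fun x => F (A' x)) T :=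
    hC.comp (A'.lipschitz.lipschitzOnWith (s := T)) hm'
  obtain ⟨M, κ, hM, ⟨CH, hCH⟩, hMl, hM1, hM2⟩ := exists_neumann hL₁0 one_pos hFL hα0 hα1
  have hTb : IsBody T := IsBody.of_interior_nonempty ((convex_Icc _ _).prod (convex_Icc _ _))
    (isCompact_Icc.prod isCompact_Icc) ⟨0, by
      rw [hT, interior_prod_eq, interior_Icc, interior_Icc]
      exact ⟨⟨by simpa using hL₁0, by simpa using hL₁0⟩, by simp, by simp⟩⟩
  have hMd : Differentiable ℝ M := hM.differentiable (by norm_num)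
  have hM1c : ContDiff ℝ 1 (fderiv ℝ M) := hM.fderiv_right (by norm_num)
  have hDMd : Differentiable ℝ (fderiv ℝ M) := hM1c.differentiable one_ne_zero
  have hMT : IsC2H α T M := by
    refine ⟨hM.contDiffOn, HolOn.congr (f := fderiv ℝ (fderiv ℝ M))
      ⟨|CH|, abs_nonneg _, fun x _ y _ => (hCH x y).trans ?_⟩ fun x hx => ?_⟩
    · exact mul_le_mul_of_nonneg_right (le_abs_self CH) (by positivity)
    · rw [hess, fderivWithin_congr (fun y hy => (hMd y).fderivWithin (hTb.unique y hy))
        ((hMd x).fderivWithin (hTb.unique x hx)), (hDMd x).fderivWithin (hTb.unique x hx)]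
  have hAc : IsC2H α b.Ebar A := isC2H_of_contDiffOn_three b.isBody_Ebar hα1.le
    A.contDiff.contDiffOn
  have e1 : ∀ v, ∀ y ∈ b.Ebar, pd b.Ebar v (fun y => M (A y)) y = fderiv ℝ M (A y) (A v) := by
    intro v y hy
    have h : HasFDerivAt (fun y => M (A y)) ((fderiv ℝ M (A y)).comp A) y :=
      (hMd (A y)).hasFDerivAt.comp y A.hasFDerivAt
    rw [pd, h.hasFDerivWithinAt.fderivWithin (hU y hy)]
    rfl
  have e2 : ∀ v, ∀ y ∈ b.Ebar, pd b.Ebar v (pd b.Ebar v (fun y => M (A y))) y =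
      fderiv ℝ (fderiv ℝ M) (A y) (A v) (A v) := by
    intro v y hy
    rw [pd_congr (fun z hz => e1 v z hz) hy, pd]
    have h1 : HasFDerivAt (fun y => fderiv ℝ M (A y)) ((fderiv ℝ (fderiv ℝ M) (A y)).comp A) y :=
      (hDMd (A y)).hasFDerivAt.comp y A.hasFDerivAt
    have h2 := h1.clm_apply (hasFDerivAt_const (A v) y)
    rw [h2.hasFDerivWithinAt.fderivWithin (hU y hy)]
    simp
  have hf2 : A f2 = b.rs • ((1, 0) : ℝ × ℝ) := by simp [hA, f2]
  have hf3 : A f3 = ((0, 1) : ℝ × ℝ) := by simp [hA, f3]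
  refine ⟨fun y => M (A y), κ, hMT.comp hα0 hα1.le b.isBody_Ebar hTb hAc hm, ?_, ?_, ?_⟩
  · intro y hy
    have hy' := b.E_subset hy
    rw [lapE, dE2, dE2, dE3, dE3, e2 _ _ hy', e2 _ _ hy', hf2, hf3]
    simp only [map_smul, smul_apply, smul_eq_mul]
    have := hMl (A y) (hm hy')
    rw [hAA] at this
    rw [← this]
    field_simp
  · intro y hy
    rw [dE2, e1 _ _ (b.edge2_subset hy), hf2, map_smul, hM1, smul_zero, mul_zero]
    have : (A y).1 = b.rs * y.1 := by simp [hA]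
    rw [this, abs_mul, abs_of_pos hrs, hy.1]
  · intro y hy
    rw [dE3, e1 _ _ (b.edge3_subset hy), hf3, hM2]
    exact hy.2

end Background

/-! ### Uniqueness for linear transport systems on a rectangle -/

/-- A nonnegative function on a rectangle which vanishes at inflow and satisfies a linear
transport inequality vanishes, if the transport does not cross the lateral sides. -/
lemma eq_zero_of_transport_le {a b c d p C : ℝ} {e es et A B : ℝ × ℝ → ℝ}
    (hp : 0 < p) (hC : 0 ≤ C)
    (hec : ContinuousOn e (Icc a b ×ˢ Icc c d)) (he0 : ∀ x ∈ Icc a b ×ˢ Icc c d, 0 ≤ e x)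
    (hin : ∀ t ∈ Icc c d, e (a, t) = 0)
    (hs : ∀ x ∈ Icc a b ×ˢ Icc c d, HasDerivWithinAt (fun s => e (s, x.2)) (es x) (Icc a b) x.1)
    (ht : ∀ x ∈ Icc a b ×ˢ Icc c d, HasDerivWithinAt (fun t => e (x.1, t)) (et x) (Icc c d) x.2)
    (hA : ∀ x ∈ Icc a b ×ˢ Icc c d, p ≤ A x)
    (hBc : ∀ s ∈ Icc a b, B (s, c) = 0) (hBd : ∀ s ∈ Icc a b, B (s, d) = 0)
    (hle : ∀ x ∈ Icc a b ×ˢ Icc c d, A x * es x + B x * et x ≤ C * e x) :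
    ∀ x ∈ Icc a b ×ˢ Icc c d, e x = 0 := by
  intro x₀ hx₀
  -- Chosen so that p l = C + p exceeds C. The proof examines a maximum point of exp(-l s) e and
  -- shows that e vanishes there.
  set l : ℝ := C / p + 1 with hl
  have hgc : ContinuousOn (fun x : ℝ × ℝ => Real.exp (-l * x.1) * e x) (Icc a b ×ˢ Icc c d) :=
    (by fun_prop : Continuous fun x : ℝ × ℝ => Real.exp (-l * x.1)).continuousOn.mul hec
  obtain ⟨x, hx, hmax⟩ := (isCompact_Icc.prod isCompact_Icc).exists_isMaxOn ⟨x₀, hx₀⟩ hgc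
  have hmx : e x = 0 := by
    by_contra hne
    have hpos : 0 < e x := lt_of_le_of_ne (he0 x hx) (Ne.symm hne)
    have hexp := Real.exp_pos (-l * x.1)
    have ha : a < x.1 := by
      refine lt_of_le_of_ne hx.1.1 fun h => hne ?_
      have := hin x.2 hx.2
      rwa [h] at this
    -- On the lateral sides B vanishes; elsewhere t is interior and e(x.1, ·) has a critical point.
    have hB : B x * et x = 0 := by
      rcases eq_or_lt_of_le hx.2.1 with h | h
      · have := hBc x.1 hx.1
        rw [h] at this
        rw [show B x = 0 from this, zero_mul]
      rcases eq_or_lt_of_le hx.2.2 with h' | h'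
      · have := hBd x.1 hx.1
        rw [← h'] at this
        rw [show B x = 0 from this, zero_mul]
      · have hd := (ht x hx).hasDerivAt (Icc_mem_nhds h h')
        have hloc : IsLocalMax (fun t => e (x.1, t)) x.2 := by
          filter_upwards [Icc_mem_nhds h h'] with t ht'
          have := hmax (show (x.1, t) ∈ Icc a b ×ˢ Icc c d from ⟨hx.1, ht'⟩)
          exact le_of_mul_le_mul_left this hexp
        rw [hloc.hasDerivAt_eq_zero hd, mul_zero]
    -- Only the derivative from the side of smaller s is used, so a maximum on the outflow side s =
    -- b is also covered.
    have hge : l * e x ≤ es x := by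
      have hd : HasDerivWithinAt (fun s => Real.exp (-l * s) * e (s, x.2))
          (Real.exp (-l * x.1) * (-l) * e x + Real.exp (-l * x.1) * es x) (Icc a b) x.1 := by
        have h1 : HasDerivAt (fun s : ℝ => Real.exp (-l * s)) (Real.exp (-l * x.1) * (-l)) x.1 := by
          simpa using ((hasDerivAt_id x.1).const_mul (-l)).exp
        exact h1.hasDerivWithinAt.mul (hs x hx)
      have hd' := hd.mono (Icc_subset_Icc_right hx.1.2 : Icc a x.1 ⊆ Icc a b)
      have hneg : 0 ≤ Real.exp (-l * x.1) * (-l) * e x + Real.exp (-l * x.1) * es x := by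
        have hloc : IsLocalMaxOn (fun s => Real.exp (-l * s) * e (s, x.2)) (Icc a x.1) x.1 := by
          have : IsMaxOn (fun s => Real.exp (-l * s) * e (s, x.2)) (Icc a x.1) x.1 := fun s hs' =>
            hmax (show (s, x.2) ∈ Icc a b ×ˢ Icc c d from ⟨⟨hs'.1, hs'.2.trans hx.1.2⟩, hx.2⟩)
          exact this.localize
        have h := hloc.hasFDerivWithinAt_nonpos hd'.hasFDerivWithinAt
          (y := a - x.1) (sub_mem_posTangentConeAt_of_segment_subset (by
            rw [segment_symm, segment_eq_Icc ha.le]))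
        simp only [ContinuousLinearMap.toSpanSingleton_apply, smul_eq_mul] at h
        by_contra hcon
        push Not at hcon
        nlinarith
      have : 0 ≤ Real.exp (-l * x.1) * (es x - l * e x) := by linarith
      have := nonneg_of_mul_nonneg_right this hexp
      linarith
    have h1 := hle x hx
    rw [hB, add_zero] at h1
    have h2 : p * (l * e x) ≤ A x * es x :=
      mul_le_mul (hA x hx) hge (by positivity) (hp.le.trans (hA x hx))
    have h3 : p * (l * e x) = C * e x + p * e x := by rw [hl]; field_simp
    have : 0 < p * e x := by positivity
    linarith
  have h := hmax hx₀
  simp only [mem_ofPred_eq, hmx, mul_zero] at h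
  exact le_antisymm (nonpos_of_mul_nonpos_right h (Real.exp_pos _)) (he0 x₀ hx₀)

/-- Solutions of homogeneous linear transport systems with zero inflow data vanish. -/
lemma eq_zero_of_transport {n : ℕ} {a b c d : ℝ} {z zs zt : Fin n → ℝ × ℝ → ℝ} {A B : ℝ × ℝ → ℝ}
    {m : Fin n → Fin n → ℝ × ℝ → ℝ}
    (hAc : ContinuousOn A (Icc a b ×ˢ Icc c d)) (hA : ∀ x ∈ Icc a b ×ˢ Icc c d, 0 < A x)
    (hm : ∀ i j, ContinuousOn (m i j) (Icc a b ×ˢ Icc c d))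
    (hz : ∀ i, ContinuousOn (z i) (Icc a b ×ˢ Icc c d))
    (hin : ∀ i, ∀ t ∈ Icc c d, z i (a, t) = 0)
    (hs : ∀ i, ∀ x ∈ Icc a b ×ˢ Icc c d,
      HasDerivWithinAt (fun s => z i (s, x.2)) (zs i x) (Icc a b) x.1)
    (ht : ∀ i, ∀ x ∈ Icc a b ×ˢ Icc c d,
      HasDerivWithinAt (fun t => z i (x.1, t)) (zt i x) (Icc c d) x.2)
    (hBc : ∀ s ∈ Icc a b, B (s, c) = 0) (hBd : ∀ s ∈ Icc a b, B (s, d) = 0)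
    (heq : ∀ i, ∀ x ∈ Icc a b ×ˢ Icc c d,
      A x * zs i x + B x * zt i x = ∑ j, m i j x * z j x) :
    ∀ i, ∀ x ∈ Icc a b ×ˢ Icc c d, z i x = 0 := by
  intro i₀ x₀ hx₀
  have hQ : IsCompact (Icc a b ×ˢ Icc c d) := isCompact_Icc.prod isCompact_Icc
  obtain ⟨x₁, hx₁, hmin⟩ := hQ.exists_isMinOn ⟨x₀, hx₀⟩ hAc
  have hex : ∀ i j, ∃ C, ∀ x ∈ Icc a b ×ˢ Icc c d, ‖m i j x‖ ≤ C := fun i j =>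
    hQ.exists_bound_of_continuousOn (hm i j)
  choose C hC using hex
  set M : ℝ := ∑ i, ∑ j, |C i j| with hM
  have hM0 : 0 ≤ M := Finset.sum_nonneg fun i _ => Finset.sum_nonneg fun j _ => abs_nonneg _
  have hmM : ∀ i j, ∀ x ∈ Icc a b ×ˢ Icc c d, |m i j x| ≤ M := fun i j x hx =>
    ((hC i j x hx).trans (le_abs_self _)).trans
      ((Finset.single_le_sum (f := fun j => |C i j|) (fun j _ => abs_nonneg _)
        (Finset.mem_univ j)).trans
      (Finset.single_le_sum (f := fun i => ∑ j, |C i j|)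
        (fun i _ => Finset.sum_nonneg fun j _ => abs_nonneg _) (Finset.mem_univ i)))
  -- The scalar estimate is applied to the sum of squares. Its transport derivative is 2 ∑ zᵢ mᵢⱼ
  -- zⱼ, at most 2nM ∑ zᵢ² by 2|zᵢzⱼ| ≤ zᵢ² + zⱼ².
  have key := eq_zero_of_transport_le (e := fun x => ∑ i, z i x ^ 2)
    (es := fun x => ∑ i, 2 * z i x * zs i x) (et := fun x => ∑ i, 2 * z i x * zt i x)
    (A := A) (B := B) (C := 2 * n * M) (hA x₁ hx₁) (by positivity)
    (continuousOn_finsetSum _ fun i _ => (hz i).pow 2)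
    (fun x _ => Finset.sum_nonneg fun i _ => sq_nonneg _)
    (fun t ht => Finset.sum_eq_zero fun i _ => by rw [hin i t ht]; norm_num)
    (fun x hx => HasDerivWithinAt.fun_sum fun i _ => by simpa using (hs i x hx).fun_pow 2)
    (fun x hx => HasDerivWithinAt.fun_sum fun i _ => by simpa using (ht i x hx).fun_pow 2)
    (fun x hx => hmin hx) hBc hBd ?_ x₀ hx₀
  · have := (Finset.sum_eq_zero_iff_of_nonneg fun i _ => sq_nonneg (z i x₀)).1 key i₀
      (Finset.mem_univ _)
    exact pow_eq_zero_iff two_ne_zero |>.1 this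
  intro x hx
  have h1 : A x * ∑ i, 2 * z i x * zs i x + B x * ∑ i, 2 * z i x * zt i x =
      ∑ i, ∑ j, 2 * z i x * (m i j x * z j x) := by
    rw [Finset.mul_sum, Finset.mul_sum, ← Finset.sum_add_distrib]
    refine Finset.sum_congr rfl fun i _ => ?_
    rw [← Finset.mul_sum, ← heq i x hx]
    ring
  have h2 : ∑ i, ∑ j, 2 * z i x * (m i j x * z j x) ≤ ∑ i, ∑ j, M * (z i x ^ 2 + z j x ^ 2) := by
    refine Finset.sum_le_sum fun i _ => Finset.sum_le_sum fun j _ => ?_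
    have h3 : 2 * z i x * (m i j x * z j x) ≤ |m i j x| * (z i x ^ 2 + z j x ^ 2) := by
      rcases abs_cases (m i j x) with ⟨h, h'⟩ | ⟨h, h'⟩ <;> rw [h]
      · nlinarith [sq_nonneg (z i x - z j x)]
      · nlinarith [sq_nonneg (z i x + z j x)]
    exact h3.trans (mul_le_mul_of_nonneg_right (hmM i j x hx) (by positivity))
  have h4 : ∑ i : Fin n, ∑ j : Fin n, M * (z i x ^ 2 + z j x ^ 2) =
      2 * n * M * ∑ i, z i x ^ 2 := by
    simp only [mul_add, Finset.sum_add_distrib, Finset.sum_const, Finset.card_univ,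
      Fintype.card_fin, ← Finset.mul_sum, nsmul_eq_mul]
    ring
  rw [h1]
  exact h2.trans h4.le

/-! ### Slices, tangential derivatives, commutation -/

section Slices

variable {X Y : Type*} [NormedAddCommGroup X] [NormedSpace ℝ X] [NormedAddCommGroup Y]
  [NormedSpace ℝ Y] {S : Set X} {f : X → ℝ}

lemma hasDerivWithinAt_slice (hf : DifferentiableOn ℝ f S) {c : ℝ → X} {v : X} {I : Set ℝ} {t : ℝ}
    (hc : HasDerivWithinAt c v I t) (hm : MapsTo c I S) (ht : t ∈ I) :
    HasDerivWithinAt (fun s => f (c s)) (pd S v f (c t)) I t :=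
  (hf (c t) (hm ht)).hasFDerivWithinAt.comp_hasDerivWithinAt t hc hm

lemma pd_eq_zero_of_slice (hf : DifferentiableOn ℝ f S) {c : ℝ → X} {v : X} {I : Set ℝ} {t : ℝ}
    (hI : UniqueDiffOn ℝ I) (hc : HasDerivWithinAt c v I t) (hm : MapsTo c I S) (ht : t ∈ I)
    (h0 : ∀ s ∈ I, f (c s) = 0) : pd S v f (c t) = 0 := by
  have h1 := (hasDerivWithinAt_slice hf hc hm ht).derivWithin (hI t ht)
  rw [derivWithin_congr (f := fun _ => 0) h0 (h0 t ht), derivWithin_fun_const] at h1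
  exact h1.symm

lemma pd_comp_affine {T : Set Y} (hf : DifferentiableOn ℝ f S) {g : Y → X} {g' : Y →L[ℝ] X}
    (hT : UniqueDiffOn ℝ T) {y : Y} (hg : HasFDerivWithinAt g g' T y) (hm : MapsTo g T S)
    (hy : y ∈ T) (v : Y) : pd T v (fun y => f (g y)) y = pd S (g' v) f (g y) := by
  have h : HasFDerivWithinAt (fun y => f (g y)) ((fderivWithin ℝ f S (g y)).comp g') T y :=
    (hf (g y) (hm hy)).hasFDerivWithinAt.comp y hg hm
  rw [pd, h.fderivWithin (hT y hy)]
  rfl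

/-- Symmetry of the second derivative reaches the boundary because every point is a limit of
interior points. It is needed on the walls. -/
lemma pd_comm (hS : UniqueDiffOn ℝ S) (hcl : S ⊆ closure (interior S)) (hf : ContDiffOn ℝ 2 f S)
    (v w : X) {x : X} (hx : x ∈ S) : pd S v (pd S w f) x = pd S w (pd S v f) x := by
  have hd : DifferentiableWithinAt ℝ (fderivWithin ℝ f S) S x :=
    ((hf.fderivWithin (m := 1) hS (by norm_num)).differentiableOn one_ne_zero) x hx
  have key : ∀ v w, pd S v (pd S w f) x = fderivWithin ℝ (fderivWithin ℝ f S) S x v w := by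
    intro v w
    have h := hd.hasFDerivWithinAt.clm_apply (hasFDerivWithinAt_const w x S)
    have h' : HasFDerivWithinAt (pd S w f) _ S x := h
    rw [pd, h'.fderivWithin (hS x hx)]
    simp
  rw [key, key]
  exact (hf x hx).isSymmSndFDerivWithinAt (by simp) hS (hcl hx) hx v w

lemma pd_zero_of_eqOn_zero {v : X} (h : EqOn f (fun _ => 0) S) {x : X} (hx : x ∈ S) :
    pd S v f x = 0 := by
  rw [pd_congr h hx, pd, fderivWithin_fun_const]; rfl

/-- The derivative of a transport equation. -/
lemma pd_transport (hS : UniqueDiffOn ℝ S) (hcl : S ⊆ closure (interior S))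
    {A B C G f : X → ℝ} {e₁ e₂ e₃ n : X} (hA : DifferentiableOn ℝ A S) (hB : DifferentiableOn ℝ B S)
    (hC : DifferentiableOn ℝ C S) (hG : DifferentiableOn ℝ G S) (hf : ContDiffOn ℝ 2 f S)
    (heq : ∀ x ∈ S, A x * pd S e₁ f x + B x * pd S e₂ f x + C x * pd S e₃ f x + G x = 0)
    {x : X} (hx : x ∈ S) :
    A x * pd S e₁ (pd S n f) x + B x * pd S e₂ (pd S n f) x + C x * pd S e₃ (pd S n f) x +
      pd S n A x * pd S e₁ f x + pd S n B x * pd S e₂ f x + pd S n C x * pd S e₃ f x +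
      pd S n G x = 0 := by
  have hp : ∀ v, DifferentiableOn ℝ (pd S v f) S := fun v =>
    (contDiffOn_pd (m := 1) hS hf (by norm_num) v).differentiableOn one_ne_zero
  have h0 := pd_zero_of_eqOn_zero (v := n) (f := fun x =>
    A x * pd S e₁ f x + B x * pd S e₂ f x + C x * pd S e₃ f x + G x) heq hx
  rw [pd_add (f := fun x => A x * pd S e₁ f x + B x * pd S e₂ f x + C x * pd S e₃ f x) hS
      (((hA.mul (hp _)).add (hB.mul (hp _))).add (hC.mul (hp _))) hG hx,
    pd_add (f := fun x => A x * pd S e₁ f x + B x * pd S e₂ f x) (g := fun x => C x * pd S e₃ f x)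
      hS ((hA.mul (hp _)).add (hB.mul (hp _))) (hC.mul (hp _)) hx,
    pd_add (f := fun x => A x * pd S e₁ f x) (g := fun x => B x * pd S e₂ f x) hS
      (hA.mul (hp _)) (hB.mul (hp _)) hx,
    pd_mul hS hA (hp _) hx, pd_mul hS hB (hp _) hx, pd_mul hS hC (hp _) hx,
    pd_comm hS hcl hf n e₁ hx, pd_comm hS hcl hf n e₂ hx, pd_comm hS hcl hf n e₃ hx] at h0
  linarith

end Slices

/-! ### Normal derivatives of the incoming flow on the walls -/

lemma isBody_boxBar {a c θ : ℝ} (hac : a < c) (hθ : 0 < θ) : IsBody (boxBar a c θ) :=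
  IsBody.of_interior_nonempty
    ((convex_Icc _ _).prod ((convex_Icc _ _).prod (convex_Icc _ _)))
    (isCompact_Icc.prod (isCompact_Icc.prod isCompact_Icc)) (by
      rw [boxBar, crossSecBar, interior_prod_eq, interior_prod_eq, interior_Icc, interior_Icc,
        interior_Icc]
      exact ⟨((a + c) / 2, 0, 0), ⟨by simp only; linarith, by simp only; linarith⟩,
        ⟨by simpa using hθ, by simpa using hθ⟩, by simp, by simp⟩)

lemma isOpen_box {a c θ : ℝ} : IsOpen (box a c θ) := isOpen_Ioo.prod (isOpen_Ioo.prod isOpen_Ioo)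

lemma box_subset {a c θ : ℝ} : box a c θ ⊆ boxBar a c θ :=
  prod_mono Ioo_subset_Icc_self (prod_mono Ioo_subset_Icc_self Ioo_subset_Icc_self)

lemma boxBar_subset_closure {a c θ : ℝ} (hac : a < c) (hθ : 0 < θ) :
    boxBar a c θ ⊆ closure (box a c θ) := by
  rw [box, crossSec, closure_prod_eq, closure_prod_eq, closure_Ioo hac.ne,
    closure_Ioo (by linarith), closure_Ioo (by norm_num)]
  exact subset_rfl

lemma boxBar_subset_closure_interior {a c θ : ℝ} (hac : a < c) (hθ : 0 < θ) :
    boxBar a c θ ⊆ closure (interior (boxBar a c θ)) :=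
  (boxBar_subset_closure hac hθ).trans (closure_mono (interior_maximal box_subset isOpen_box))

namespace Background

variable (b : Background)

lemma r₁_lt_r₂ : b.r₁ < b.r₂ := b.r₁_lt_rs.trans b.rs_lt_r₂

lemma isBody_Ωbar : IsBody b.Ωbar := isBody_boxBar b.r₁_lt_r₂ b.θ₀_pos

lemma isBody_Dbar : IsBody b.Dbar := isBody_boxBar b.rs_lt_r₂ b.θ₀_pos

end Background

section Incoming

variable {b : Background} {α ε C₀ : ℝ} {d : State (ℝ × ℝ)} {Ψ : State (ℝ × ℝ × ℝ)}

/-- The Euler system in advection form on the closure of the nozzle, for the reciprocal density `σ`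
and the angular velocity `W`. -/
structure IsAdvection (b : Background) (Ψ : State (ℝ × ℝ × ℝ)) (σ W : ℝ × ℝ × ℝ → ℝ) : Prop where
  reg_U1 : ContDiffOn ℝ 2 Ψ.U1 b.Ωbar
  reg_U2 : ContDiffOn ℝ 2 Ψ.U2 b.Ωbar
  reg_U3 : ContDiffOn ℝ 2 Ψ.U3 b.Ωbar
  reg_P : ContDiffOn ℝ 2 Ψ.P b.Ωbar
  reg_K : ContDiffOn ℝ 2 Ψ.K b.Ωbar
  reg_σ : ContDiffOn ℝ 2 σ b.Ωbar
  reg_W : ContDiffOn ℝ 2 W b.Ωbar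
  K_ne : ∀ x ∈ b.Ωbar, Ψ.K x ≠ 0
  U1_pos : ∀ x ∈ b.Ωbar, 0 < Ψ.U1 x
  σ_pos : ∀ x ∈ b.Ωbar, 0 < σ x
  W_eq : ∀ x ∈ b.Ωbar, W x = Ψ.U2 x * x.1⁻¹
  pd_σ : ∀ x ∈ b.Ωbar, ∀ v, pd b.Ωbar v Ψ.P x = 0 →
    pd b.Ωbar v σ x = σ x / (b.γ * Ψ.K x) * pd b.Ωbar v Ψ.K x
  momentum1 : ∀ x ∈ b.Ωbar, Ψ.U1 x * b.dΩ1 Ψ.U1 x + W x * b.dΩ2 Ψ.U1 x + Ψ.U3 x * b.dΩ3 Ψ.U1 x +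
    (σ x * b.dΩ1 Ψ.P x - Ψ.U2 x * W x) = 0
  momentum2 : ∀ x ∈ b.Ωbar, Ψ.U1 x * b.dΩ1 Ψ.U2 x + W x * b.dΩ2 Ψ.U2 x + Ψ.U3 x * b.dΩ3 Ψ.U2 x +
    (σ x * x.1⁻¹ * b.dΩ2 Ψ.P x + Ψ.U1 x * W x) = 0
  momentum3 : ∀ x ∈ b.Ωbar, Ψ.U1 x * b.dΩ1 Ψ.U3 x + W x * b.dΩ2 Ψ.U3 x + Ψ.U3 x * b.dΩ3 Ψ.U3 x +
    σ x * b.dΩ3 Ψ.P x = 0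
  entropy : ∀ x ∈ b.Ωbar, Ψ.U1 x * b.dΩ1 Ψ.K x + W x * b.dΩ2 Ψ.K x + Ψ.U3 x * b.dΩ3 Ψ.K x +
    0 = 0
  slip2 : ∀ r ∈ Icc b.r₁ b.r₂, ∀ y ∈ b.edge2, Ψ.U2 (r, y) = 0
  slip3 : ∀ r ∈ Icc b.r₁ b.r₂, ∀ y ∈ b.edge3, Ψ.U3 (r, y) = 0

lemma fst_pos {x : ℝ × ℝ × ℝ} (hx : x ∈ b.Ωbar) : 0 < x.1 := b.r₁_pos.trans_le hx.1.1

lemma contDiffOn_inv_fst {n : WithTop ℕ∞} : ContDiffOn ℝ n (fun x : ℝ × ℝ × ℝ => x.1⁻¹) b.Ωbar :=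
  contDiffOn_fst.inv fun _ hx => (fst_pos hx).ne'

/-- The Euler equations are given in the open nozzle only, but are needed on the walls. All terms
are continuous up to the boundary for a C² flow with positive density, so the equations extend. -/
lemma IsIncomingFlow.isAdvection (h : IsIncomingFlow b α ε C₀ d Ψ)
    (hU : ∀ x ∈ b.Ωbar, 0 < Ψ.U1 x) (hP : ∀ x ∈ b.Ωbar, 0 < Ψ.P x)
    (hK : ∀ x ∈ b.Ωbar, 0 < Ψ.K x) :
    IsAdvection b Ψ (fun x => 1 / Ψ.rho b.γ x) (fun x => Ψ.U2 x * x.1⁻¹) := by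
  have hS := b.isBody_Ωbar.unique
  have hγ : 0 < b.γ := one_pos.trans b.one_lt_γ
  have c1 : ContDiffOn ℝ 2 Ψ.U1 b.Ωbar := by exact_mod_cast h.reg_U1.1
  have c2 : ContDiffOn ℝ 2 Ψ.U2 b.Ωbar := by exact_mod_cast h.reg_U2.1
  have c3 : ContDiffOn ℝ 2 Ψ.U3 b.Ωbar := by exact_mod_cast h.reg_U3.1
  have cP : ContDiffOn ℝ 2 Ψ.P b.Ωbar := by exact_mod_cast h.reg_P.1
  have cK : ContDiffOn ℝ 2 Ψ.K b.Ωbar := by exact_mod_cast h.reg_K.1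
  have hρ : ∀ x ∈ b.Ωbar, 0 < Ψ.rho b.γ x := fun x hx =>
    Real.rpow_pos_of_pos (div_pos (hP x hx) (hK x hx)) _
  have cρ : ContDiffOn ℝ 2 (Ψ.rho b.γ) b.Ωbar :=
    (cP.div cK fun x hx => (hK x hx).ne').rpow_const_of_ne fun x hx =>
      (div_pos (hP x hx) (hK x hx)).ne'
  have cσ : ContDiffOn ℝ 2 (fun x => 1 / Ψ.rho b.γ x) b.Ωbar :=
    contDiffOn_const.div cρ fun x hx => (hρ x hx).ne'
  have cW : ContDiffOn ℝ 2 (fun x => Ψ.U2 x * x.1⁻¹) b.Ωbar := c2.mul contDiffOn_inv_fst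
  have hpc : ∀ {f : ℝ × ℝ × ℝ → ℝ} (v), ContDiffOn ℝ 2 f b.Ωbar →
      ContinuousOn (pd b.Ωbar v f) b.Ωbar := fun v hf =>
    (contDiffOn_pd (m := 1) hS hf (by norm_num) v).continuousOn
  have ext : ∀ {F : ℝ × ℝ × ℝ → ℝ}, ContinuousOn F b.Ωbar → (∀ x ∈ b.Ω, F x = 0) →
      ∀ x ∈ b.Ωbar, F x = 0 := fun {F} hF h0 =>
    (show EqOn F (fun _ => 0) b.Ω from h0).of_subset_closure hF continuousOn_const box_subset
      (boxBar_subset_closure b.r₁_lt_r₂ b.θ₀_pos)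
  have adv : ∀ {f : ℝ × ℝ × ℝ → ℝ}, ContDiffOn ℝ 2 f b.Ωbar → ContinuousOn (fun x =>
      Ψ.U1 x * b.dΩ1 f x + Ψ.U2 x * x.1⁻¹ * b.dΩ2 f x + Ψ.U3 x * b.dΩ3 f x) b.Ωbar := fun hf =>
    ((c1.continuousOn.mul (hpc _ hf)).add (cW.continuousOn.mul (hpc _ hf))).add
      (c3.continuousOn.mul (hpc _ hf))
  refine ⟨c1, c2, c3, cP, cK, cσ, cW, fun x hx => (hK x hx).ne', hU,
    fun x hx => one_div_pos.2 (hρ x hx), fun _ _ => rfl, ?_, ?_, ?_, ?_, ?_, h.slip2, h.slip3⟩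
  · intro x hx v hv
    have dP := (cP.differentiableOn (by norm_num) x hx).hasFDerivWithinAt
    have dK := (cK.differentiableOn (by norm_num) x hx).hasFDerivWithinAt
    -- In the form (K/P)^(1/γ) = exp(-(log P - log K)/γ), a direction in which P is stationary
    -- leaves only the contribution of K.
    have e : EqOn (fun x => 1 / Ψ.rho b.γ x)
        (fun x => Real.exp (-(1 / b.γ) * (Real.log (Ψ.P x) - Real.log (Ψ.K x)))) b.Ωbar := by
      intro z hz
      simp only [State.rho]
      rw [← Real.log_div (hP z hz).ne' (hK z hz).ne', one_div, ← Real.rpow_neg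
        (div_pos (hP z hz) (hK z hz)).le, Real.rpow_def_of_pos (div_pos (hP z hz) (hK z hz)),
        mul_comm]
    have D := (((dP.log (hP x hx).ne').sub (dK.log (hK x hx).ne')).const_mul (-(1 / b.γ))).exp
    rw [pd_congr e hx, pd]
    have D' : HasFDerivWithinAt
      (fun x => Real.exp (-(1 / b.γ) * (Real.log (Ψ.P x) - Real.log (Ψ.K x)))) _ b.Ωbar x := D
    rw [D'.fderivWithin (hS x hx)]
    have ex := e hx
    simp only at ex
    rw [ex]
    have hv' : fderivWithin ℝ Ψ.P b.Ωbar x v = 0 := hv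
    simp only [pd, smul_apply, sub_apply, smul_eq_mul, hv']
    have := (hK x hx).ne'
    simp only [Pi.sub_apply]
    field_simp
    ring
  · refine ext ((adv c1).add ((cσ.continuousOn.mul (hpc _ cP)).sub
      (c2.continuousOn.mul cW.continuousOn))) fun x hx => ?_
    linear_combination (h.euler x hx).momentum1
  · refine ext ((adv c2).add (((cσ.continuousOn.mul
      (contDiffOn_inv_fst (n := 0)).continuousOn).mul (hpc _ cP)).add
      (c1.continuousOn.mul cW.continuousOn))) fun x hx => ?_
    have := (h.euler x hx).momentum2
    rw [← this]
    have h1 := (fst_pos (b := b) (box_subset hx)).ne'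
    have h2 := (hρ x (box_subset hx)).ne'
    field_simp
    ring
  · refine ext ((adv c3).add (cσ.continuousOn.mul (hpc _ cP))) fun x hx => ?_
    linear_combination (h.euler x hx).momentum3
  · refine ext ((adv cK).add continuousOn_const) fun x hx => ?_
    linear_combination (h.euler x hx).entropy

lemma hasDerivAt_line1 (y : ℝ × ℝ) (s : ℝ) : HasDerivAt (fun s : ℝ => (s, y)) e1 s :=
  (hasDerivAt_id s).prodMk (hasDerivAt_const s y)

lemma hasDerivAt_line2 (r x₃ s : ℝ) : HasDerivAt (fun s : ℝ => (r, s, x₃)) e2 s :=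
  (hasDerivAt_const s r).prodMk ((hasDerivAt_id s).prodMk (hasDerivAt_const s x₃))

lemma hasDerivAt_line3 (r θ s : ℝ) : HasDerivAt (fun s : ℝ => (r, θ, s)) e3 s :=
  (hasDerivAt_const s r).prodMk ((hasDerivAt_const s θ).prodMk (hasDerivAt_id s))

lemma pd_inv_fst {v : ℝ × ℝ × ℝ} (hv : v.1 = 0) {x : ℝ × ℝ × ℝ} (hx : x ∈ b.Ωbar) :
    pd b.Ωbar v (fun x : ℝ × ℝ × ℝ => x.1⁻¹) x = 0 := by
  have h1 : HasFDerivWithinAt (fun x : ℝ × ℝ × ℝ => x.1) (ContinuousLinearMap.fst ℝ ℝ (ℝ × ℝ))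
    b.Ωbar x := hasFDerivWithinAt_fst
  have hd : HasFDerivWithinAt (fun x : ℝ × ℝ × ℝ => x.1⁻¹) _ b.Ωbar x :=
    (hasDerivAt_inv (fst_pos hx).ne').comp_hasFDerivWithinAt x h1
  rw [pd, hd.fderivWithin (b.isBody_Ωbar.unique x hx)]
  simp [hv]

lemma pd_W {W : ℝ × ℝ × ℝ → ℝ} {σ : ℝ × ℝ × ℝ → ℝ} (H : IsAdvection b Ψ σ W) {v : ℝ × ℝ × ℝ}
    (hv : v.1 = 0) {x : ℝ × ℝ × ℝ} (hx : x ∈ b.Ωbar) :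
    pd b.Ωbar v W x = pd b.Ωbar v Ψ.U2 x * x.1⁻¹ := by
  rw [pd_congr H.W_eq hx, pd_mul b.isBody_Ωbar.unique (H.reg_U2.differentiableOn (by norm_num))
    ((contDiffOn_inv_fst (n := 1)).differentiableOn one_ne_zero) hx, pd_inv_fst hv hx, mul_zero,
    add_zero]

/-- On this wall the angular velocity vanishes, and the angular momentum equation then makes the
pressure stationary in the normal direction. Differentiating the equations for K, U₁, U₃ in θ gives
a homogeneous linear system for their normal derivatives, transported within the wall by (U₁, U₃);
U₃ = 0 at x₃ = ±1 prevents lateral inflow. -/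
lemma IsAdvection.wall2 {σ W : ℝ × ℝ × ℝ → ℝ} (H : IsAdvection b Ψ σ W)
    (hin : ∀ y ∈ b.edge2, b.dΩ2 Ψ.K (b.r₁, y) = 0 ∧ b.dΩ2 Ψ.U1 (b.r₁, y) = 0 ∧
      b.dΩ2 Ψ.U3 (b.r₁, y) = 0) {r : ℝ} (hr : r ∈ Icc b.r₁ b.r₂) {y : ℝ × ℝ} (hy : y ∈ b.edge2) :
    b.dΩ2 Ψ.U1 (r, y) = 0 ∧ b.dΩ2 Ψ.U3 (r, y) = 0 ∧ b.dΩ2 Ψ.P (r, y) = 0 ∧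
      b.dΩ2 Ψ.K (r, y) = 0 := by
  have hS := b.isBody_Ωbar.unique
  have hcl := boxBar_subset_closure_interior b.r₁_lt_r₂ b.θ₀_pos
  have I1 : UniqueDiffOn ℝ (Icc b.r₁ b.r₂) := uniqueDiffOn_Icc b.r₁_lt_r₂
  have I3 : UniqueDiffOn ℝ (Icc (-1 : ℝ) 1) := uniqueDiffOn_Icc (by norm_num)
  have hdf : ∀ {f : ℝ × ℝ × ℝ → ℝ}, ContDiffOn ℝ 2 f b.Ωbar → DifferentiableOn ℝ f b.Ωbar :=
    fun hf => hf.differentiableOn (by norm_num)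
  have hp1 : ∀ {f : ℝ × ℝ × ℝ → ℝ} (v), ContDiffOn ℝ 2 f b.Ωbar →
      ContDiffOn ℝ 1 (pd b.Ωbar v f) b.Ωbar := fun v hf => contDiffOn_pd hS hf (by norm_num) v
  have hpd : ∀ {f : ℝ × ℝ × ℝ → ℝ} (v), ContDiffOn ℝ 2 f b.Ωbar →
      DifferentiableOn ℝ (pd b.Ωbar v f) b.Ωbar := fun v hf =>
    (hp1 v hf).differentiableOn one_ne_zero
  have hpc : ∀ {f : ℝ × ℝ × ℝ → ℝ} (v), ContDiffOn ℝ 2 f b.Ωbar →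
      ContinuousOn (pd b.Ωbar v f) b.Ωbar := fun v hf => (hp1 v hf).continuousOn
  obtain ⟨τ, t₀⟩ := y
  have hτ : |τ| = b.θ₀ := hy.1
  have hw : ∀ t ∈ Icc (-1 : ℝ) 1, (τ, t) ∈ b.edge2 := fun t ht => ⟨hτ, ht⟩
  have hmem : ∀ s ∈ Icc b.r₁ b.r₂, ∀ t ∈ Icc (-1 : ℝ) 1, (s, τ, t) ∈ b.Ωbar := fun s hs t ht =>
    ⟨hs, b.edge2_subset (hw t ht)⟩
  have tan1 : ∀ {f : ℝ × ℝ × ℝ → ℝ}, DifferentiableOn ℝ f b.Ωbar →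
      (∀ s ∈ Icc b.r₁ b.r₂, ∀ t ∈ Icc (-1 : ℝ) 1, f (s, τ, t) = 0) →
      ∀ s ∈ Icc b.r₁ b.r₂, ∀ t ∈ Icc (-1 : ℝ) 1, pd b.Ωbar e1 f (s, τ, t) = 0 :=
    fun hf h0 s hs t ht => pd_eq_zero_of_slice hf I1 (hasDerivAt_line1 (τ, t) s).hasDerivWithinAt
      (fun s hs => hmem s hs t ht) hs fun s hs => h0 s hs t ht
  have tan3 : ∀ {f : ℝ × ℝ × ℝ → ℝ}, DifferentiableOn ℝ f b.Ωbar →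
      (∀ s ∈ Icc b.r₁ b.r₂, ∀ t ∈ Icc (-1 : ℝ) 1, f (s, τ, t) = 0) →
      ∀ s ∈ Icc b.r₁ b.r₂, ∀ t ∈ Icc (-1 : ℝ) 1, pd b.Ωbar e3 f (s, τ, t) = 0 :=
    fun hf h0 s hs t ht => pd_eq_zero_of_slice hf I3 (hasDerivAt_line3 s τ t).hasDerivWithinAt
      (fun t ht => hmem s hs t ht) ht fun t ht => h0 s hs t ht
  have U20 : ∀ s ∈ Icc b.r₁ b.r₂, ∀ t ∈ Icc (-1 : ℝ) 1, Ψ.U2 (s, τ, t) = 0 := fun s hs t ht =>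
    H.slip2 s hs _ (hw t ht)
  have W0 : ∀ s ∈ Icc b.r₁ b.r₂, ∀ t ∈ Icc (-1 : ℝ) 1, W (s, τ, t) = 0 := fun s hs t ht => by
    rw [H.W_eq _ (hmem s hs t ht), U20 s hs t ht, zero_mul]
  -- Where U₂ = W = 0 along the whole wall, the tangential derivatives of U₂ vanish as well, and the
  -- pressure term of the angular momentum equation is all that remains.
  have P0 : ∀ s ∈ Icc b.r₁ b.r₂, ∀ t ∈ Icc (-1 : ℝ) 1, pd b.Ωbar e2 Ψ.P (s, τ, t) = 0 := by
    intro s hs t ht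
    have hx := hmem s hs t ht
    have h := H.momentum2 _ hx
    rw [Background.dΩ1, Background.dΩ3, tan1 (hdf H.reg_U2) U20 s hs t ht,
      tan3 (hdf H.reg_U2) U20 s hs t ht, W0 s hs t ht] at h
    have h1 : σ (s, τ, t) * s⁻¹ * pd b.Ωbar e2 Ψ.P (s, τ, t) = 0 := by
      simpa [Background.dΩ2] using h
    exact (mul_eq_zero.1 h1).resolve_left
      (mul_pos (H.σ_pos _ hx) (inv_pos.2 (fst_pos hx))).ne'
  have hmaps : MapsTo (fun x : ℝ × ℝ => (x.1, τ, x.2)) (Icc b.r₁ b.r₂ ×ˢ Icc (-1 : ℝ) 1) b.Ωbar :=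
    fun x hx => hmem _ hx.1 _ hx.2
  have hι : Continuous fun x : ℝ × ℝ => (x.1, τ, x.2) := by fun_prop
  have pull : ∀ {f : ℝ × ℝ × ℝ → ℝ}, ContinuousOn f b.Ωbar →
      ContinuousOn (fun x : ℝ × ℝ => f (x.1, τ, x.2)) (Icc b.r₁ b.r₂ ×ˢ Icc (-1 : ℝ) 1) :=
    fun hf => hf.comp hι.continuousOn hmaps
  have cc : ContinuousOn (fun x => σ x / (b.γ * Ψ.K x)) b.Ωbar :=
    H.reg_σ.continuousOn.div (continuousOn_const.mul H.reg_K.continuousOn) fun x hx =>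
      mul_ne_zero (one_pos.trans b.one_lt_γ).ne' (H.K_ne x hx)
  have cw : ContinuousOn (pd b.Ωbar e2 W) b.Ωbar := hpc _ H.reg_W
  set F : Fin 3 → ℝ × ℝ × ℝ → ℝ := ![Ψ.K, Ψ.U1, Ψ.U3] with hF
  have hFr : ∀ i, ContDiffOn ℝ 2 (F i) b.Ωbar := fun i => by
    fin_cases i
    exacts [H.reg_K, H.reg_U1, H.reg_U3]
  set m : Fin 3 → Fin 3 → ℝ × ℝ × ℝ → ℝ :=
    ![![fun x => -pd b.Ωbar e2 W x, fun x => -pd b.Ωbar e1 Ψ.K x, fun x => -pd b.Ωbar e3 Ψ.K x],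
      ![fun x => -(σ x / (b.γ * Ψ.K x) * pd b.Ωbar e1 Ψ.P x),
        fun x => -(pd b.Ωbar e1 Ψ.U1 x + pd b.Ωbar e2 W x), fun x => -pd b.Ωbar e3 Ψ.U1 x],
      ![fun x => -(σ x / (b.γ * Ψ.K x) * pd b.Ωbar e3 Ψ.P x),
        fun x => -pd b.Ωbar e1 Ψ.U3 x, fun x => -(pd b.Ωbar e2 W x + pd b.Ωbar e3 Ψ.U3 x)]] with hm
  have hmc : ∀ i j, ContinuousOn (m i j) b.Ωbar := fun i j => by
    fin_cases i <;> fin_cases j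
    exacts [cw.neg, (hpc _ H.reg_K).neg, (hpc _ H.reg_K).neg, (cc.mul (hpc _ H.reg_P)).neg,
      ((hpc _ H.reg_U1).add cw).neg, (hpc _ H.reg_U1).neg, (cc.mul (hpc _ H.reg_P)).neg,
      (hpc _ H.reg_U3).neg, (cw.add (hpc _ H.reg_U3)).neg]
  have key := eq_zero_of_transport (z := fun i x => pd b.Ωbar e2 (F i) (x.1, τ, x.2))
    (zs := fun i x => pd b.Ωbar e1 (pd b.Ωbar e2 (F i)) (x.1, τ, x.2))
    (zt := fun i x => pd b.Ωbar e3 (pd b.Ωbar e2 (F i)) (x.1, τ, x.2))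
    (A := fun x => Ψ.U1 (x.1, τ, x.2)) (B := fun x => Ψ.U3 (x.1, τ, x.2))
    (m := fun i j x => m i j (x.1, τ, x.2))
    (a := b.r₁) (b := b.r₂) (c := -1) (d := 1)
    (pull H.reg_U1.continuousOn) (fun x hx => H.U1_pos _ (hmaps hx))
    (fun i j => pull (hmc i j)) (fun i => pull (hpc _ (hFr i)))
    (fun i t ht => by
      have := hin _ (hw t ht)
      fin_cases i
      exacts [this.1, this.2.1, this.2.2])
    (fun i x hx => hasDerivWithinAt_slice (hpd _ (hFr i))
      (hasDerivAt_line1 (τ, x.2) x.1).hasDerivWithinAt (fun s hs => hmem s hs _ hx.2) hx.1)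
    (fun i x hx => hasDerivWithinAt_slice (hpd _ (hFr i))
      (hasDerivAt_line3 x.1 τ x.2).hasDerivWithinAt (fun s hs => hmem _ hx.1 s hs) hx.2)
    (fun s hs => H.slip3 s hs _ ⟨(b.edge2_subset (hw (-1) (by simp))).1, by simp⟩)
    (fun s hs => H.slip3 s hs _ ⟨(b.edge2_subset (hw 1 (by simp))).1, by simp⟩)
    ?_
  · have hx : (r, t₀) ∈ Icc b.r₁ b.r₂ ×ˢ Icc (-1 : ℝ) 1 := ⟨hr, hy.2⟩
    exact ⟨key 1 _ hx, key 2 _ hx, P0 r hr t₀ hy.2, key 0 _ hx⟩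
  rintro i ⟨s, t⟩ ⟨hs, ht⟩
  have hx := hmem s hs t ht
  have w0 := W0 s hs t ht
  have u0 := U20 s hs t ht
  have sK := H.pd_σ _ hx e2 (P0 s hs t ht)
  -- Since ∂₂P = 0 on the whole wall, its tangential derivatives vanish; after commuting, no second
  -- derivative of P survives in the system. The derivative of σ is a multiple of that of K, which
  -- closes it.
  have p1 := tan1 (hpd _ H.reg_P) P0 s hs t ht
  have p3 := tan3 (hpd _ H.reg_P) P0 s hs t ht
  have dσ := hdf H.reg_σ
  simp only [Fin.sum_univ_three]
  fin_cases i
  · have h := pd_transport hS hcl (n := e2) (hdf H.reg_U1) (hdf H.reg_W) (hdf H.reg_U3)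
      (G := fun _ => 0) (differentiableOn_const 0) H.reg_K H.entropy hx
    rw [pd_zero_of_eqOn_zero (fun _ _ => rfl) hx, w0] at h
    simp only [hF, hm, Fin.zero_eta, Fin.isValue, Matrix.cons_val]
    linear_combination h
  · have h := pd_transport (G := fun x => σ x * pd b.Ωbar e1 Ψ.P x - Ψ.U2 x * W x) hS hcl (n := e2)
      (hdf H.reg_U1) (hdf H.reg_W) (hdf H.reg_U3) ((dσ.mul (hpd e1 H.reg_P)).sub ((hdf H.reg_U2).mul (hdf H.reg_W))) H.reg_U1 H.momentum1 hx
    have e : pd b.Ωbar e2 (fun x => σ x * pd b.Ωbar e1 Ψ.P x - Ψ.U2 x * W x) (s, τ, t) =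
        σ (s, τ, t) / (b.γ * Ψ.K (s, τ, t)) * pd b.Ωbar e2 Ψ.K (s, τ, t) *
          pd b.Ωbar e1 Ψ.P (s, τ, t) := by
      rw [pd_sub (f := fun x => σ x * pd b.Ωbar e1 Ψ.P x) (g := fun x => Ψ.U2 x * W x) hS
        (dσ.mul (hpd _ H.reg_P)) ((hdf H.reg_U2).mul (hdf H.reg_W)) hx,
        pd_mul hS dσ (hpd _ H.reg_P) hx, pd_mul hS (hdf H.reg_U2) (hdf H.reg_W) hx, w0, u0,
        pd_comm hS hcl H.reg_P e2 e1 hx, p1, sK]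
      ring
    rw [e, w0] at h
    simp only [hF, hm, Fin.mk_one, Fin.isValue, Matrix.cons_val]
    linear_combination h
  · have h := pd_transport (G := fun x => σ x * pd b.Ωbar e3 Ψ.P x) hS hcl (n := e2)
      (hdf H.reg_U1) (hdf H.reg_W) (hdf H.reg_U3) (dσ.mul (hpd e3 H.reg_P)) H.reg_U3 H.momentum3 hx
    have e : pd b.Ωbar e2 (fun x => σ x * pd b.Ωbar e3 Ψ.P x) (s, τ, t) =
        σ (s, τ, t) / (b.γ * Ψ.K (s, τ, t)) * pd b.Ωbar e2 Ψ.K (s, τ, t) *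
          pd b.Ωbar e3 Ψ.P (s, τ, t) := by
      rw [pd_mul hS dσ (hpd _ H.reg_P) hx, pd_comm hS hcl H.reg_P e2 e3 hx, p3, sK]
      ring
    rw [e, w0] at h
    simp only [hF, hm, Fin.reduceFinMk, Fin.isValue, Matrix.cons_val]
    linear_combination h

/-- As for `IsAdvection.wall2`, with unknowns the axial derivatives of K, U₁, U₂ and transport by
(U₁, W). The curvature terms U₂²/r and U₁U₂/r add zeroth-order couplings, and W = 0 at θ = ±θ₀
closes the lateral sides. -/
lemma IsAdvection.wall3 {σ W : ℝ × ℝ × ℝ → ℝ} (H : IsAdvection b Ψ σ W)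
    (hin : ∀ y ∈ b.edge3, b.dΩ3 Ψ.K (b.r₁, y) = 0 ∧ b.dΩ3 Ψ.U1 (b.r₁, y) = 0 ∧
      b.dΩ3 Ψ.U2 (b.r₁, y) = 0) {r : ℝ} (hr : r ∈ Icc b.r₁ b.r₂) {y : ℝ × ℝ} (hy : y ∈ b.edge3) :
    b.dΩ3 Ψ.U1 (r, y) = 0 ∧ b.dΩ3 Ψ.U2 (r, y) = 0 ∧ b.dΩ3 Ψ.P (r, y) = 0 ∧
      b.dΩ3 Ψ.K (r, y) = 0 := by
  have hS := b.isBody_Ωbar.unique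
  have hcl := boxBar_subset_closure_interior b.r₁_lt_r₂ b.θ₀_pos
  have I1 : UniqueDiffOn ℝ (Icc b.r₁ b.r₂) := uniqueDiffOn_Icc b.r₁_lt_r₂
  have I2 : UniqueDiffOn ℝ (Icc (-b.θ₀) b.θ₀) := uniqueDiffOn_Icc (by linarith [b.θ₀_pos])
  have hdf : ∀ {f : ℝ × ℝ × ℝ → ℝ}, ContDiffOn ℝ 2 f b.Ωbar → DifferentiableOn ℝ f b.Ωbar :=
    fun hf => hf.differentiableOn (by norm_num)
  have hp1 : ∀ {f : ℝ × ℝ × ℝ → ℝ} (v), ContDiffOn ℝ 2 f b.Ωbar →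
      ContDiffOn ℝ 1 (pd b.Ωbar v f) b.Ωbar := fun v hf => contDiffOn_pd hS hf (by norm_num) v
  have hpd : ∀ {f : ℝ × ℝ × ℝ → ℝ} (v), ContDiffOn ℝ 2 f b.Ωbar →
      DifferentiableOn ℝ (pd b.Ωbar v f) b.Ωbar := fun v hf =>
    (hp1 v hf).differentiableOn one_ne_zero
  have hpc : ∀ {f : ℝ × ℝ × ℝ → ℝ} (v), ContDiffOn ℝ 2 f b.Ωbar →
      ContinuousOn (pd b.Ωbar v f) b.Ωbar := fun v hf => (hp1 v hf).continuousOn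
  obtain ⟨t₀, τ⟩ := y
  have hτ : |τ| = 1 := hy.2
  have hw : ∀ t ∈ Icc (-b.θ₀) b.θ₀, (t, τ) ∈ b.edge3 := fun t ht => ⟨ht, hτ⟩
  have hmem : ∀ s ∈ Icc b.r₁ b.r₂, ∀ t ∈ Icc (-b.θ₀) b.θ₀, (s, t, τ) ∈ b.Ωbar := fun s hs t ht =>
    ⟨hs, b.edge3_subset (hw t ht)⟩
  have tan1 : ∀ {f : ℝ × ℝ × ℝ → ℝ}, DifferentiableOn ℝ f b.Ωbar →
      (∀ s ∈ Icc b.r₁ b.r₂, ∀ t ∈ Icc (-b.θ₀) b.θ₀, f (s, t, τ) = 0) →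
      ∀ s ∈ Icc b.r₁ b.r₂, ∀ t ∈ Icc (-b.θ₀) b.θ₀, pd b.Ωbar e1 f (s, t, τ) = 0 :=
    fun hf h0 s hs t ht => pd_eq_zero_of_slice hf I1 (hasDerivAt_line1 (t, τ) s).hasDerivWithinAt
      (fun s hs => hmem s hs t ht) hs fun s hs => h0 s hs t ht
  have tan2 : ∀ {f : ℝ × ℝ × ℝ → ℝ}, DifferentiableOn ℝ f b.Ωbar →
      (∀ s ∈ Icc b.r₁ b.r₂, ∀ t ∈ Icc (-b.θ₀) b.θ₀, f (s, t, τ) = 0) →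
      ∀ s ∈ Icc b.r₁ b.r₂, ∀ t ∈ Icc (-b.θ₀) b.θ₀, pd b.Ωbar e2 f (s, t, τ) = 0 :=
    fun hf h0 s hs t ht => pd_eq_zero_of_slice hf I2 (hasDerivAt_line2 s τ t).hasDerivWithinAt
      (fun t ht => hmem s hs t ht) ht fun t ht => h0 s hs t ht
  have U30 : ∀ s ∈ Icc b.r₁ b.r₂, ∀ t ∈ Icc (-b.θ₀) b.θ₀, Ψ.U3 (s, t, τ) = 0 := fun s hs t ht =>
    H.slip3 s hs _ (hw t ht)
  have P0 : ∀ s ∈ Icc b.r₁ b.r₂, ∀ t ∈ Icc (-b.θ₀) b.θ₀, pd b.Ωbar e3 Ψ.P (s, t, τ) = 0 := by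
    intro s hs t ht
    have hx := hmem s hs t ht
    have h := H.momentum3 _ hx
    rw [Background.dΩ1, Background.dΩ2, tan1 (hdf H.reg_U3) U30 s hs t ht,
      tan2 (hdf H.reg_U3) U30 s hs t ht, U30 s hs t ht] at h
    have h1 : σ (s, t, τ) * pd b.Ωbar e3 Ψ.P (s, t, τ) = 0 := by
      simpa [Background.dΩ3] using h
    exact (mul_eq_zero.1 h1).resolve_left (H.σ_pos _ hx).ne'
  have hmaps : MapsTo (fun x : ℝ × ℝ => (x.1, x.2, τ)) (Icc b.r₁ b.r₂ ×ˢ Icc (-b.θ₀) b.θ₀) b.Ωbar :=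
    fun x hx => hmem _ hx.1 _ hx.2
  have hι : Continuous fun x : ℝ × ℝ => (x.1, x.2, τ) := by fun_prop
  have pull : ∀ {f : ℝ × ℝ × ℝ → ℝ}, ContinuousOn f b.Ωbar →
      ContinuousOn (fun x : ℝ × ℝ => f (x.1, x.2, τ)) (Icc b.r₁ b.r₂ ×ˢ Icc (-b.θ₀) b.θ₀) :=
    fun hf => hf.comp hι.continuousOn hmaps
  have cc : ContinuousOn (fun x => σ x / (b.γ * Ψ.K x)) b.Ωbar :=
    H.reg_σ.continuousOn.div (continuousOn_const.mul H.reg_K.continuousOn) fun x hx =>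
      mul_ne_zero (one_pos.trans b.one_lt_γ).ne' (H.K_ne x hx)
  have cj : ContinuousOn (fun x : ℝ × ℝ × ℝ => x.1⁻¹) b.Ωbar :=
    (contDiffOn_inv_fst (n := 0)).continuousOn
  have hθ := b.θ₀_pos
  have W0 : ∀ s ∈ Icc b.r₁ b.r₂, ∀ t ∈ Icc (-b.θ₀) b.θ₀, |t| = b.θ₀ → W (s, t, τ) = 0 :=
    fun s hs t ht h => by
      rw [H.W_eq _ (hmem s hs t ht), H.slip2 s hs _ ⟨h, abs_le.1 hτ.le⟩, zero_mul]
  set F : Fin 3 → ℝ × ℝ × ℝ → ℝ := ![Ψ.K, Ψ.U1, Ψ.U2] with hF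
  have hFr : ∀ i, ContDiffOn ℝ 2 (F i) b.Ωbar := fun i => by
    fin_cases i
    exacts [H.reg_K, H.reg_U1, H.reg_U2]
  set m : Fin 3 → Fin 3 → ℝ × ℝ × ℝ → ℝ :=
    ![![fun x => -pd b.Ωbar e3 Ψ.U3 x, fun x => -pd b.Ωbar e1 Ψ.K x,
        fun x => -(pd b.Ωbar e2 Ψ.K x * x.1⁻¹)],
      ![fun x => -(σ x / (b.γ * Ψ.K x) * pd b.Ωbar e1 Ψ.P x),
        fun x => -(pd b.Ωbar e1 Ψ.U1 x + pd b.Ωbar e3 Ψ.U3 x),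
        fun x => W x + Ψ.U2 x * x.1⁻¹ - pd b.Ωbar e2 Ψ.U1 x * x.1⁻¹],
      ![fun x => -(σ x / (b.γ * Ψ.K x) * (x.1⁻¹ * pd b.Ωbar e2 Ψ.P x)),
        fun x => -(pd b.Ωbar e1 Ψ.U2 x + W x),
        fun x => -(pd b.Ωbar e2 Ψ.U2 x * x.1⁻¹ + pd b.Ωbar e3 Ψ.U3 x + Ψ.U1 x * x.1⁻¹)]] with hm
  have hmc : ∀ i j, ContinuousOn (m i j) b.Ωbar := fun i j => by
    fin_cases i <;> fin_cases j
    exacts [(hpc _ H.reg_U3).neg, (hpc _ H.reg_K).neg, ((hpc _ H.reg_K).mul cj).neg,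
      (cc.mul (hpc _ H.reg_P)).neg, ((hpc _ H.reg_U1).add (hpc _ H.reg_U3)).neg,
      (H.reg_W.continuousOn.add (H.reg_U2.continuousOn.mul cj)).sub ((hpc _ H.reg_U1).mul cj),
      (cc.mul (cj.mul (hpc _ H.reg_P))).neg, ((hpc _ H.reg_U2).add H.reg_W.continuousOn).neg,
      ((((hpc _ H.reg_U2).mul cj).add (hpc _ H.reg_U3)).add (H.reg_U1.continuousOn.mul cj)).neg]
  have key := eq_zero_of_transport (z := fun i x => pd b.Ωbar e3 (F i) (x.1, x.2, τ))
    (zs := fun i x => pd b.Ωbar e1 (pd b.Ωbar e3 (F i)) (x.1, x.2, τ))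
    (zt := fun i x => pd b.Ωbar e2 (pd b.Ωbar e3 (F i)) (x.1, x.2, τ))
    (A := fun x => Ψ.U1 (x.1, x.2, τ)) (B := fun x => W (x.1, x.2, τ))
    (m := fun i j x => m i j (x.1, x.2, τ))
    (a := b.r₁) (b := b.r₂) (c := -b.θ₀) (d := b.θ₀)
    (pull H.reg_U1.continuousOn) (fun x hx => H.U1_pos _ (hmaps hx))
    (fun i j => pull (hmc i j)) (fun i => pull (hpc _ (hFr i)))
    (fun i t ht => by
      have := hin _ (hw t ht)
      fin_cases i
      exacts [this.1, this.2.1, this.2.2])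
    (fun i x hx => hasDerivWithinAt_slice (hpd _ (hFr i))
      (hasDerivAt_line1 (x.2, τ) x.1).hasDerivWithinAt (fun s hs => hmem s hs _ hx.2) hx.1)
    (fun i x hx => hasDerivWithinAt_slice (hpd _ (hFr i))
      (hasDerivAt_line2 x.1 τ x.2).hasDerivWithinAt (fun s hs => hmem _ hx.1 s hs) hx.2)
    (fun s hs => W0 s hs (-b.θ₀) ⟨le_rfl, by linarith⟩ (by rw [abs_neg, abs_of_pos hθ]))
    (fun s hs => W0 s hs b.θ₀ ⟨by linarith, le_rfl⟩ (abs_of_pos hθ))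
    ?_
  · have hx : (r, t₀) ∈ Icc b.r₁ b.r₂ ×ˢ Icc (-b.θ₀) b.θ₀ := ⟨hr, hy.1⟩
    exact ⟨key 1 _ hx, key 2 _ hx, P0 r hr t₀ hy.1, key 0 _ hx⟩
  rintro i ⟨s, t⟩ ⟨hs, ht⟩
  have hx := hmem s hs t ht
  have u0 := U30 s hs t ht
  have sK := H.pd_σ _ hx e3 (P0 s hs t ht)
  have p1 := tan1 (hpd _ H.reg_P) P0 s hs t ht
  have p2 := tan2 (hpd _ H.reg_P) P0 s hs t ht
  have dσ := hdf H.reg_σ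
  have dj : DifferentiableOn ℝ (fun x : ℝ × ℝ × ℝ => x.1⁻¹) b.Ωbar :=
    (contDiffOn_inv_fst (n := 1)).differentiableOn one_ne_zero
  -- The radius does not depend on x₃, so ∂₃W is ∂₃U₂ divided by r and adds no further unknown.
  have wn := pd_W H (v := e3) rfl hx
  simp only [Fin.sum_univ_three]
  fin_cases i
  · have h := pd_transport hS hcl (n := e3) (hdf H.reg_U1) (hdf H.reg_W) (hdf H.reg_U3)
      (G := fun _ => 0) (differentiableOn_const 0) H.reg_K H.entropy hx
    rw [pd_zero_of_eqOn_zero (fun _ _ => rfl) hx, u0, wn] at h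
    simp only [hF, hm, Fin.zero_eta, Fin.isValue, Matrix.cons_val]
    linear_combination h
  · have h := pd_transport (G := fun x => σ x * pd b.Ωbar e1 Ψ.P x - Ψ.U2 x * W x) hS hcl (n := e3)
      (hdf H.reg_U1) (hdf H.reg_W) (hdf H.reg_U3) ((dσ.mul (hpd e1 H.reg_P)).sub
      ((hdf H.reg_U2).mul (hdf H.reg_W))) H.reg_U1 H.momentum1 hx
    have e : pd b.Ωbar e3 (fun x => σ x * pd b.Ωbar e1 Ψ.P x - Ψ.U2 x * W x) (s, t, τ) =
        σ (s, t, τ) / (b.γ * Ψ.K (s, t, τ)) * pd b.Ωbar e3 Ψ.K (s, t, τ) *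
          pd b.Ωbar e1 Ψ.P (s, t, τ) - (pd b.Ωbar e3 Ψ.U2 (s, t, τ) * W (s, t, τ) +
          Ψ.U2 (s, t, τ) * pd b.Ωbar e3 W (s, t, τ)) := by
      rw [pd_sub (f := fun x => σ x * pd b.Ωbar e1 Ψ.P x) (g := fun x => Ψ.U2 x * W x) hS
        (dσ.mul (hpd _ H.reg_P)) ((hdf H.reg_U2).mul (hdf H.reg_W)) hx,
        pd_mul hS dσ (hpd _ H.reg_P) hx, pd_mul hS (hdf H.reg_U2) (hdf H.reg_W) hx,
        pd_comm hS hcl H.reg_P e3 e1 hx, p1, sK]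
      ring
    rw [e, u0, wn] at h
    simp only [hF, hm, Fin.mk_one, Fin.isValue, Matrix.cons_val]
    linear_combination h
  · have h := pd_transport (G := fun x => σ x * x.1⁻¹ * pd b.Ωbar e2 Ψ.P x + Ψ.U1 x * W x) hS hcl
      (n := e3) (hdf H.reg_U1) (hdf H.reg_W) (hdf H.reg_U3) (((dσ.mul dj).mul (hpd e2 H.reg_P)).add
      ((hdf H.reg_U1).mul (hdf H.reg_W))) H.reg_U2 H.momentum2 hx
    have dj0 : pd b.Ωbar e3 (fun x : ℝ × ℝ × ℝ => x.1⁻¹) (s, t, τ) = 0 := pd_inv_fst rfl hx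
    have e : pd b.Ωbar e3 (fun x => σ x * x.1⁻¹ * pd b.Ωbar e2 Ψ.P x + Ψ.U1 x * W x) (s, t, τ) =
        σ (s, t, τ) / (b.γ * Ψ.K (s, t, τ)) * pd b.Ωbar e3 Ψ.K (s, t, τ) *
          (s⁻¹ * pd b.Ωbar e2 Ψ.P (s, t, τ)) + (pd b.Ωbar e3 Ψ.U1 (s, t, τ) * W (s, t, τ) +
          Ψ.U1 (s, t, τ) * pd b.Ωbar e3 W (s, t, τ)) := by
      rw [pd_add (f := fun x => σ x * x.1⁻¹ * pd b.Ωbar e2 Ψ.P x) (g := fun x => Ψ.U1 x * W x) hS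
        ((dσ.mul dj).mul (hpd _ H.reg_P)) ((hdf H.reg_U1).mul (hdf H.reg_W)) hx,
        pd_mul (f := fun x => σ x * x.1⁻¹) hS (dσ.mul dj) (hpd _ H.reg_P) hx,
        pd_mul hS dσ dj hx, dj0, pd_mul hS (hdf H.reg_U1) (hdf H.reg_W) hx,
        pd_comm hS hcl H.reg_P e3 e2 hx, p2, sK]
      ring
    rw [e, u0, wn] at h
    simp only [hF, hm, Fin.reduceFinMk, Fin.isValue, Matrix.cons_val]
    linear_combination h

/-- Tangential derivatives on a cross-section. -/
lemma pd_crossSec {a c r θ : ℝ} (hθ : 0 < θ) (hr : r ∈ Icc a c) {f : ℝ × ℝ × ℝ → ℝ}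
    (hf : DifferentiableOn ℝ f (boxBar a c θ)) (v : ℝ × ℝ) {y : ℝ × ℝ} (hy : y ∈ crossSecBar θ) :
    pd (crossSecBar θ) v (fun y => f (r, y)) y = pd (boxBar a c θ) (0, v) f (r, y) := by
  have hu : UniqueDiffOn ℝ (crossSecBar θ) :=
    (uniqueDiffOn_Icc (by linarith)).prod (uniqueDiffOn_Icc (by norm_num))
  have hg : HasFDerivWithinAt (fun y : ℝ × ℝ => (r, y)) (ContinuousLinearMap.inr ℝ ℝ (ℝ × ℝ))
    (crossSecBar θ) y := (hasFDerivAt_prodMk_right r y).hasFDerivWithinAt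
  rw [pd_comp_affine hf hu hg (fun z hz => ⟨hr, hz⟩) hy v]
  rfl

/-- The normal derivatives of an incoming flow vanish on the walls, except for that of the normal
velocity. -/
lemma IsIncomingFlow.wall_derivatives (hd : IsInletData b α d) (h : IsIncomingFlow b α ε C₀ d Ψ)
    (hU : ∀ x ∈ b.Ωbar, 0 < Ψ.U1 x) (hP : ∀ x ∈ b.Ωbar, 0 < Ψ.P x)
    (hK : ∀ x ∈ b.Ωbar, 0 < Ψ.K x) {r : ℝ} (hr : r ∈ Icc b.r₁ b.r₂) :
    (∀ y ∈ b.edge2, b.dΩ2 Ψ.U1 (r, y) = 0 ∧ b.dΩ2 Ψ.U3 (r, y) = 0 ∧ b.dΩ2 Ψ.P (r, y) = 0 ∧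
      b.dΩ2 Ψ.K (r, y) = 0) ∧
    ∀ y ∈ b.edge3, b.dΩ3 Ψ.U1 (r, y) = 0 ∧ b.dΩ3 Ψ.U2 (r, y) = 0 ∧ b.dΩ3 Ψ.P (r, y) = 0 ∧
      b.dΩ3 Ψ.K (r, y) = 0 := by
  have H := h.isAdvection hU hP hK
  -- Directions across the section are tangential to the inlet, so there the derivatives of the flow
  -- are ε times those of the inlet data.
  have key : ∀ {f : ℝ × ℝ × ℝ → ℝ} {g : ℝ × ℝ → ℝ} (k : ℝ), ContDiffOn ℝ 2 f b.Ωbar →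
      MemHolder 2 α b.Ebar g → (∀ y ∈ b.Ebar, f (b.r₁, y) = k + ε * g y) → ∀ v, ∀ y ∈ b.Ebar,
      pd b.Ωbar (0, v) f (b.r₁, y) = ε * pd b.Ebar v g y := by
    intro f g k hf hg heq v y hy
    have hu := b.isBody_Ebar.unique
    have dg : DifferentiableOn ℝ g b.Ebar := hg.1.differentiableOn (by norm_num)
    have h1 := pd_crossSec b.θ₀_pos (left_mem_Icc.2 b.r₁_lt_r₂.le)
      (hf.differentiableOn (by norm_num)) v hy
    rw [Background.Ωbar, ← h1]
    refine (pd_congr heq hy).trans ?_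
    rw [pd_add (f := fun _ => k) (g := fun y => ε * g y) hu (differentiableOn_const k)
      (dg.const_mul ε) hy, pd_const_mul hu dg ε hy, pd, fderivWithin_fun_const]
    simp
  constructor
  · refine fun y hy => H.wall2 (fun z hz => ?_) hr hy
    have hz' := b.edge2_subset hz
    obtain ⟨-, -, z1, z3, -, zK⟩ := hd.edge2 z hz
    refine ⟨?_, ?_, ?_⟩
    · exact (key _ H.reg_K hd.reg_K (fun y hy => (h.inlet y hy).2.2.2.2) f2 z hz').trans
        (mul_eq_zero_of_right _ zK)
    · exact (key _ H.reg_U1 hd.reg_U1 (fun y hy => (h.inlet y hy).1) f2 z hz').trans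
        (mul_eq_zero_of_right _ z1)
    · exact (key 0 H.reg_U3 hd.reg_U3 (fun y hy => by rw [(h.inlet y hy).2.2.1, zero_add])
        f2 z hz').trans (mul_eq_zero_of_right _ z3)
  · refine fun y hy => H.wall3 (fun z hz => ?_) hr hy
    have hz' := b.edge3_subset hz
    obtain ⟨-, -, z1, z2, -, zK⟩ := hd.edge3 z hz
    refine ⟨?_, ?_, ?_⟩
    · exact (key _ H.reg_K hd.reg_K (fun y hy => (h.inlet y hy).2.2.2.2) f3 z hz').trans
        (mul_eq_zero_of_right _ zK)
    · exact (key _ H.reg_U1 hd.reg_U1 (fun y hy => (h.inlet y hy).1) f3 z hz').trans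
        (mul_eq_zero_of_right _ z1)
    · exact (key 0 H.reg_U2 hd.reg_U2 (fun y hy => by rw [(h.inlet y hy).2.1, zero_add])
        f3 z hz').trans (mul_eq_zero_of_right _ z2)

end Incoming

/-! ### The front error terms as functions of the point values of the data -/

/-- The upstream state and the downstream perturbation with prescribed constant values. -/
def constState (p : Fin 11 → ℝ) : State (ℝ × ℝ × ℝ) :=
  ⟨fun _ => p 6, fun _ => p 7, fun _ => p 8, fun _ => p 9, fun _ => p 10⟩

def constPert (p : Fin 11 → ℝ) : Perturbation :=
  ⟨fun _ => p 0, fun _ => p 1, fun _ => p 2, fun _ => p 3, fun _ => p 4, fun _ => p 5⟩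

/-- The point values on which the front error terms depend. -/
def frontData (b : Background) (Ψ : State (ℝ × ℝ × ℝ)) (V : Perturbation) (y : ℝ × ℝ) :
    Fin 11 → ℝ :=
  ![V.V1 (b.rs, y), V.V2 (b.rs, y), V.V3 (b.rs, y), V.V4 (b.rs, y), V.V5 (b.rs, y), V.V6 y,
    Ψ.U1 (frontPt b V y), Ψ.U2 (frontPt b V y), Ψ.U3 (frontPt b V y), Ψ.P (frontPt b V y),
    Ψ.K (frontPt b V y)]

/-- The front error terms as functions of point values. -/
noncomputable def R1val (b : Background) (p : Fin 11 → ℝ) : ℝ := R1 b (constState p) (constPert p) 0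
noncomputable def g2val (b : Background) (p : Fin 11 → ℝ) : ℝ := g2 b (constState p) (constPert p) 0
noncomputable def g3val (b : Background) (p : Fin 11 → ℝ) : ℝ := g3 b (constState p) (constPert p) 0

/-- The point values of the background. -/
noncomputable def baseData (b : Background) : Fin 11 → ℝ := ![0, 0, 0, 0, 0, 0, b.Um b.rs, 0, 0, b.Pm b.rs, b.Km]

section Data

variable (b : Background)

/-- Definitional: the error terms see the fields only through eleven numbers at each y, so constant
fields with these values reproduce them. Regularity and parity thereby become statements about
functions on ℝ¹¹. -/
lemma R1_eq (Ψ : State (ℝ × ℝ × ℝ)) (V : Perturbation) (y : ℝ × ℝ) :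
    R1 b Ψ V y = R1val b (frontData b Ψ V y) := rfl

lemma g2_eq (Ψ : State (ℝ × ℝ × ℝ)) (V : Perturbation) (y : ℝ × ℝ) :
    g2 b Ψ V y = g2val b (frontData b Ψ V y) := rfl

lemma g3_eq (Ψ : State (ℝ × ℝ × ℝ)) (V : Perturbation) (y : ℝ × ℝ) :
    g3 b Ψ V y = g3val b (frontData b Ψ V y) := rfl

/-! #### Background identities -/

namespace Background

lemma γ_pos : 0 < b.γ := one_pos.trans b.one_lt_γ

lemma Kp_pos : 0 < b.Kp := b.flow_p.K_pos

lemma Km_pos : 0 < b.Km := b.flow_m.K_pos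

lemma rs_mem_p : b.rs ∈ Icc b.rb b.r₂ := ⟨b.rb_lt_rs.le, b.rs_lt_r₂.le⟩

lemma rs_mem_m : b.rs ∈ Icc b.r₁ b.r₂ := ⟨b.r₁_lt_rs.le, b.rs_lt_r₂.le⟩

lemma ρp_rs_pos : 0 < b.ρp b.rs := b.flow_p.ρ_pos _ b.rs_mem_p

lemma Up_rs_pos : 0 < b.Up b.rs := b.flow_p.U_pos _ b.rs_mem_p

lemma cs2_sub_pos : 0 < b.cs2 - b.Up b.rs ^ 2 := sub_pos.2 (b.subsonic _ b.rs_mem_p)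

/-- Without a pressure jump, the mass and momentum conditions force equal velocities and then equal
densities; equal pressures would give equal K, against the entropy condition. -/
lemma jumpP_ne_zero : b.jumpP ≠ 0 := by
  intro h
  have hm := b.flow_m.ρ_pos _ b.rs_mem_m
  have hp := b.ρp_rs_pos
  have hu := b.Up_rs_pos
  have h1 := b.jump_mass
  have h2 := b.jump_momentum
  have h3 := b.entropy
  have hP : b.Kp * b.ρp b.rs ^ b.γ = b.Km * b.ρm b.rs ^ b.γ := sub_eq_zero.1 h
  have e1 : b.ρp b.rs * b.Up b.rs * (b.Up b.rs - b.Um b.rs) = 0 := by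
    have : b.ρp b.rs * b.Up b.rs ^ 2 = b.ρm b.rs * b.Um b.rs ^ 2 := by linarith
    linear_combination this - b.Um b.rs * h1
  have e2 : b.Up b.rs = b.Um b.rs :=
    sub_eq_zero.1 ((mul_eq_zero.1 e1).resolve_left (mul_pos hp hu).ne')
  have e3 : b.ρp b.rs = b.ρm b.rs := by
    rw [← e2] at h1
    exact mul_right_cancel₀ hu.ne' h1
  rw [← e3] at hP
  have := mul_right_cancel₀ (Real.rpow_pos_of_pos hp b.γ).ne' hP
  exact h3.ne' this

lemma enthalpy_eq : b.Bp - b.Up b.rs ^ 2 / 2 =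
    b.γ / (b.γ - 1) * b.Kp * b.ρp b.rs ^ (b.γ - 1) := by
  rw [Bp, bernQ]; ring

/-- Only the pressure jump has a sign not read off directly; it enters a₀ and a₁ as a nonzero
factor. Subsonicity behind the shock keeps the denominator of a₁ positive. -/
lemma a4_ne_zero : b.a4 ≠ 0 := by
  have h1 := b.ρp_rs_pos
  have h2 := b.Up_rs_pos
  have h3 := b.jumpP_ne_zero
  have h4 := b.cs2_sub_pos
  have h5 := b.γ_pos
  have h6 := b.rs_pos
  have h7 : 0 < b.cs2 := by nlinarith [sq_nonneg (b.Up b.rs)]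
  have h8 : 0 < b.Ms2 := by rw [Ms2]; positivity
  have h9 : 0 < b.a3 := by
    have := b.one_lt_γ
    have : 0 < b.γ - 1 := by linarith
    rw [a3]; positivity
  refine mul_ne_zero (mul_ne_zero ?_ ?_) h9.ne'
  · exact div_ne_zero (by positivity) h3
  · refine div_ne_zero (mul_ne_zero (by positivity) h3) (by positivity)

end Background

/-! #### Smoothness -/

/-- The error terms are built from arithmetic operations, real powers and the background profiles.
It suffices that at the background the bases of the powers are positive and the denominator J is
nonzero. -/
lemma contDiffAt_errors : ContDiffAt ℝ 3 (R1val b) (baseData b) ∧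
    ContDiffAt ℝ 3 (g2val b) (baseData b) ∧ ContDiffAt ℝ 3 (g3val b) (baseData b) := by
  have hγ := b.γ_pos
  have hγ1 : 0 < b.γ - 1 := by linarith [b.one_lt_γ]
  have hKp := b.Kp_pos
  have hKm := b.Km_pos
  have hρ := b.ρp_rs_pos
  have c : ∀ i, ContDiffAt ℝ 3 (fun p : Fin 11 → ℝ => p i) (baseData b) := fun i =>
    (contDiff_apply ℝ ℝ i).contDiffAt
  have hfr : b.rs + baseData b 5 = b.rs := by simp [baseData]
  have cfr : ContDiffAt ℝ 3 (fun p => front b (constPert p) 0) (baseData b) :=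
    contDiffAt_const.add (c 5)
  have hfr0 : front b (constPert (baseData b)) 0 = b.rs := hfr
  have comp : ∀ {f : ℝ → ℝ}, ContDiffAt ℝ ∞ f b.rs →
      ContDiffAt ℝ 3 (fun p => f (front b (constPert p) 0)) (baseData b) := fun {f} hf => by
    refine ContDiffAt.comp (baseData b) ?_ cfr
    rw [hfr0]
    exact hf.of_le (by norm_cast)
  -- The extension of the subsonic state ahead of the shock, to some rb < rs, makes its smoothness
  -- two-sided at rs.
  have np : Icc b.rb b.r₂ ∈ 𝓝 b.rs := Icc_mem_nhds b.rb_lt_rs b.rs_lt_r₂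
  have nm : Icc b.r₁ b.r₂ ∈ 𝓝 b.rs := Icc_mem_nhds b.r₁_lt_rs b.rs_lt_r₂
  have cUp := comp (b.flow_p.smooth_U.contDiffAt np)
  have cρp := comp (b.flow_p.smooth_ρ.contDiffAt np)
  have cUm := comp (b.flow_m.smooth_U.contDiffAt nm)
  have cρm := comp (b.flow_m.smooth_ρ.contDiffAt nm)
  have hρp0 : b.ρp (front b (constPert (baseData b)) 0) ≠ 0 := by rw [hfr0]; exact hρ.ne'
  have hρm0 : b.ρm (front b (constPert (baseData b)) 0) ≠ 0 := by
    rw [hfr0]; exact (b.flow_m.ρ_pos _ b.rs_mem_m).ne'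
  have cPp : ContDiffAt ℝ 3 (fun p => b.Pp (front b (constPert p) 0)) (baseData b) :=
    contDiffAt_const.mul (cρp.rpow_const_of_ne hρp0)
  have cPm : ContDiffAt ℝ 3 (fun p => b.Pm (front b (constPert p) 0)) (baseData b) :=
    contDiffAt_const.mul (cρm.rpow_const_of_ne hρm0)
  have cu1 : ContDiffAt ℝ 3 (fun p => u1 b (constPert p) 0) (baseData b) := cUp.add (c 0)
  have cen : ContDiffAt ℝ 3 (fun p => enth b (constPert p) 0) (baseData b) :=
    ((contDiffAt_const.add (c 4)).sub ((cu1.pow 2).div_const 2)).sub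
      ((((c 1).pow 2).add ((c 2).pow 2)).div_const 2)
  have hen : enth b (constPert (baseData b)) 0 =
      b.γ / (b.γ - 1) * b.Kp * b.ρp b.rs ^ (b.γ - 1) := by
    rw [← b.enthalpy_eq, enth, u1, hfr0]
    simp [constPert, u2, u3, baseData]
  have hen0 : 0 < enth b (constPert (baseData b)) 0 := by rw [hen]; positivity
  have hK0 : b.Kp + baseData b 3 = b.Kp := by simp [baseData]
  have hbase : 0 < (b.γ - 1) / (b.γ * (b.Kp + baseData b 3)) := by rw [hK0]; positivity
  have crT : ContDiffAt ℝ 3 (fun p => rhoT b (constPert p) 0) (baseData b) :=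
    ((contDiffAt_const.div (contDiffAt_const.mul (contDiffAt_const.add (c 3)))
      (by rw [hK0]; positivity)).rpow_const_of_ne hbase.ne').mul (cen.rpow_const_of_ne hen0.ne')
  have hrT : 0 < rhoT b (constPert (baseData b)) 0 :=
    mul_pos (Real.rpow_pos_of_pos hbase _) (Real.rpow_pos_of_pos hen0 _)
  have cpT : ContDiffAt ℝ 3 (fun p => pT b (constPert p) 0) (baseData b) :=
    (contDiffAt_const.mul ((contDiffAt_const.div (contDiffAt_const.add (c 3))
      (by rw [hK0]; positivity)).rpow_const_of_ne
        (one_div_pos.2 (show 0 < b.Kp + baseData b 3 by rw [hK0]; positivity)).ne')).mul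
      (cen.rpow_const_of_ne hen0.ne')
  -- Consistency of the Bernoulli form of the pressure with K ρ^γ at zero perturbation; needed to
  -- evaluate J.
  have hpT : pT b (constPert (baseData b)) 0 = b.Pp b.rs := by
    have e1 : pT b (constPert (baseData b)) 0 = ((b.γ - 1) / b.γ) ^ (b.γ / (b.γ - 1)) *
        (1 / b.Kp) ^ (1 / (b.γ - 1)) *
        (b.γ / (b.γ - 1) * b.Kp * b.ρp b.rs ^ (b.γ - 1)) ^ (b.γ / (b.γ - 1)) := by
      rw [pT, hen, show b.Kp + (constPert (baseData b)).V4 (b.rs, 0) = b.Kp from hK0]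
    have e2 : b.γ / (b.γ - 1) = 1 / (b.γ - 1) + 1 := by field_simp; ring
    have e3 : (b.γ - 1) / b.γ * (b.γ / (b.γ - 1) * b.Kp * b.ρp b.rs ^ (b.γ - 1)) =
        b.Kp * b.ρp b.rs ^ (b.γ - 1) := by field_simp
    have e4 : (b.ρp b.rs ^ (b.γ - 1)) ^ (b.γ / (b.γ - 1)) = b.ρp b.rs ^ b.γ := by
      rw [← Real.rpow_mul hρ.le]
      congr 1
      field_simp
    have e5 : (1 / b.Kp) ^ (1 / (b.γ - 1)) * b.Kp ^ (b.γ / (b.γ - 1)) = b.Kp := by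
      rw [e2, Real.rpow_add hKp, Real.rpow_one, ← mul_assoc,
        ← Real.mul_rpow (by positivity) hKp.le, one_div_mul_cancel hKp.ne', Real.one_rpow, one_mul]
    rw [e1, mul_right_comm, ← Real.mul_rpow (by positivity) (by positivity), e3,
      Real.mul_rpow hKp.le (by positivity), e4, Background.Pp]
    linear_combination b.ρp b.rs ^ b.γ * e5
  have hratio : 0 < baseData b 9 / baseData b 10 :=
    div_pos (mul_pos hKm (Real.rpow_pos_of_pos (b.flow_m.ρ_pos _ b.rs_mem_m) _)) hKm
  have crM : ContDiffAt ℝ 3 (fun p => rhoM b (constState p) (constPert p) 0) (baseData b) :=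
    ((c 9).div (c 10) (show baseData b 10 ≠ 0 from hKm.ne')).rpow_const_of_ne hratio.ne'
  have hrM : 0 < rhoM b (constState (baseData b)) (constPert (baseData b)) 0 :=
    Real.rpow_pos_of_pos hratio _
  have c2 : ContDiffAt ℝ 3 (fun p => j2 b (constState p) (constPert p) 0) (baseData b) :=
    (crT.mul (c 1)).sub (crM.mul (c 7))
  have c3 : ContDiffAt ℝ 3 (fun p => j3 b (constState p) (constPert p) 0) (baseData b) :=
    (crT.mul (c 2)).sub (crM.mul (c 8))
  have c12 : ContDiffAt ℝ 3 (fun p => j12 b (constState p) (constPert p) 0) (baseData b) :=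
    ((crT.mul cu1).mul (c 1)).sub ((crM.mul (c 6)).mul (c 7))
  have c13 : ContDiffAt ℝ 3 (fun p => j13 b (constState p) (constPert p) 0) (baseData b) :=
    ((crT.mul cu1).mul (c 2)).sub ((crM.mul (c 6)).mul (c 8))
  have c23 : ContDiffAt ℝ 3 (fun p => j23 b (constState p) (constPert p) 0) (baseData b) :=
    ((crT.mul (c 1)).mul (c 2)).sub ((crM.mul (c 7)).mul (c 8))
  have c22 : ContDiffAt ℝ 3 (fun p => j22 b (constState p) (constPert p) 0) (baseData b) :=
    ((crT.mul ((c 1).pow 2)).add cpT).sub ((crM.mul ((c 7).pow 2)).add (c 9))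
  have c33 : ContDiffAt ℝ 3 (fun p => j33 b (constState p) (constPert p) 0) (baseData b) :=
    ((crT.mul ((c 2).pow 2)).add cpT).sub ((crM.mul ((c 8).pow 2)).add (c 9))
  have cJ : ContDiffAt ℝ 3 (fun p => J b (constState p) (constPert p) 0) (baseData b) :=
    (c22.mul c33).sub (c23.pow 2)
  have cJ2 : ContDiffAt ℝ 3 (fun p => J2 b (constState p) (constPert p) 0) (baseData b) :=
    (c33.mul c12).sub (c13.mul c23)
  have cJ3 : ContDiffAt ℝ 3 (fun p => J3 b (constState p) (constPert p) 0) (baseData b) :=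
    (c22.mul c13).sub (c12.mul c23)
  -- With zero tangential velocities J reduces to the square of the pressure jump.
  have hJ : J b (constState (baseData b)) (constPert (baseData b)) 0 ≠ 0 := by
    have : J b (constState (baseData b)) (constPert (baseData b)) 0 = b.jumpP ^ 2 := by
      rw [J, j22, j33, j23, hpT]
      simp [u2, u3, w2, w3, pM, constPert, constState, baseData,
        Background.jumpP, pow_two]
    rw [this]
    exact pow_ne_zero 2 b.jumpP_ne_zero
  have cdot : ContDiffAt ℝ 3 (fun p => rhoDot b (constPert p) 0) (baseData b) := crT.sub cρp
  have cbern : ContDiffAt ℝ 3 (fun p => (constState p).bern b.γ (frontPt b (constPert p) 0))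
      (baseData b) :=
    (((((c 6).pow 2).add ((c 7).pow 2)).add ((c 8).pow 2)).div_const 2).add
      ((contDiffAt_const.mul (c 10)).mul (crM.rpow_const_of_ne hrM.ne'))
  have cR01 : ContDiffAt ℝ 3 (fun p => R01 b (constState p) (constPert p) 0) (baseData b) :=
    (((((((cρp.mul cUp).sub (cρm.mul cUm)).neg).add (crM.mul (c 6))).sub (cρm.mul cUm)).sub
      ((((c 0).add cUp).sub contDiffAt_const).mul cdot)).add
      (((c2.mul cJ2).add (c3.mul cJ3)).div cJ hJ)).sub ((cρp.sub contDiffAt_const).mul (c 0))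
  have cR02 : ContDiffAt ℝ 3 (fun p => R02 b (constState p) (constPert p) 0) (baseData b) :=
    ((((((((cρp.mul (cUp.pow 2)).add cPp).sub ((cρm.mul (cUm.pow 2)).add cPm)).sub
      (contDiffAt_const.mul (c 5))).neg).add ((crM.mul ((c 6).pow 2)).add (c 9))).sub
      ((cρm.mul (cUm.pow 2)).add cPm)).sub
      ((((((crT.mul (cu1.pow 2)).add cpT).sub ((cρp.mul (cUp.pow 2)).add cPp)).sub
        (contDiffAt_const.mul (c 0))).sub (contDiffAt_const.mul cdot)).sub
        (contDiffAt_const.mul (c 3)))).add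
      (((c12.mul cJ2).add (c13.mul cJ3)).div cJ hJ)
  have cR03 : ContDiffAt ℝ 3 (fun p => R03 b (constState p) (constPert p) 0) (baseData b) :=
    ((((((cbern.sub contDiffAt_const).sub (cUp.mul (c 0))).sub
      (((((c 0).pow 2).add ((c 1).pow 2)).add ((c 2).pow 2)).div_const 2)).add
      (contDiffAt_const.mul (c 0))).sub
      (contDiffAt_const.mul (((contDiffAt_const.add (c 3)).mul (crT.rpow_const_of_ne hrT.ne')).sub
        (contDiffAt_const.mul (cρp.rpow_const_of_ne hρp0))))).add
      (contDiffAt_const.mul cdot)).add (contDiffAt_const.mul (c 3))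
  exact ⟨((contDiffAt_const.mul cR01).add (contDiffAt_const.mul cR02)).add
      (contDiffAt_const.mul cR03),
    contDiffAt_const.mul (((cfr.mul cJ2).div cJ hJ).sub (contDiffAt_const.mul (c 1))),
    (cJ3.div cJ hJ).sub (contDiffAt_const.mul (c 2))⟩

/-- Being C³ at a point is an open condition. A closed ball is taken because it is a convex compact
body, on which the composition results apply. -/
lemma exists_closedBall_contDiffAt_errors : ∃ η > 0, ∀ p ∈ Metric.closedBall (baseData b) η,
    ContDiffAt ℝ 3 (R1val b) p ∧ ContDiffAt ℝ 3 (g2val b) p ∧ ContDiffAt ℝ 3 (g3val b) p := by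
  obtain ⟨h1, h2, h3⟩ := contDiffAt_errors b
  obtain ⟨η, hη, h⟩ := Metric.nhds_basis_closedBall.eventually_iff.1 ((h1.eventually (by simp)).and
    ((h2.eventually (by simp)).and (h3.eventually (by simp))))
  exact ⟨η, hη, fun p hp => h hp⟩

/-! #### Parity -/

/-- Reversal of the sign of two coordinates. -/
def flip (i j : Fin 11) (p : Fin 11 → ℝ) : Fin 11 → ℝ := fun k => if k = i ∨ k = j then -p k else p k

lemma flip_eq_self {i j : Fin 11} {p : Fin 11 → ℝ} (hi : p i = 0) (hj : p j = 0) :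
    flip i j p = p := by
  ext k
  rw [flip]
  split_ifs with h
  · rcases h with rfl | rfl
    · rw [hi, neg_zero]
    · rw [hj, neg_zero]
  · rfl

/-- An even function of data whose even part is stationary in a direction is stationary in that
direction. -/
lemma pd_comp_eq_zero_of_flip {X : Type*} [NormedAddCommGroup X] [NormedSpace ℝ X] {S : Set X}
    {R : (Fin 11 → ℝ) → ℝ} {u : X → Fin 11 → ℝ} {y v : X} {i j : Fin 11}
    (hS : UniqueDiffWithinAt ℝ S y) (hR : DifferentiableAt ℝ R (u y))
    (hflip : ∀ p, R (flip i j p) = R p) (hu : DifferentiableWithinAt ℝ u S y)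
    (hi : u y i = 0) (hj : u y j = 0)
    (hk : ∀ k, k ≠ i → k ≠ j → pd S v (fun z => u z k) y = 0) :
    pd S v (fun z => R (u z)) y = 0 := by
  set A : (Fin 11 → ℝ) →L[ℝ] (Fin 11 → ℝ) := ContinuousLinearMap.pi fun k =>
    if k = i ∨ k = j then -ContinuousLinearMap.proj k else ContinuousLinearMap.proj k with hA
  have hAf : ∀ p, A p = flip i j p := fun p => by
    ext k
    simp only [hA, ContinuousLinearMap.pi_apply, flip]
    split_ifs <;> simp
  have hfix : A (u y) = u y := by rw [hAf, flip_eq_self hi hj]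
  -- Invariance of R under the reflection A is differentiated at a fixed point of A.
  have hsym : fderiv ℝ R (u y) = (fderiv ℝ R (u y)).comp A := by
    have h1 : HasFDerivAt R (fderiv ℝ R (u y)) (A (u y)) := by rw [hfix]; exact hR.hasFDerivAt
    have h2 : HasFDerivAt (fun p => R (A p)) ((fderiv ℝ R (u y)).comp A) (u y) :=
      h1.comp (u y) A.hasFDerivAt
    have h3 : (fun p => R (A p)) = R := funext fun p => by rw [hAf, hflip]
    rw [h3] at h2
    exact h2.fderiv
  -- Only the two reflected components of the data vary in the direction v, so A reverses this
  -- vector; an A-invariant functional then vanishes on it.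
  have hw : A (fderivWithin ℝ u S y v) = -fderivWithin ℝ u S y v := by
    rw [hAf]
    ext k
    rw [flip]
    split_ifs with h
    · rfl
    · push Not at h
      have h1 := hk k h.1 h.2
      have h2 : HasFDerivWithinAt (fun z => u z k)
          ((ContinuousLinearMap.proj k).comp (fderivWithin ℝ u S y)) S y :=
        hasFDerivWithinAt_pi'.1 hu.hasFDerivWithinAt k
      rw [pd, h2.fderivWithin hS] at h1
      have h3 : fderivWithin ℝ u S y v k = 0 := h1
      rw [Pi.neg_apply, h3, neg_zero]
  have hc : HasFDerivWithinAt (fun z => R (u z)) ((fderiv ℝ R (u y)).comp (fderivWithin ℝ u S y))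
      S y := hR.hasFDerivAt.comp_hasFDerivWithinAt y hu.hasFDerivWithinAt
  rw [pd, hc.fderivWithin hS]
  have h := congrArg (fun L : (Fin 11 → ℝ) →L[ℝ] ℝ => L (fderivWithin ℝ u S y v)) hsym
  simp only [ContinuousLinearMap.comp_apply, hw, map_neg] at h
  rw [ContinuousLinearMap.comp_apply]
  linarith

/-- Indices 1 and 7 are the downstream and upstream angular velocities. Jumps containing an odd
number of factors U₂ change sign, hence so does J₂, while J and J₃ do not; in R₁ the odd quantities
occur only in pairs or squared. -/
lemma errors_flip_angular (p : Fin 11 → ℝ) : R1val b (flip 1 7 p) = R1val b p ∧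
    g2val b (flip 1 7 p) = -g2val b p := by
  set q := flip 1 7 p
  have q7 : q 7 = -p 7 := rfl
  have hf : front b (constPert q) 0 = front b (constPert p) 0 := rfl
  have h1 : u1 b (constPert q) 0 = u1 b (constPert p) 0 := rfl
  have h2 : u2 b (constPert q) 0 = -u2 b (constPert p) 0 := rfl
  have h3 : u3 b (constPert q) 0 = u3 b (constPert p) 0 := rfl
  have he : enth b (constPert q) 0 = enth b (constPert p) 0 := by
    rw [enth, enth, h1, h2, h3, neg_sq]; rfl
  have hr : rhoT b (constPert q) 0 = rhoT b (constPert p) 0 := by rw [rhoT, rhoT, he]; rfl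
  have hp : pT b (constPert q) 0 = pT b (constPert p) 0 := by rw [pT, pT, he]; rfl
  have k1 : w1 b (constState q) (constPert q) 0 = w1 b (constState p) (constPert p) 0 := rfl
  have k2 : w2 b (constState q) (constPert q) 0 = -w2 b (constState p) (constPert p) 0 := rfl
  have k3 : w3 b (constState q) (constPert q) 0 = w3 b (constState p) (constPert p) 0 := rfl
  have kr : rhoM b (constState q) (constPert q) 0 = rhoM b (constState p) (constPert p) 0 := rfl
  have kp : pM b (constState q) (constPert q) 0 = pM b (constState p) (constPert p) 0 := rfl
  have l2 : j2 b (constState q) (constPert q) 0 = -j2 b (constState p) (constPert p) 0 := by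
    rw [j2, j2, hr, h2, kr, k2]; ring
  have l3 : j3 b (constState q) (constPert q) 0 = j3 b (constState p) (constPert p) 0 := by
    rw [j3, j3, hr, h3, kr, k3]
  have l12 : j12 b (constState q) (constPert q) 0 = -j12 b (constState p) (constPert p) 0 := by
    rw [j12, j12, hr, h1, h2, kr, k1, k2]; ring
  have l13 : j13 b (constState q) (constPert q) 0 = j13 b (constState p) (constPert p) 0 := by
    rw [j13, j13, hr, h1, h3, kr, k1, k3]
  have l23 : j23 b (constState q) (constPert q) 0 = -j23 b (constState p) (constPert p) 0 := by
    rw [j23, j23, hr, h2, h3, kr, k2, k3]; ring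
  have l22 : j22 b (constState q) (constPert q) 0 = j22 b (constState p) (constPert p) 0 := by
    rw [j22, j22, hr, h2, hp, kr, k2, kp]; ring
  have l33 : j33 b (constState q) (constPert q) 0 = j33 b (constState p) (constPert p) 0 := by
    rw [j33, j33, hr, h3, hp, kr, k3, kp]
  have lJ : J b (constState q) (constPert q) 0 = J b (constState p) (constPert p) 0 := by
    rw [J, J, l22, l33, l23]; ring
  have lJ2 : J2 b (constState q) (constPert q) 0 = -J2 b (constState p) (constPert p) 0 := by
    rw [J2, J2, l33, l12, l13, l23]; ring
  have lJ3 : J3 b (constState q) (constPert q) 0 = J3 b (constState p) (constPert p) 0 := by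
    rw [J3, J3, l22, l13, l12, l23]; ring
  have hd : rhoDot b (constPert q) 0 = rhoDot b (constPert p) 0 := by rw [rhoDot, rhoDot, hr, hf]
  have hb : (constState q).bern b.γ (frontPt b (constPert q) 0) =
      (constState p).bern b.γ (frontPt b (constPert p) 0) := by
    simp only [State.bern, State.rho, constState, q7, neg_sq]; rfl
  have v1 : (constPert q).V1 (b.rs, 0) = (constPert p).V1 (b.rs, 0) := rfl
  have v2 : (constPert q).V2 (b.rs, 0) = -(constPert p).V2 (b.rs, 0) := rfl
  have v3 : (constPert q).V3 (b.rs, 0) = (constPert p).V3 (b.rs, 0) := rfl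
  have v4 : (constPert q).V4 (b.rs, 0) = (constPert p).V4 (b.rs, 0) := rfl
  have v6 : (constPert q).V6 0 = (constPert p).V6 0 := rfl
  constructor
  · rw [R1val, R1val, R1, R1]
    congr 1
    · congr 1
      · rw [R01, R01, hf, kr, k1, v1, hd, l2, lJ2, l3, lJ3, lJ, neg_mul_neg]
      · rw [R02, R02, hf, v6, kr, k1, kp, hr, h1, hp, v1, hd, v4, l12, lJ2, l13, lJ3, lJ,
          neg_mul_neg]
    · rw [R03, R03, hb, hf, v1, v2, v3, v4, hr, hd, neg_sq]
  · rw [g2val, g2val, g2, g2, hf, lJ2, lJ, v2]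
    ring

lemma errors_flip_axial (p : Fin 11 → ℝ) : R1val b (flip 2 8 p) = R1val b p ∧
    g3val b (flip 2 8 p) = -g3val b p := by
  set q := flip 2 8 p
  have q8 : q 8 = -p 8 := rfl
  have hf : front b (constPert q) 0 = front b (constPert p) 0 := rfl
  have h1 : u1 b (constPert q) 0 = u1 b (constPert p) 0 := rfl
  have h2 : u2 b (constPert q) 0 = u2 b (constPert p) 0 := rfl
  have h3 : u3 b (constPert q) 0 = -u3 b (constPert p) 0 := rfl
  have he : enth b (constPert q) 0 = enth b (constPert p) 0 := by
    rw [enth, enth, h1, h2, h3, neg_sq]; rfl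
  have hr : rhoT b (constPert q) 0 = rhoT b (constPert p) 0 := by rw [rhoT, rhoT, he]; rfl
  have hp : pT b (constPert q) 0 = pT b (constPert p) 0 := by rw [pT, pT, he]; rfl
  have k1 : w1 b (constState q) (constPert q) 0 = w1 b (constState p) (constPert p) 0 := rfl
  have k2 : w2 b (constState q) (constPert q) 0 = w2 b (constState p) (constPert p) 0 := rfl
  have k3 : w3 b (constState q) (constPert q) 0 = -w3 b (constState p) (constPert p) 0 := rfl
  have kr : rhoM b (constState q) (constPert q) 0 = rhoM b (constState p) (constPert p) 0 := rfl
  have kp : pM b (constState q) (constPert q) 0 = pM b (constState p) (constPert p) 0 := rfl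
  have l2 : j2 b (constState q) (constPert q) 0 = j2 b (constState p) (constPert p) 0 := by
    rw [j2, j2, hr, h2, kr, k2]
  have l3 : j3 b (constState q) (constPert q) 0 = -j3 b (constState p) (constPert p) 0 := by
    rw [j3, j3, hr, h3, kr, k3]; ring
  have l12 : j12 b (constState q) (constPert q) 0 = j12 b (constState p) (constPert p) 0 := by
    rw [j12, j12, hr, h1, h2, kr, k1, k2]
  have l13 : j13 b (constState q) (constPert q) 0 = -j13 b (constState p) (constPert p) 0 := by
    rw [j13, j13, hr, h1, h3, kr, k1, k3]; ring
  have l23 : j23 b (constState q) (constPert q) 0 = -j23 b (constState p) (constPert p) 0 := by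
    rw [j23, j23, hr, h2, h3, kr, k2, k3]; ring
  have l22 : j22 b (constState q) (constPert q) 0 = j22 b (constState p) (constPert p) 0 := by
    rw [j22, j22, hr, h2, hp, kr, k2, kp]
  have l33 : j33 b (constState q) (constPert q) 0 = j33 b (constState p) (constPert p) 0 := by
    rw [j33, j33, hr, h3, hp, kr, k3, kp]; ring
  have lJ : J b (constState q) (constPert q) 0 = J b (constState p) (constPert p) 0 := by
    rw [J, J, l22, l33, l23]; ring
  have lJ2 : J2 b (constState q) (constPert q) 0 = J2 b (constState p) (constPert p) 0 := by
    rw [J2, J2, l33, l12, l13, l23]; ring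
  have lJ3 : J3 b (constState q) (constPert q) 0 = -J3 b (constState p) (constPert p) 0 := by
    rw [J3, J3, l22, l13, l12, l23]; ring
  have hd : rhoDot b (constPert q) 0 = rhoDot b (constPert p) 0 := by rw [rhoDot, rhoDot, hr, hf]
  have hb : (constState q).bern b.γ (frontPt b (constPert q) 0) =
      (constState p).bern b.γ (frontPt b (constPert p) 0) := by
    simp only [State.bern, State.rho, constState, q8, neg_sq]; rfl
  have v1 : (constPert q).V1 (b.rs, 0) = (constPert p).V1 (b.rs, 0) := rfl
  have v2 : (constPert q).V2 (b.rs, 0) = (constPert p).V2 (b.rs, 0) := rfl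
  have v3 : (constPert q).V3 (b.rs, 0) = -(constPert p).V3 (b.rs, 0) := rfl
  have v4 : (constPert q).V4 (b.rs, 0) = (constPert p).V4 (b.rs, 0) := rfl
  have v6 : (constPert q).V6 0 = (constPert p).V6 0 := rfl
  constructor
  · rw [R1val, R1val, R1, R1]
    congr 1
    · congr 1
      · rw [R01, R01, hf, kr, k1, v1, hd, l2, lJ2, l3, lJ3, lJ, neg_mul_neg]
      · rw [R02, R02, hf, v6, kr, k1, kp, hr, h1, hp, v1, hd, v4, l12, lJ2, l13, lJ3, lJ,
          neg_mul_neg]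
    · rw [R03, R03, hb, hf, v1, v2, v3, v4, hr, hd, neg_sq]
  · rw [g3val, g3val, g3, g3, lJ3, lJ, v3]
    ring

end Data

/-! ### Regularity, smallness and edge conditions of the front data -/

section FrontData

variable {b : Background} {α ε C₀ δ : ℝ} {d : State (ℝ × ℝ)} {Ψ : State (ℝ × ℝ × ℝ)}
  {V : Perturbation}

lemma IsIncomingFlow.abs_sub_le (h : IsIncomingFlow b α ε C₀ d Ψ) (hε : 0 ≤ C₀ * ε)
    {x : ℝ × ℝ × ℝ} (hx : x ∈ b.Ωbar) : |Ψ.U1 x - b.Um x.1| ≤ C₀ * ε ∧ |Ψ.U2 x| ≤ C₀ * ε ∧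
      |Ψ.U3 x| ≤ C₀ * ε ∧ |Ψ.P x - b.Pm x.1| ≤ C₀ * ε ∧ |Ψ.K x - b.Km| ≤ C₀ * ε := by
  have hc := h.close
  have c4 := le_self_add.trans hc
  have c3 := le_self_add.trans c4
  have c2 := le_self_add.trans c3
  exact ⟨abs_le_of_holderNorm_le hε (le_self_add.trans c2) hx,
    abs_le_of_holderNorm_le hε (le_add_self.trans c2) hx,
    abs_le_of_holderNorm_le hε (le_add_self.trans c3) hx,
    abs_le_of_holderNorm_le hε (le_add_self.trans c4) hx,
    abs_le_of_holderNorm_le hε (le_add_self.trans hc) hx⟩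

lemma MemX.abs_le (h : MemX b α δ V) (hδ : 0 ≤ δ) {y : ℝ × ℝ} (hy : y ∈ b.Ebar) :
    |V.V1 (b.rs, y)| ≤ δ ∧ |V.V2 (b.rs, y)| ≤ δ ∧ |V.V3 (b.rs, y)| ≤ δ ∧ |V.V4 (b.rs, y)| ≤ δ ∧
      |V.V5 (b.rs, y)| ≤ δ ∧ |V.V6 y| ≤ δ := by
  have hx : (b.rs, y) ∈ b.Dbar := ⟨left_mem_Icc.2 b.rs_lt_r₂.le, hy⟩
  have c6 := h.small
  have c5 := le_self_add.trans c6
  have c4 := le_self_add.trans c5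
  have c3 := le_self_add.trans c4
  have c2 := le_self_add.trans c3
  exact ⟨abs_le_of_holderNorm_le hδ (le_self_add.trans c2) hx,
    abs_le_of_holderNorm_le hδ (le_add_self.trans c2) hx,
    abs_le_of_holderNorm_le hδ (le_add_self.trans c3) hx,
    abs_le_of_holderNorm_le hδ (le_add_self.trans c4) hx,
    abs_le_of_holderNorm_le hδ (le_add_self.trans c5) hx,
    abs_le_of_holderNorm_le hδ (le_add_self.trans c6) hy⟩

/-- The wall conditions are imposed on relatively open faces; continuity carries them to the edge on
the front r = rs, corners included. -/
lemma eq_zero_on_edge2 {f : ℝ × ℝ × ℝ → ℝ} (hf : ContinuousOn f b.Dbar)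
    (h0 : ∀ y ∈ b.wall2, f y = 0) {y : ℝ × ℝ} (hy : y ∈ b.edge2) : f (b.rs, y) = 0 := by
  have hsub : Icc b.rs b.r₂ ×ˢ ({y.1} ×ˢ Icc (-1 : ℝ) 1) ⊆ b.Dbar := by
    rintro ⟨r, z₁, z₂⟩ ⟨hr, hz, hz2⟩
    rw [mem_singleton_iff] at hz
    simp only at hz
    exact ⟨hr, by rw [hz]; exact (b.edge2_subset hy).1, hz2⟩
  refine (show EqOn f (fun _ => 0) (Ioo b.rs b.r₂ ×ˢ ({y.1} ×ˢ Ioo (-1 : ℝ) 1)) from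
    fun z hz => h0 z ⟨hz.1, ?_, hz.2.2⟩).of_subset_closure (hf.mono hsub) continuousOn_const
    (prod_mono Ioo_subset_Icc_self (prod_mono subset_rfl Ioo_subset_Icc_self)) ?_
    (show (b.rs, y) ∈ _ from ⟨left_mem_Icc.2 b.rs_lt_r₂.le, rfl, hy.2⟩)
  · rw [show z.2.1 = y.1 from hz.2.1]
    exact hy.1
  · rw [closure_prod_eq, closure_prod_eq, closure_Ioo b.rs_lt_r₂.ne, closure_Ioo (by norm_num),
      closure_singleton]

lemma eq_zero_on_edge3 {f : ℝ × ℝ × ℝ → ℝ} (hf : ContinuousOn f b.Dbar)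
    (h0 : ∀ y ∈ b.wall3, f y = 0) {y : ℝ × ℝ} (hy : y ∈ b.edge3) : f (b.rs, y) = 0 := by
  have hsub : Icc b.rs b.r₂ ×ˢ (Icc (-b.θ₀) b.θ₀ ×ˢ {y.2}) ⊆ b.Dbar := by
    rintro ⟨r, z₁, z₂⟩ ⟨hr, hz, hz2⟩
    rw [mem_singleton_iff] at hz2
    simp only at hz2
    exact ⟨hr, hz, by rw [hz2]; exact (b.edge3_subset hy).2⟩
  have hθ := b.θ₀_pos
  refine (show EqOn f (fun _ => 0) (Ioo b.rs b.r₂ ×ˢ (Ioo (-b.θ₀) b.θ₀ ×ˢ {y.2})) from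
    fun z hz => h0 z ⟨hz.1, hz.2.1, ?_⟩).of_subset_closure (hf.mono hsub) continuousOn_const
    (prod_mono Ioo_subset_Icc_self (prod_mono Ioo_subset_Icc_self subset_rfl)) ?_
    (show (b.rs, y) ∈ _ from ⟨left_mem_Icc.2 b.rs_lt_r₂.le, hy.1, rfl⟩)
  · rw [show z.2.2 = y.2 from hz.2.2]
    exact hy.2
  · rw [closure_prod_eq, closure_prod_eq, closure_Ioo b.rs_lt_r₂.ne, closure_Ioo (by linarith),
      closure_singleton]

lemma IsC2H.slice (hα0 : 0 < α) (hα1 : α < 1) {f : ℝ × ℝ × ℝ → ℝ} (hf : MemHolder 2 α b.Dbar f) :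
    IsC2H α b.Ebar (fun y => f (b.rs, y)) :=
  (hf.isC2H b.isBody_Dbar hα0.le).comp (g := fun y : ℝ × ℝ => (b.rs, y)) hα0 hα1.le b.isBody_Ebar
    b.isBody_Dbar (isC2H_of_contDiffOn_three b.isBody_Ebar hα1.le
      (contDiffOn_const.prodMk contDiffOn_id)) fun _ hy => ⟨left_mem_Icc.2 b.rs_lt_r₂.le, hy⟩

lemma pd_slice {f : ℝ × ℝ × ℝ → ℝ} (hf : ContDiffOn ℝ 2 f b.Dbar) (v : ℝ × ℝ) {y : ℝ × ℝ}
    (hy : y ∈ b.Ebar) : pd b.Ebar v (fun y => f (b.rs, y)) y = pd b.Dbar (0, v) f (b.rs, y) :=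
  pd_crossSec b.θ₀_pos (left_mem_Icc.2 b.rs_lt_r₂.le) (hf.differentiableOn (by norm_num)) v hy

/-- The derivative of an upstream quantity along the front, in a direction in which the front is
stationary. -/
lemma pd_front {f : ℝ × ℝ × ℝ → ℝ} (hf : DifferentiableOn ℝ f b.Ωbar)
    (hV : ContDiffOn ℝ 3 V.V6 b.Ebar) (hm : MapsTo (frontPt b V) b.Ebar b.Ωbar) {v y : ℝ × ℝ}
    (hy : y ∈ b.Ebar) (h0 : pd b.Ebar v V.V6 y = 0) :
    pd b.Ebar v (fun y => f (frontPt b V y)) y = pd b.Ωbar (0, v) f (frontPt b V y) := by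
  have hg : HasFDerivWithinAt (frontPt b V)
      ((fderivWithin ℝ V.V6 b.Ebar y).prod (ContinuousLinearMap.id ℝ (ℝ × ℝ))) b.Ebar y :=
    (((hV.differentiableOn (by norm_num)) y hy).hasFDerivWithinAt.const_add b.rs).prodMk
      (hasFDerivWithinAt_id y _)
  rw [pd_comp_affine hf b.isBody_Ebar.unique hg hm hy v]
  have : fderivWithin ℝ V.V6 b.Ebar y v = 0 := h0
  rw [ContinuousLinearMap.prod_apply, this]
  rfl

/-- The C³ regularity of V₆ makes the front a C^{2,α} map, so upstream traces on the moving front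
lose nothing. -/
lemma isC2H_frontData (hα0 : 0 < α) (hα1 : α < 1) (hΨ : IsIncomingFlow b α ε C₀ d Ψ)
    (hV : MemX b α δ V) (hm : MapsTo (frontPt b V) b.Ebar b.Ωbar) :
    IsC2H α b.Ebar (frontData b Ψ V) := by
  have h6 : ContDiffOn ℝ 3 V.V6 b.Ebar := by exact_mod_cast hV.reg6.1
  have hfr : IsC2H α b.Ebar (frontPt b V) :=
    isC2H_of_contDiffOn_three b.isBody_Ebar hα1.le
      ((contDiffOn_const.add h6).prodMk contDiffOn_id)
  have up : ∀ {f : ℝ × ℝ × ℝ → ℝ}, MemHolder 2 α b.Ωbar f →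
      IsC2H α b.Ebar (fun y => f (frontPt b V y)) := fun hf =>
    (hf.isC2H b.isBody_Ωbar hα0.le).comp hα0 hα1.le b.isBody_Ebar b.isBody_Ωbar hfr hm
  refine IsC2H.pi b.isBody_Ebar fun i => ?_
  fin_cases i
  exacts [IsC2H.slice hα0 hα1 hV.reg1, IsC2H.slice hα0 hα1 hV.reg2, IsC2H.slice hα0 hα1 hV.reg3,
    IsC2H.slice hα0 hα1 hV.reg4, IsC2H.slice hα0 hα1 hV.reg5,
    isC2H_of_contDiffOn_three b.isBody_Ebar hα1.le h6, up hΨ.reg_U1, up hΨ.reg_U2, up hΨ.reg_U3,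
    up hΨ.reg_P, up hΨ.reg_K]

/-- These are the hypotheses of the parity argument. For upstream values ∂₂V₆ = 0 removes the radial
part of the derivative along the front, and the wall derivatives of the incoming flow remove the
rest. -/
lemma frontData_edge2 (hd : IsInletData b α d) (hΨ : IsIncomingFlow b α ε C₀ d Ψ)
    (hV : MemX b α δ V) (hm : MapsTo (frontPt b V) b.Ebar b.Ωbar)
    (hU : ∀ x ∈ b.Ωbar, 0 < Ψ.U1 x) (hP : ∀ x ∈ b.Ωbar, 0 < Ψ.P x)
    (hK : ∀ x ∈ b.Ωbar, 0 < Ψ.K x) {y : ℝ × ℝ} (hy : y ∈ b.edge2) :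
    frontData b Ψ V y 1 = 0 ∧ frontData b Ψ V y 7 = 0 ∧
      ∀ k, k ≠ 1 → k ≠ 7 → pd b.Ebar f2 (fun z => frontData b Ψ V z k) y = 0 := by
  have hy' := b.edge2_subset hy
  have hr : front b V y ∈ Icc b.r₁ b.r₂ := (hm hy').1
  have h6 : ContDiffOn ℝ 3 V.V6 b.Ebar := by exact_mod_cast hV.reg6.1
  have h60 : pd b.Ebar f2 V.V6 y = 0 := (hV.edge2 y hy).1
  obtain ⟨w1, w3, wP, wK⟩ := (hΨ.wall_derivatives hd hU hP hK hr).1 y hy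
  have dn : ∀ {f : ℝ × ℝ × ℝ → ℝ}, MemHolder 2 α b.Dbar f → (∀ y ∈ b.wall2, b.dD2 f y = 0) →
      pd b.Ebar f2 (fun y => f (b.rs, y)) y = 0 := fun hf h0 =>
    (pd_slice hf.1 f2 hy').trans (eq_zero_on_edge2
      (contDiffOn_pd (m := 1) b.isBody_Dbar.unique hf.1 (by norm_num) e2).continuousOn h0 hy)
  have up : ∀ {f : ℝ × ℝ × ℝ → ℝ}, MemHolder 2 α b.Ωbar f → b.dΩ2 f (front b V y, y) = 0 →
      pd b.Ebar f2 (fun y => f (frontPt b V y)) y = 0 := fun hf h0 =>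
    (pd_front (hf.1.differentiableOn (by norm_num)) h6 hm hy' h60).trans h0
  refine ⟨eq_zero_on_edge2 hV.reg2.1.continuousOn (fun z hz => (hV.wall2 z hz).1) hy,
    hΨ.slip2 _ hr y hy, fun k h1 h7 => ?_⟩
  fin_cases k
  exacts [dn hV.reg1 fun z hz => (hV.wall2 z hz).2.2.1, absurd rfl h1,
    dn hV.reg3 fun z hz => (hV.wall2 z hz).2.2.2.1,
    dn hV.reg4 fun z hz => (hV.wall2 z hz).2.2.2.2.1,
    dn hV.reg5 fun z hz => (hV.wall2 z hz).2.2.2.2.2, h60, up hΨ.reg_U1 w1, absurd rfl h7,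
    up hΨ.reg_U3 w3, up hΨ.reg_P wP, up hΨ.reg_K wK]

lemma frontData_edge3 (hd : IsInletData b α d) (hΨ : IsIncomingFlow b α ε C₀ d Ψ)
    (hV : MemX b α δ V) (hm : MapsTo (frontPt b V) b.Ebar b.Ωbar)
    (hU : ∀ x ∈ b.Ωbar, 0 < Ψ.U1 x) (hP : ∀ x ∈ b.Ωbar, 0 < Ψ.P x)
    (hK : ∀ x ∈ b.Ωbar, 0 < Ψ.K x) {y : ℝ × ℝ} (hy : y ∈ b.edge3) :
    frontData b Ψ V y 2 = 0 ∧ frontData b Ψ V y 8 = 0 ∧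
      ∀ k, k ≠ 2 → k ≠ 8 → pd b.Ebar f3 (fun z => frontData b Ψ V z k) y = 0 := by
  have hy' := b.edge3_subset hy
  have hr : front b V y ∈ Icc b.r₁ b.r₂ := (hm hy').1
  have h6 : ContDiffOn ℝ 3 V.V6 b.Ebar := by exact_mod_cast hV.reg6.1
  have h60 : pd b.Ebar f3 V.V6 y = 0 := (hV.edge3 y hy).1
  obtain ⟨w1, w2, wP, wK⟩ := (hΨ.wall_derivatives hd hU hP hK hr).2 y hy
  have dn : ∀ {f : ℝ × ℝ × ℝ → ℝ}, MemHolder 2 α b.Dbar f → (∀ y ∈ b.wall3, b.dD3 f y = 0) →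
      pd b.Ebar f3 (fun y => f (b.rs, y)) y = 0 := fun hf h0 =>
    (pd_slice hf.1 f3 hy').trans (eq_zero_on_edge3
      (contDiffOn_pd (m := 1) b.isBody_Dbar.unique hf.1 (by norm_num) e3).continuousOn h0 hy)
  have up : ∀ {f : ℝ × ℝ × ℝ → ℝ}, MemHolder 2 α b.Ωbar f → b.dΩ3 f (front b V y, y) = 0 →
      pd b.Ebar f3 (fun y => f (frontPt b V y)) y = 0 := fun hf h0 =>
    (pd_front (hf.1.differentiableOn (by norm_num)) h6 hm hy' h60).trans h0
  refine ⟨eq_zero_on_edge3 hV.reg3.1.continuousOn (fun z hz => (hV.wall3 z hz).1) hy,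
    hΨ.slip3 _ hr y hy, fun k h2 h8 => ?_⟩
  fin_cases k
  exacts [dn hV.reg1 fun z hz => (hV.wall3 z hz).2.2.1,
    dn hV.reg2 fun z hz => (hV.wall3 z hz).2.2.2.1, absurd rfl h2,
    dn hV.reg4 fun z hz => (hV.wall3 z hz).2.2.2.2.1,
    dn hV.reg5 fun z hz => (hV.wall3 z hz).2.2.2.2.2, h60, up hΨ.reg_U1 w1,
    up hΨ.reg_U2 w2, absurd rfl h8, up hΨ.reg_P wP, up hΨ.reg_K wK]

/-- The properties of the front error terms used below: regularity and edge conditions. -/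
structure IsCompatible (b : Background) (α : ℝ) (R g h : ℝ × ℝ → ℝ) : Prop where
  reg_R : IsC2H α b.Ebar R
  reg_g : ContDiffOn ℝ 2 g b.Ebar
  reg_h : ContDiffOn ℝ 2 h b.Ebar
  R_edge2 : ∀ y ∈ b.edge2, b.dE2 R y = 0
  R_edge3 : ∀ y ∈ b.edge3, b.dE3 R y = 0
  g_edge2 : ∀ y ∈ b.edge2, g y = 0
  h_edge3 : ∀ y ∈ b.edge3, h y = 0

/-- Regularity is composition of C³ functions on the ball with C^{2,α} data. On an edge the data are
fixed by the reflection: an odd term equals its negative there, and an even term has zero normal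
derivative. -/
lemma isCompatible_errors (hα0 : 0 < α) (hα1 : α < 1) (hd : IsInletData b α d)
    (hΨ : IsIncomingFlow b α ε C₀ d Ψ) (hV : MemX b α δ V)
    (hm : MapsTo (frontPt b V) b.Ebar b.Ωbar) (hU : ∀ x ∈ b.Ωbar, 0 < Ψ.U1 x)
    (hP : ∀ x ∈ b.Ωbar, 0 < Ψ.P x) (hK : ∀ x ∈ b.Ωbar, 0 < Ψ.K x) {η : ℝ} (hη : 0 < η)
    (hs : ∀ p ∈ Metric.closedBall (baseData b) η,
      ContDiffAt ℝ 3 (R1val b) p ∧ ContDiffAt ℝ 3 (g2val b) p ∧ ContDiffAt ℝ 3 (g3val b) p)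
    (hmb : MapsTo (frontData b Ψ V) b.Ebar (Metric.closedBall (baseData b) η)) :
    IsCompatible b α (R1 b Ψ V) (g2 b Ψ V) (g3 b Ψ V) := by
  have hB : IsBody (Metric.closedBall (baseData b) η) :=
    IsBody.of_interior_nonempty (convex_closedBall _ _) (isCompact_closedBall _ _)
      ⟨baseData b, Metric.ball_subset_interior_closedBall (Metric.mem_ball_self hη)⟩
  have hu := isC2H_frontData hα0 hα1 hΨ hV hm
  have hud : DifferentiableOn ℝ (frontData b Ψ V) b.Ebar := hu.1.differentiableOn (by norm_num)
  have hR : IsC2H α b.Ebar (fun y => R1val b (frontData b Ψ V y)) :=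
    (isC2H_of_contDiffOn_three hB hα1.le fun p hp => (hs p hp).1.contDiffWithinAt).comp hα0 hα1.le
      b.isBody_Ebar hB hu hmb
  have hS := b.isBody_Ebar.unique
  rw [funext (R1_eq b Ψ V), funext (g2_eq b Ψ V), funext (g3_eq b Ψ V)]
  refine ⟨hR, ?_, ?_, fun y hy => ?_, fun y hy => ?_, fun y hy => ?_, fun y hy => ?_⟩
  · exact fun y hy => ContDiffAt.comp_contDiffWithinAt (g := g2val b) y
      ((hs _ (hmb hy)).2.1.of_le (by norm_num)) (hu.1 y hy)
  · exact fun y hy => ContDiffAt.comp_contDiffWithinAt (g := g3val b) y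
      ((hs _ (hmb hy)).2.2.of_le (by norm_num)) (hu.1 y hy)
  · have hy' := b.edge2_subset hy
    obtain ⟨h1, h7, hk⟩ := frontData_edge2 hd hΨ hV hm hU hP hK hy
    exact pd_comp_eq_zero_of_flip (hS y hy') ((hs _ (hmb hy')).1.differentiableAt (by norm_num))
      (fun p => (errors_flip_angular b p).1) (hud y hy') h1 h7 hk
  · have hy' := b.edge3_subset hy
    obtain ⟨h2, h8, hk⟩ := frontData_edge3 hd hΨ hV hm hU hP hK hy
    exact pd_comp_eq_zero_of_flip (hS y hy') ((hs _ (hmb hy')).1.differentiableAt (by norm_num))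
      (fun p => (errors_flip_axial b p).1) (hud y hy') h2 h8 hk
  · obtain ⟨h1, h7, -⟩ := frontData_edge2 hd hΨ hV hm hU hP hK hy
    have h := (errors_flip_angular b (frontData b Ψ V y)).2
    rw [flip_eq_self h1 h7] at h
    linarith
  · obtain ⟨h2, h8, -⟩ := frontData_edge3 hd hΨ hV hm hU hP hK hy
    have h := (errors_flip_axial b (frontData b Ψ V y)).2
    rw [flip_eq_self h2 h8] at h
    linarith

/-- Smallness of the data puts the front data near those of the background. -/
lemma exists_small (b : Background) {C₀ : ℝ} (hC₀ : 0 < C₀) {η : ℝ} (hη : 0 < η) :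
    ∃ ε₀ > 0, ∃ δ₀ > 0, ∀ (α ε : ℝ) (d : State (ℝ × ℝ)) (Ψ : State (ℝ × ℝ × ℝ)) (V : Perturbation),
      0 < ε → ε < ε₀ → IsIncomingFlow b α ε C₀ d Ψ → MemX b α δ₀ V →
      (∀ x ∈ b.Ωbar, 0 < Ψ.U1 x) ∧ (∀ x ∈ b.Ωbar, 0 < Ψ.P x) ∧ (∀ x ∈ b.Ωbar, 0 < Ψ.K x) ∧
      MapsTo (frontPt b V) b.Ebar b.Ωbar ∧
      MapsTo (frontData b Ψ V) b.Ebar (Metric.closedBall (baseData b) η) := by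
  have hne : (Icc b.r₁ b.r₂).Nonempty := nonempty_Icc.2 b.r₁_lt_r₂.le
  have cU := b.flow_m.smooth_U.continuousOn
  have cP : ContinuousOn b.Pm (Icc b.r₁ b.r₂) :=
    continuousOn_const.mul (b.flow_m.smooth_ρ.continuousOn.rpow_const fun r hr =>
      Or.inl (b.flow_m.ρ_pos r hr).ne')
  have pP : ∀ r ∈ Icc b.r₁ b.r₂, 0 < b.Pm r := fun r hr =>
    mul_pos b.Km_pos (Real.rpow_pos_of_pos (b.flow_m.ρ_pos r hr) _)
  obtain ⟨rU, hrU, hU⟩ := isCompact_Icc.exists_isMinOn hne cU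
  obtain ⟨rP, hrP, hP⟩ := isCompact_Icc.exists_isMinOn hne cP
  have mU := b.flow_m.U_pos rU hrU
  have mP := pP rP hrP
  have hnh : Icc b.r₁ b.r₂ ∈ 𝓝 b.rs := Icc_mem_nhds b.r₁_lt_rs b.rs_lt_r₂
  -- Half of the tolerance goes to the displacement of the front in the background, the other half
  -- to the perturbation of the incoming flow.
  have ev : ∀ᶠ r in 𝓝 b.rs, r ∈ Icc b.r₁ b.r₂ ∧ |b.Um r - b.Um b.rs| < η / 2 ∧
      |b.Pm r - b.Pm b.rs| < η / 2 := by
    refine (show ∀ᶠ r in 𝓝 b.rs, r ∈ Icc b.r₁ b.r₂ from hnh).and (Eventually.and ?_ ?_)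
    · exact Metric.continuousAt_iff'.1 (cU.continuousAt hnh) (η / 2) (by positivity)
    · exact Metric.continuousAt_iff'.1 (cP.continuousAt hnh) (η / 2) (by positivity)
  obtain ⟨δ₁, hδ₁, hball⟩ := Metric.nhds_basis_closedBall.eventually_iff.1 ev
  -- The perturbation C₀ε stays below the minima of the background velocity, pressure and K, which
  -- keeps the flow positive, and below η/2. The bound δ₀ keeps the front within δ₁ of rs.
  refine ⟨min (min (b.Um rU) (b.Pm rP)) (min b.Km (η / 2)) / C₀,
    div_pos (lt_min (lt_min mU mP) (lt_min b.Km_pos (by positivity))) hC₀, min δ₁ η,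
    lt_min hδ₁ hη, fun α ε d Ψ V hε hεlt hΨ hV => ?_⟩
  have hCε : 0 < C₀ * ε := mul_pos hC₀ hε
  rw [lt_div_iff₀ hC₀, mul_comm, lt_min_iff, lt_min_iff, lt_min_iff] at hεlt
  obtain ⟨⟨sU, sP⟩, sK, sη⟩ := hεlt
  have hδ0 : 0 ≤ min δ₁ η := (lt_min hδ₁ hη).le
  have hξ : ∀ y ∈ b.Ebar, front b V y ∈ Metric.closedBall b.rs δ₁ := fun y hy => by
    rw [Metric.mem_closedBall, Real.dist_eq, front, add_sub_cancel_left]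
    exact (hV.abs_le hδ0 hy).2.2.2.2.2.trans (min_le_left _ _)
  have hm : MapsTo (frontPt b V) b.Ebar b.Ωbar := fun y hy => ⟨(hball (hξ y hy)).1, hy⟩
  refine ⟨fun x hx => ?_, fun x hx => ?_, fun x hx => ?_, hm, fun y hy => ?_⟩
  · have h1 := abs_le.1 (hΨ.abs_sub_le hCε.le hx).1
    have h2 : b.Um rU ≤ b.Um x.1 := hU hx.1
    linarith
  · have h1 := abs_le.1 (hΨ.abs_sub_le hCε.le hx).2.2.2.1
    have h2 : b.Pm rP ≤ b.Pm x.1 := hP hx.1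
    linarith
  · have h1 := abs_le.1 (hΨ.abs_sub_le hCε.le hx).2.2.2.2
    linarith
  · obtain ⟨v1, v2, v3, v4, v5, v6⟩ := hV.abs_le hδ0 hy
    obtain ⟨w1, w2, w3, wP, wK⟩ := hΨ.abs_sub_le hCε.le (hm hy)
    obtain ⟨-, z1, zP⟩ := hball (hξ y hy)
    have hδη : min δ₁ η ≤ η := min_le_right _ _
    have tri : ∀ {p q r : ℝ}, |p - q| ≤ C₀ * ε → |q - r| < η / 2 → |p - r| ≤ η := fun h1 h2 => by
      have := abs_sub_le _ _ _ |>.trans (add_le_add h1 h2.le)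
      exact this.trans (by linarith)
    rw [Metric.mem_closedBall, dist_pi_le_iff hη.le]
    intro k
    rw [Real.dist_eq]
    have vz : ∀ {p : ℝ}, |p| ≤ min δ₁ η → |p - 0| ≤ η := fun h => by
      rw [sub_zero]; exact h.trans hδη
    have wz : ∀ {p : ℝ}, |p| ≤ C₀ * ε → |p - 0| ≤ η := fun h => by rw [sub_zero]; linarith
    fin_cases k
    exacts [vz v1, vz v2, vz v3, vz v4, vz v5, vz v6, tri w1 z1, wz w2, wz w3, tri wP zP,
      wK.trans (by linarith)]

end FrontData

/-! ### The Neumann problem with the front error terms as data -/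

/-- Seen as composition with t ↦ a t on an interval containing the range of f; the added 1 keeps
that interval nondegenerate. -/
lemma IsC2H.const_mul {X : Type*} [NormedAddCommGroup X] [NormedSpace ℝ X] {S : Set X}
    (hS : IsBody S) {α : ℝ} (hα0 : 0 < α) (hα1 : α ≤ 1) {f : X → ℝ} (hf : IsC2H α S f) (a : ℝ) :
    IsC2H α S (fun x => a * f x) := by
  obtain ⟨C, hC⟩ := hS.bounded_of_continuousOn hf.1.continuousOn
  have hT : IsBody (Metric.closedBall (0 : ℝ) (|C| + 1)) :=
    IsBody.of_interior_nonempty (convex_closedBall _ _) (isCompact_closedBall _ _)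
      ⟨0, Metric.ball_subset_interior_closedBall (Metric.mem_ball_self (by positivity))⟩
  exact (isC2H_of_contDiffOn_three hT hα1 (contDiffOn_const.mul contDiffOn_id :
    ContDiffOn ℝ 3 (fun t : ℝ => a * t) _)).comp hα0 hα1 hS hT hf fun x hx =>
      mem_closedBall_zero_iff.2 ((hC x hx).trans (by linarith [le_abs_self C]))

section Neumann

variable {b : Background}

lemma SolvesNeumann.add {F G u v : ℝ × ℝ → ℝ} (hu : SolvesNeumann b F u)
    (hv : SolvesNeumann b G v) (cu : ContDiffOn ℝ 2 u b.Ebar) (cv : ContDiffOn ℝ 2 v b.Ebar) :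
    SolvesNeumann b (fun y => F y + G y) (fun y => u y + v y) := by
  have hS := b.isBody_Ebar.unique
  have du : DifferentiableOn ℝ u b.Ebar := cu.differentiableOn (by norm_num)
  have dv : DifferentiableOn ℝ v b.Ebar := cv.differentiableOn (by norm_num)
  refine ⟨fun y hy => ?_, fun y hy => ?_, fun y hy => ?_⟩
  · rw [b.lapE_add cu cv (b.E_subset hy), hu.poisson y hy, hv.poisson y hy]
  · have h1 := hu.neumann2 y hy
    have h2 := hv.neumann2 y hy
    rw [Background.dE2] at h1 h2 ⊢
    rw [pd_add hS du dv (b.edge2_subset hy), mul_add, h1, h2, add_zero]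
  · have h1 := hu.neumann3 y hy
    have h2 := hv.neumann3 y hy
    rw [Background.dE3] at h1 h2 ⊢
    rw [pd_add hS du dv (b.edge3_subset hy), h1, h2, add_zero]

lemma solvesNeumann_const (k : ℝ) : SolvesNeumann b (fun _ => 0) (fun _ => k) := by
  have h : ∀ (v y : ℝ × ℝ) (c : ℝ), pd b.Ebar v (fun _ => c) y = 0 := fun v y c => by
    rw [pd, fderivWithin_fun_const]; rfl
  have h' : ∀ v : ℝ × ℝ, pd b.Ebar v (fun _ => k) = fun _ => 0 := fun v => funext fun y => h v y k
  refine ⟨fun y _ => ?_, fun y _ => ?_, fun y _ => ?_⟩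
  · simp only [Background.lapE, Background.dE2, Background.dE3, h', h, mul_zero, add_zero]
  · rw [Background.dE2, h, mul_zero]
  · rw [Background.dE3, h]

lemma volume_E_pos (b : Background) : 0 < volume.real b.E := by
  refine ENNReal.toReal_pos (b.isOpen_E.measure_pos _ ⟨0, b.zero_mem_E⟩).ne' ?_
  exact ((measure_mono b.E_subset).trans_lt b.isBody_Ebar.compact.measure_lt_top).ne

lemma setIntegral_E_const (k : ℝ) : ∫ _ in b.E, k = volume.real b.E * k := by
  rw [setIntegral_const, smul_eq_mul]

lemma setIntegral_E_congr {f g : ℝ × ℝ → ℝ} (h : EqOn f g b.Ebar) :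
    ∫ y in b.E, f y = ∫ y in b.E, g y :=
  setIntegral_congr_fun b.isOpen_E.measurableSet (h.mono b.E_subset)

lemma eq_zero_of_mean {u v : ℝ × ℝ → ℝ} {κ : ℝ} (hv : ContinuousOn v b.Ebar)
    (h : ∀ y ∈ b.Ebar, u y = v y + κ) (hu0 : ∫ y in b.E, u y = 0) (hv0 : ∫ y in b.E, v y = 0) :
    κ = 0 := by
  rw [setIntegral_E_congr h, integral_add (b.integrableOn_E hv)
    (b.integrableOn_E continuousOn_const), hv0, zero_add, setIntegral_E_const] at hu0
  exact (mul_eq_zero.1 hu0).resolve_left (volume_E_pos b).ne'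

lemma continuousOn_lapE {m : ℝ × ℝ → ℝ} (hm : ContDiffOn ℝ 2 m b.Ebar) :
    ContinuousOn (b.lapE m) b.Ebar := by
  have hS := b.isBody_Ebar.unique
  have key : ∀ v, ContinuousOn (pd b.Ebar v (pd b.Ebar v m)) b.Ebar := fun v =>
    (contDiffOn_pd (m := 0) hS (contDiffOn_pd (m := 1) hS hm (by norm_num) v) (by norm_num)
      v).continuousOn
  exact (continuousOn_const.mul (key f2)).add (key f3)

/-- A function with vanishing normal derivative has mean-zero Laplacian. -/
lemma integral_lapE_eq_zero {m : ℝ × ℝ → ℝ} (hm : ContDiffOn ℝ 2 m b.Ebar)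
    (h2 : ∀ y ∈ b.edge2, b.dE2 m y = 0) (h3 : ∀ y ∈ b.edge3, b.dE3 m y = 0) :
    ∫ y in b.E, b.lapE m y = 0 := by
  have hS := b.isBody_Ebar.unique
  have c2 : ContDiffOn ℝ 1 (b.dE2 m) b.Ebar := contDiffOn_pd hS hm (by norm_num) f2
  have c3 : ContDiffOn ℝ 1 (b.dE3 m) b.Ebar := contDiffOn_pd hS hm (by norm_num) f3
  have h := b.integral_div_eq_zero (f := fun y => 1 / b.rs ^ 2 * b.dE2 m y) (g := b.dE3 m)
    (contDiffOn_const.mul c2) c3 (fun y hy => by rw [h2 y hy, mul_zero]) h3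
  rw [← h]
  refine setIntegral_E_congr fun y hy => ?_
  have e : b.dE2 (fun y => 1 / b.rs ^ 2 * b.dE2 m y) y = 1 / b.rs ^ 2 * b.dE2 (b.dE2 m) y :=
    pd_const_mul hS (c2.differentiableOn one_ne_zero) _ hy
  simp only [Background.lapE, e]

/-- The Neumann problem with right-hand side `a₃ (F + (rs⁻² ∂₂² + ∂₃²) R)` has a mean-zero solution,
if `F` is `C¹` with mean zero and the normal derivative of `R` vanishes on the edges. -/
lemma exists_isMeanZeroSolution {α : ℝ} (hα0 : 0 < α) (hα1 : α < 1) {F R q : ℝ × ℝ → ℝ} (a : ℝ)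
    (hF : ContDiffOn ℝ 1 F b.Ebar) (hF0 : ∫ y in b.E, F y = 0) (hR : IsC2H α b.Ebar R)
    (hR2 : ∀ y ∈ b.edge2, b.dE2 R y = 0) (hR3 : ∀ y ∈ b.edge3, b.dE3 R y = 0)
    (hq : ∀ y ∈ b.Ebar, q y = F y + b.lapE R y) :
    ∃ m, IsMeanZeroSolution b α (fun y => a * q y) m := by
  have hS := b.isBody_Ebar.unique
  have hrs := b.rs_pos
  -- Only the C¹ part of the source goes through the solver, which needs a Lipschitz right-hand
  -- side; for the Laplacian of `R` the function a R is itself a solution.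
  obtain ⟨M, κ, cM, sM⟩ := b.exists_solution_up_to_const (contDiffOn_const.mul hF :
    ContDiffOn ℝ 1 (fun y => a * F y) b.Ebar) hα0 hα1
  have M2 : ∀ y ∈ b.edge2, b.dE2 M y = 0 := fun y hy =>
    (mul_eq_zero.1 (sM.neumann2 y hy)).resolve_left (by positivity)
  -- Solvability: integrating the equation over E, the Neumann conditions make the left side vanish
  -- and F has mean zero.
  have hκ : κ = 0 := by
    have h1 := integral_lapE_eq_zero cM.1 M2 sM.neumann3
    rw [setIntegral_congr_fun b.isOpen_E.measurableSet sM.poisson,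
      integral_sub ((b.integrableOn_E hF.continuousOn).const_mul a)
      (b.integrableOn_E continuousOn_const), integral_const_mul, hF0, mul_zero, zero_sub,
      setIntegral_E_const, neg_eq_zero] at h1
    exact (mul_eq_zero.1 h1).resolve_left (volume_E_pos b).ne'
  have cR : IsC2H α b.Ebar (fun y => a * R y) := hR.const_mul b.isBody_Ebar hα0 hα1.le a
  have dR : DifferentiableOn ℝ R b.Ebar := hR.1.differentiableOn (by norm_num)
  have sR : SolvesNeumann b (fun y => a * b.lapE R y) (fun y => a * R y) := by
    refine ⟨fun y hy => b.lapE_const_mul hR.1 a (b.E_subset hy), fun y hy => ?_, fun y hy => ?_⟩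
    · have h := hR2 y hy
      rw [Background.dE2] at h ⊢
      rw [pd_const_mul hS dR a (b.edge2_subset hy), h, mul_zero, mul_zero]
    · have h := hR3 y hy
      rw [Background.dE3] at h ⊢
      rw [pd_const_mul hS dR a (b.edge3_subset hy), h, mul_zero]
  have c0 : IsC2H α b.Ebar (fun y => a * R y + M y) := cR.add b.isBody_Ebar cM
  -- Minus the average of the solution, to normalize the mean to zero.
  set k : ℝ := -((∫ y in b.E, (a * R y + M y)) / volume.real b.E) with hk
  have ck : IsC2H α b.Ebar (fun _ => k) :=
    isC2H_of_contDiffOn_three b.isBody_Ebar hα1.le contDiffOn_const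
  have s := ((sR.add sM cR.1 cM.1).add (solvesNeumann_const k) c0.1 ck.1)
  refine ⟨_, (c0.add b.isBody_Ebar ck).memHolder b.isBody_Ebar hα0.le,
    ⟨fun y hy => ?_, s.neumann2, s.neumann3⟩, ?_⟩
  · rw [s.poisson y hy, hq y (b.E_subset hy), hκ]
    ring
  · rw [integral_add (b.integrableOn_E c0.1.continuousOn) (b.integrableOn_E continuousOn_const),
      setIntegral_E_const, hk, mul_neg, mul_div_cancel₀ _ (volume_E_pos b).ne', add_neg_cancel]

lemma IsMeanZeroSolution.eqOn {α : ℝ} {F u v : ℝ × ℝ → ℝ} (hu : IsMeanZeroSolution b α F u)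
    (hv : IsMeanZeroSolution b α F v) : EqOn u v b.Ebar := by
  obtain ⟨κ, hκ⟩ := b.exists_const_of_solvesNeumann hu.reg.1 hv.reg.1 hu.solves hv.solves
  have := eq_zero_of_mean hv.reg.1.continuousOn hκ hu.mean hv.mean
  intro y hy
  rw [hκ y hy, this, add_zero]

/-- One derivative is lost in ∂₁φ; the remaining C² regularity is what the uniqueness result for the
Neumann problem requires. -/
lemma contDiffOn_obliqueTrace {φ : ℝ × ℝ × ℝ → ℝ} (hφ : ContDiffOn ℝ 3 φ b.Dbar) :
    ContDiffOn ℝ 2 (obliqueTrace b φ) b.Ebar := by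
  have hm : MapsTo (fun y : ℝ × ℝ => (b.rs, y)) b.Ebar b.Dbar := fun y hy =>
    ⟨left_mem_Icc.2 b.rs_lt_r₂.le, hy⟩
  have hs : ContDiffOn ℝ 2 (fun y : ℝ × ℝ => (b.rs, y)) b.Ebar :=
    contDiffOn_const.prodMk contDiffOn_id
  have h1 : ContDiffOn ℝ 2 (b.dD1 φ) b.Dbar :=
    contDiffOn_pd b.isBody_Dbar.unique hφ (by norm_num) e1
  exact (h1.comp hs hm).sub (contDiffOn_const.mul ((hφ.of_le (by norm_num)).comp hs hm))

lemma obliqueTrace_add_const (φ : ℝ × ℝ × ℝ → ℝ) (c : ℝ) (y : ℝ × ℝ) :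
    obliqueTrace b (fun z => φ z + c) y = obliqueTrace b φ y - b.a4 * c := by
  rw [obliqueTrace, obliqueTrace, Background.dD1, Background.dD1, pd, pd,
    fderivWithin_add_const]
  ring

/-- The oblique boundary condition for front potentials. -/
lemma IsFrontPotential.oblique {α : ℝ} {q m : ℝ × ℝ → ℝ} {φ : ℝ × ℝ × ℝ → ℝ}
    (hφ : IsFrontPotential b q φ) (hm : IsMeanZeroSolution b α (fun y => b.a3 * q y) m) :
    (∃! c : ℝ, ∀ y ∈ b.Ebar, obliqueTrace b (fun z => φ z + c) y = m y) ∧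
      ((∫ y in b.E, obliqueTrace b φ y) = 0 → ∀ y ∈ b.Ebar, obliqueTrace b φ y = m y) := by
  obtain ⟨κ, hκ⟩ := b.exists_const_of_solvesNeumann (contDiffOn_obliqueTrace hφ.reg) hm.reg.1
    hφ.front hm.solves
  have ha := b.a4_ne_zero
  -- The trace is m + κ, and adding c lowers it by a₄c. The condition at the single point 0 already
  -- determines c.
  refine ⟨⟨κ / b.a4, fun y hy => ?_, fun c hc => ?_⟩, fun h y hy => ?_⟩
  · rw [obliqueTrace_add_const, hκ y hy]
    field_simp
    ring
  · have h0 := b.E_subset b.zero_mem_E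
    have h := hc 0 h0
    rw [obliqueTrace_add_const, hκ 0 h0] at h
    rw [eq_div_iff ha]
    linarith
  · rw [hκ y hy, eq_zero_of_mean hm.reg.1.continuousOn hκ h hm.mean, add_zero]

end Neumann

/-! ### Divergence structure of the source term. -/

section SourceTerm

variable {b : Background} {α : ℝ} {Ψ : State (ℝ × ℝ × ℝ)} {V : Perturbation}
  {G1 G2 G3 W1 W2 W3 : ℝ × ℝ × ℝ → ℝ}

/-- The source term is the sum of a mean-zero `C¹` function and of the Laplacian of `R₁`. -/
lemma q5_decomposition (hα0 : 0 < α) (hα1 : α < 1)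
    (hc : IsCompatible b α (R1 b Ψ V) (g2 b Ψ V) (g3 b Ψ V))
    (hW : IsDivCurlSolution b α G1 G2 G3 W1 W2 W3) :
    ∃ F : ℝ × ℝ → ℝ, ContDiffOn ℝ 1 F b.Ebar ∧ (∫ y in b.E, F y) = 0 ∧
      ∀ y ∈ b.Ebar, q5 b Ψ V W2 W3 y = F y + b.lapE (R1 b Ψ V) y := by
  have hS := b.isBody_Ebar.unique
  have c2 : ContDiffOn ℝ 2 (fun y => W2 (b.rs, y)) b.Ebar := (IsC2H.slice hα0 hα1 hW.reg2).1
  have c3 : ContDiffOn ℝ 2 (fun y => W3 (b.rs, y)) b.Ebar := (IsC2H.slice hα0 hα1 hW.reg3).1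
  have dif : ∀ {f : ℝ × ℝ → ℝ}, ContDiffOn ℝ 2 f b.Ebar → DifferentiableOn ℝ f b.Ebar :=
    fun hf => hf.differentiableOn (by norm_num)
  have e2 : ∀ y ∈ b.Ebar, b.dE2 (fun y => b.a1 * (1 / b.rs) * g2 b Ψ V y +
      b.a0 * b.a1 * (1 / b.rs) * W2 (b.rs, y)) y =
      b.a1 * (1 / b.rs) * b.dE2 (g2 b Ψ V) y + b.a0 * b.a1 * (1 / b.rs) * b.dD2 W2 (b.rs, y) := by
    intro y hy
    have h := pd_slice hW.reg2.1 f2 hy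
    rw [Background.dE2, Background.dE2, pd_add (f := fun y => b.a1 * (1 / b.rs) * g2 b Ψ V y)
      (g := fun y => b.a0 * b.a1 * (1 / b.rs) * W2 (b.rs, y)) hS ((dif hc.reg_g).const_mul _)
      ((dif c2).const_mul _) hy, pd_const_mul hS (dif hc.reg_g) _ hy,
      pd_const_mul (f := fun y => W2 (b.rs, y)) hS (dif c2) _ hy, h]
    rfl
  have e3 : ∀ y ∈ b.Ebar, b.dE3 (fun y => b.a1 * g3 b Ψ V y + b.a0 * b.a1 * W3 (b.rs, y)) y =
      b.a1 * b.dE3 (g3 b Ψ V) y + b.a0 * b.a1 * b.dD3 W3 (b.rs, y) := by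
    intro y hy
    have h := pd_slice hW.reg3.1 f3 hy
    rw [Background.dE3, Background.dE3, pd_add (f := fun y => b.a1 * g3 b Ψ V y)
      (g := fun y => b.a0 * b.a1 * W3 (b.rs, y)) hS ((dif hc.reg_h).const_mul _)
      ((dif c3).const_mul _) hy, pd_const_mul hS (dif hc.reg_h) _ hy,
      pd_const_mul (f := fun y => W3 (b.rs, y)) hS (dif c3) _ hy, h]
    rfl
  -- `f` and `g` are the components of the field whose divergence is the C¹ part of the source. Each
  -- vanishes on its own pair of edges: the error term by parity, the trace of the div-curl solution
  -- by its wall condition.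
  set f : ℝ × ℝ → ℝ := fun y => b.a1 * (1 / b.rs) * g2 b Ψ V y +
    b.a0 * b.a1 * (1 / b.rs) * W2 (b.rs, y)
  set g : ℝ × ℝ → ℝ := fun y => b.a1 * g3 b Ψ V y + b.a0 * b.a1 * W3 (b.rs, y)
  have cf : ContDiffOn ℝ 2 f b.Ebar :=
    (contDiffOn_const.mul hc.reg_g).add (contDiffOn_const.mul c2)
  have cg : ContDiffOn ℝ 2 g b.Ebar :=
    (contDiffOn_const.mul hc.reg_h).add (contDiffOn_const.mul c3)
  refine ⟨fun y => b.dE2 f y + b.dE3 g y, (contDiffOn_pd hS cf (by norm_num) f2).add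
    (contDiffOn_pd hS cg (by norm_num) f3), b.integral_div_eq_zero (cf.of_le (by norm_num))
    (cg.of_le (by norm_num)) (fun y hy => ?_) (fun y hy => ?_), fun y hy => ?_⟩
  · simp only [f, hc.g_edge2 y hy, eq_zero_on_edge2 hW.reg2.1.continuousOn hW.wall2 hy, mul_zero,
      add_zero]
  · simp only [g, hc.h_edge3 y hy, eq_zero_on_edge3 hW.reg3.1.continuousOn hW.wall3 hy, mul_zero,
      add_zero]
  · simp only [e2 y hy, e3 y hy, q5, q1]
    ring

end SourceTerm

end TransonicShock

/-! ### The main theorem. -/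

open TransonicShock
theorem lemma3p2 (b : Background) (α : ℝ) (hα0 : 0 < α) (hα1 : α < 1)
    (d : State (ℝ × ℝ)) (hd : IsInletData b α d) (C₀ : ℝ) (hC₀ : 0 < C₀) :
    ∃ ε₀ > 0, ∃ δ₀ > 0, ∀ ε : ℝ, 0 < ε → ε < ε₀ →
      ∀ Ψ : State (ℝ × ℝ × ℝ), IsIncomingFlow b α ε C₀ d Ψ →
      ∀ V : Perturbation, MemX b α δ₀ V →
      ∀ G1 G2 G3 W1 W2 W3 : ℝ × ℝ × ℝ → ℝ, IsDivCurlSolution b α G1 G2 G3 W1 W2 W3 →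
        (IntegrableOn (q5 b Ψ V W2 W3) b.E ∧ (∫ y in b.E, q5 b Ψ V W2 W3 y) = 0) ∧
        ∃ m₁ : ℝ × ℝ → ℝ,
          IsMeanZeroSolution b α (fun y => b.a3 * q5 b Ψ V W2 W3 y) m₁ ∧
          (∀ m : ℝ × ℝ → ℝ, IsMeanZeroSolution b α (fun y => b.a3 * q5 b Ψ V W2 W3 y) m →
            EqOn m m₁ b.Ebar) ∧
          ∀ φ : ℝ × ℝ × ℝ → ℝ, IsFrontPotential b (q5 b Ψ V W2 W3) φ →
            (∃! c : ℝ, ∀ y ∈ b.Ebar, obliqueTrace b (fun z => φ z + c) y = m₁ y) ∧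
            ((∫ y in b.E, obliqueTrace b φ y) = 0 → ∀ y ∈ b.Ebar, obliqueTrace b φ y = m₁ y) := by
  obtain ⟨η, hη, hs⟩ := exists_closedBall_contDiffAt_errors b
  -- The thresholds depend only on the background and on C₀, through the radius η of the ball where
  -- the error terms are C³.
  obtain ⟨ε₀, hε₀, δ₀, hδ₀, hsmall⟩ := exists_small b hC₀ hη
  refine ⟨ε₀, hε₀, δ₀, hδ₀, fun ε hε hεlt Ψ hΨ V hV G1 G2 G3 W1 W2 W3 hW => ?_⟩
  obtain ⟨hU, hP, hK, hm, hmb⟩ := hsmall α ε d Ψ V hε hεlt hΨ hV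
  have hc := isCompatible_errors hα0 hα1 hd hΨ hV hm hU hP hK hη hs hmb
  obtain ⟨F, cF, iF, hq⟩ := q5_decomposition hα0 hα1 hc hW
  have cL := continuousOn_lapE hc.reg_R.1
  obtain ⟨m₁, hm₁⟩ := exists_isMeanZeroSolution hα0 hα1 b.a3 cF iF hc.reg_R hc.R_edge2 hc.R_edge3 hq
  refine ⟨⟨?_, ?_⟩, m₁, hm₁, fun m h => h.eqOn hm₁, fun φ hφ => hφ.oblique hm₁⟩
  · exact b.integrableOn_E ((cF.continuousOn.add cL).congr hq)
  · rw [setIntegral_E_congr hq, integral_add (b.integrableOn_E cF.continuousOn)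
      (b.integrableOn_E cL), iF, integral_lapE_eq_zero hc.reg_R.1 hc.R_edge2 hc.R_edge3, add_zero]
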